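/- Let $k$ be a field; all algebras are $k$-algebras (possibly without unit) that are non-zero and non-degenerate ($ab=0$ for all $b$ implies $a=0$, and $ba=0$ for all $b$ implies $a=0$), $M(B)$ denotes the multiplier algebra of $B$, and homomorphisms and automorphisms are extended to multiplier algebras in the canonical way. Let $(A,\Delta)$ be an algebraic quantum group, i.e. a regular multiplier Hopf algebra with a non-zero left invariant functional $\varphi$. Denote by $\varepsilon$ its counit and by $S$ its antipode, put $\psi=\varphi\circ S$, let $\sigma,\sigma'$ be the modular automorphisms of $\varphi,\psi$ (so $\varphi(ab)=\varphi(b\sigma(a))$ and $\psi(ab)=\psi(b\sigma'(a))$), $\delta\in M(A)$ the modular element ($(\varphi\otimes\iota)\Delta(a)=\varphi(a)\delta$) and $\tau\in k$ the scaling constant ($\varphi\circ S^2=\tau\varphi$). Let $\hat A=\{\varphi(\,\cdot\,a)\mid a\in A\}$ be the dual, with product $(\omega\omega')(a)=(\omega\otimes\omega')(\Delta(a))$, coproduct $\hat\Delta(\omega)(a\otimes b)=\omega(ab)$ and left invariant functional $\hat\varphi(\psi(a\,\cdot\,))=\varepsilon(a)$, and let $\hat\delta\in M(\hat A)$ be its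 modular element, $(\hat\varphi\otimes\iota)\hat\Delta(\omega)=\hat\varphi(\omega)\hat\delta$. Let $(X,\alpha)$ be a right $A$-Galois object: $\alpha:X\to M(X\otimes A)$ is an injective homomorphism with $\alpha(X)(1\otimes A)$, $(1\otimes A)\alpha(X)$ and $(X\otimes1)\alpha(X)$ contained in $X\otimes A$ and $(\alpha\otimes\iota)\alpha=(\iota\otimes\Delta)\alpha$, the only $f\in M(X)$ with $\alpha(f)=f\otimes1$ are the scalars, and $V:X\otimes X\to X\otimes A$, $x\otimes y\mapsto(x\otimes1)\alpha(y)$, is bijective; then $W:x\otimes y\mapsto\alpha(x)(y\otimes 1)$ is also a bijection $X\otimes X\to X\otimes A$. For $a\in A$ let $\beta(a)\in M(X\otimes X)$ be given by $(x\otimes1)\beta(a)=V^{-1}(x\otimes a)$ and $\beta(a)(1\otimes y)=W^{-1}(y\otimes S(a))$, and let $\tilde\beta:A\to M(X^{\rm op}\otimes X)$ be $\beta$ regarded as a homomorphism into $M(X^{\rm op}\otimes X)$. Let $\varphi_X$ be the functional on $X$ with $(\iota\otimes\varphi)\alpha(x)=\varphi_X(x)1$, let $\psi_X$ be a non-zero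 invariant functional on $X$ ($(\psi_X\otimes\iota)\alpha(x)=\psi_X(x)1$), let $\delta_X\in M(X)$ be the invertible element with $\varphi_X(x\delta_X)=\psi_X(x)$, and let $\sigma_X$ be the automorphism of $X$ with $\varphi_X(y\sigma_X(x))=\varphi_X(xy)$. Let $\hat A$ act on $X$ by $\omega\cdot x=(\iota\otimes\omega)\alpha(x)$, extend this action to $M(\hat A)$ by $m\cdot(\omega\cdot x)=(m\omega)\cdot x$, and let $\theta_X(x)=\sigma_X(\hat\delta\cdot x)$, an automorphism of $X$. All these objects exist (for every choice of $\varphi$ and $\psi_X$; a $\psi_X$ exists), and \begin{align*} &\text{(iii)}\ \alpha(\delta_X)=\delta_X\otimes\delta, &&\text{(iv)}\ \tilde\beta(\delta)=\delta_X^{-1}\otimes\delta_X, &&\text{(v)}\ \sigma_X(\delta_X)=\tau^{-1}\delta_X,\\ &\text{(vi)}\ \alpha\circ\sigma_X=(\theta_X\otimes\sigma)\circ\alpha, &&\text{(vii)}\ \alpha\circ\theta_X=(\theta_X\otimes S^2)\circ\alpha, &&\text{(viii)}\ \alpha\circ\theta_X=(\sigma_X\otimes\sigma'^{-1})\circ\alpha,\\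 &\text{(ix)}\ \sigma_X\circ\theta_X=\theta_X\circ\sigma_X, &&\text{(x)}\ \theta_X(\delta_X)=\delta_X, &&\text{(xi)}\ \varphi_X\circ\theta_X=\varphi_X(\delta_X^{-1}\,\cdot\,\delta_X)=\tau\varphi_X. \end{align*} In particular the scaling constant of $X$, i.e. the unique $c\in k$ with $\varphi_X\circ\theta_X=c\,\varphi_X$, equals $\tau$. -/

import Mathlib

open scoped TensorProduct

noncomputable section

namespace GaloisObj

/-! ### Multiplier algebras -/

section Multiplier

/-- The multiplier algebra of `A`: pairs `(l, r)` of linear maps with `a * l b = r a * b`.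
The second component lives in the opposite algebra of endomorphisms, so that the product of
`(l, r)` and `(l', r')` is `(l ∘ l', r' ∘ r)`. -/
def multSubalgebra (k A : Type*) [Field k] [NonUnitalNonAssocRing A] [Module k A]
    [IsScalarTower k A A] [SMulCommClass k A A] :
    Subalgebra k (Module.End k A × (Module.End k A)ᵐᵒᵖ) where
  carrier := {p | ∀ a b : A, a * p.1 b = p.2.unop a * b}
  mul_mem' := by
    intro p q hp hq a b
    have hp' : ∀ a b : A, a * p.1 b = p.2.unop a * b := hp
    have hq' : ∀ a b : A, a * q.1 b = q.2.unop a * b := hq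
    simp [hp', hq']
  add_mem' := by
    intro p q hp hq a b
    have hp' : ∀ a b : A, a * p.1 b = p.2.unop a * b := hp
    have hq' : ∀ a b : A, a * q.1 b = q.2.unop a * b := hq
    simp [hp', hq', mul_add, add_mul]
  algebraMap_mem' := by
    intro c a b
    simp [Module.algebraMap_end_apply, mul_smul_comm, smul_mul_assoc]

/-- The multiplier algebra `M(A)`. -/
abbrev Mult (k A : Type*) [Field k] [NonUnitalNonAssocRing A] [Module k A]
    [IsScalarTower k A A] [SMulCommClass k A A] : Type _ :=
  ↥(multSubalgebra k A)

namespace Mult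

section NonAssoc

variable {k A : Type*} [Field k] [NonUnitalNonAssocRing A] [Module k A]
  [IsScalarTower k A A] [SMulCommClass k A A]

/-- `m.lmul a` is the product `m a`. -/
def lmul (m : Mult k A) : A →ₗ[k] A := m.1.1

/-- `m.rmul a` is the product `a m`. -/
def rmul (m : Mult k A) : A →ₗ[k] A := m.1.2.unop

theorem central (m : Mult k A) (a b : A) : a * m.lmul b = m.rmul a * b := m.2 a b

/-- The multiplier with prescribed left and right multiplication maps. -/
def mk (l r : A →ₗ[k] A) (h : ∀ a b, a * l b = r a * b) : Mult k A :=
  ⟨(l, MulOpposite.op r), h⟩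

@[ext]
theorem ext {m n : Mult k A} (hl : ∀ a, m.lmul a = n.lmul a) (hr : ∀ a, m.rmul a = n.rmul a) :
    m = n :=
  Subtype.ext (Prod.ext (LinearMap.ext hl) (MulOpposite.unop_injective (LinearMap.ext hr)))

@[simp] theorem lmul_mk (l r : A →ₗ[k] A) (h) (a : A) : (mk l r h).lmul a = l a := rfl
@[simp] theorem rmul_mk (l r : A →ₗ[k] A) (h) (a : A) : (mk l r h).rmul a = r a := rfl
@[simp] theorem lmul_mul (m n : Mult k A) (a : A) : (m * n).lmul a = m.lmul (n.lmul a) := rfl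
@[simp] theorem rmul_mul (m n : Mult k A) (a : A) : (m * n).rmul a = n.rmul (m.rmul a) := rfl
@[simp] theorem lmul_one (a : A) : (1 : Mult k A).lmul a = a := rfl
@[simp] theorem rmul_one (a : A) : (1 : Mult k A).rmul a = a := rfl

/-- A multiplier of `A`, seen as a multiplier of the opposite algebra. -/
def op (m : Mult k A) : Mult k Aᵐᵒᵖ :=
  mk ((MulOpposite.opLinearEquiv k).toLinearMap ∘ₗ m.rmul ∘ₗ
        (MulOpposite.opLinearEquiv k).symm.toLinearMap)
    ((MulOpposite.opLinearEquiv k).toLinearMap ∘ₗ m.lmul ∘ₗ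
        (MulOpposite.opLinearEquiv k).symm.toLinearMap)
    (fun a b => MulOpposite.unop_injective (by simp [central]))

end NonAssoc

section Assoc

variable {k A B : Type*} [Field k]
  [NonUnitalRing A] [Module k A] [IsScalarTower k A A] [SMulCommClass k A A]
  [NonUnitalRing B] [Module k B] [IsScalarTower k B B] [SMulCommClass k B B]

/-- The canonical map `A → M(A)`. -/
def incl (a : A) : Mult k A :=
  mk (LinearMap.mulLeft k a) (LinearMap.mulRight k a) (fun x y => by simp [mul_assoc])

@[simp] theorem lmul_incl (a b : A) : (incl a : Mult k A).lmul b = a * b := rfl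
@[simp] theorem rmul_incl (a b : A) : (incl a : Mult k A).rmul b = b * a := rfl

/-- The multiplier `m ⊗ n` of `A ⊗ B`. -/
def tmul (m : Mult k A) (n : Mult k B) : Mult k (A ⊗[k] B) :=
  mk (TensorProduct.map m.lmul n.lmul) (TensorProduct.map m.rmul n.rmul) (fun s t => by
    induction s with
    | zero => simp
    | add s s' hs hs' => simp [add_mul, hs, hs']
    | tmul a b =>
      induction t with
      | zero => simp
      | add t t' ht ht' => simp [mul_add, ht, ht']
      | tmul c d => simp [central])

/-- For a homomorphism `f : A → M(B)`, the multiplier `n` of `B` is compatible with `f` as a value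
at the multiplier `m` of `A`: `n f(a) = f(m a)` and `f(a) n = f(a m)`. -/
def IsExtensionAt (f : A →ₙₐ[k] Mult k B) (m : Mult k A) (n : Mult k B) : Prop :=
  ∀ a : A, n * f a = f (m.lmul a) ∧ f a * n = f (m.rmul a)

/-- The canonical extension of `f : A → M(B)` to `M(A)` takes a well-determined value at `m`, and
this value is `n`. -/
def ExtendsTo (f : A →ₙₐ[k] Mult k B) (m : Mult k A) (n : Mult k B) : Prop :=
  IsExtensionAt f m n ∧ ∀ n' : Mult k B, IsExtensionAt f m n' → n' = n

end Assoc

end Mult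

/-- Automorphisms of a (non-unital) `k`-algebra. -/
structure AlgAut (k A : Type*) [Field k] [NonUnitalNonAssocRing A] [Module k A] extends
    A ≃ₗ[k] A where
  map_mul' : ∀ a b : A, toFun (a * b) = toFun a * toFun b

namespace AlgAut

section NonAssoc

variable {k A : Type*} [Field k] [NonUnitalNonAssocRing A] [Module k A]

instance : CoeFun (AlgAut k A) (fun _ => A → A) := ⟨fun s => s.toLinearEquiv⟩

theorem map_mul (s : AlgAut k A) (a b : A) :
    s.toLinearEquiv (a * b) = s.toLinearEquiv a * s.toLinearEquiv b := s.map_mul' a b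

/-- The inverse automorphism. -/
def symm (s : AlgAut k A) : AlgAut k A where
  toLinearEquiv := s.toLinearEquiv.symm
  map_mul' a b := by
    change s.toLinearEquiv.symm (a * b) = s.toLinearEquiv.symm a * s.toLinearEquiv.symm b
    apply s.toLinearEquiv.injective
    simp [map_mul]

variable [IsScalarTower k A A] [SMulCommClass k A A]

/-- The extension of an automorphism of `A` to `M(A)`, determined by `s(m) s(a) = s(m a)` and
`s(a) s(m) = s(a m)`. -/
def onMult (s : AlgAut k A) (m : Mult k A) : Mult k A :=
  Mult.mk (s.toLinearEquiv.toLinearMap ∘ₗ m.lmul ∘ₗ s.toLinearEquiv.symm.toLinearMap)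
    (s.toLinearEquiv.toLinearMap ∘ₗ m.rmul ∘ₗ s.toLinearEquiv.symm.toLinearMap) (fun a b => by
      apply s.toLinearEquiv.symm.injective
      have h := s.symm.map_mul
      simp only [symm] at h
      simp [h, Mult.central])

end NonAssoc

variable {k A B : Type*} [Field k]
  [NonUnitalRing A] [Module k A] [IsScalarTower k A A] [SMulCommClass k A A]
  [NonUnitalRing B] [Module k B] [IsScalarTower k B B] [SMulCommClass k B B]

/-- The automorphism `s ⊗ t` of `A ⊗ B`. -/
def tensor (s : AlgAut k A) (t : AlgAut k B) : AlgAut k (A ⊗[k] B) where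
  toLinearEquiv := TensorProduct.congr s.toLinearEquiv t.toLinearEquiv
  map_mul' x y := by
    change TensorProduct.congr s.toLinearEquiv t.toLinearEquiv (x * y) =
      TensorProduct.congr s.toLinearEquiv t.toLinearEquiv x *
        TensorProduct.congr s.toLinearEquiv t.toLinearEquiv y
    induction x with
    | zero => simp
    | add x x' hx hx' => simp only [add_mul, map_add, hx, hx']
    | tmul a b =>
      induction y with
      | zero => simp
      | add y y' hy hy' => simp only [mul_add, map_add, hy, hy']
      | tmul c d => simp [map_mul]

end AlgAut

end Multiplier

/-! ### Slice maps -/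

section Slice

variable {k A B : Type*} [Field k] [AddCommGroup A] [Module k A] [AddCommGroup B] [Module k B]

/-- `ω ⊗ ι : A ⊗ B → B`. -/
def sliceL (ω : A →ₗ[k] k) : A ⊗[k] B →ₗ[k] B :=
  (TensorProduct.lid k B).toLinearMap ∘ₗ TensorProduct.map ω LinearMap.id

/-- `ι ⊗ ω : A ⊗ B → A`. -/
def sliceR (ω : B →ₗ[k] k) : A ⊗[k] B →ₗ[k] A :=
  (TensorProduct.rid k A).toLinearMap ∘ₗ TensorProduct.map LinearMap.id ω

/-- `ω ⊗ ω' : A ⊗ B → k`. -/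
def pair (ω : A →ₗ[k] k) (ω' : B →ₗ[k] k) : A ⊗[k] B →ₗ[k] k :=
  (TensorProduct.lid k k).toLinearMap ∘ₗ TensorProduct.map ω ω'

@[simp] theorem sliceL_tmul (ω : A →ₗ[k] k) (a : A) (b : B) :
    sliceL ω (a ⊗ₜ[k] b) = ω a • b := by simp [sliceL]
@[simp] theorem sliceR_tmul (ω : B →ₗ[k] k) (a : A) (b : B) :
    sliceR ω (a ⊗ₜ[k] b) = ω b • a := by simp [sliceR]
@[simp] theorem pair_tmul (ω : A →ₗ[k] k) (ω' : B →ₗ[k] k) (a : A) (b : B) :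
    pair ω ω' (a ⊗ₜ[k] b) = ω a * ω' b := by simp [pair]

end Slice

/-! ### Algebraic quantum groups -/

/-- An algebraic quantum group `(A, Δ)`: a regular multiplier Hopf algebra, together with a chosen
non-zero left invariant functional `φ`. The four maps `T` are determined by `Δ`; having them as
linear equivalences says that the four canonical maps are bijections of `A ⊗ A`. -/
structure AlgebraicQuantumGroup (k A : Type*) [Field k] [NonUnitalRing A] [Module k A]
    [IsScalarTower k A A] [SMulCommClass k A A] where
  nondeg_left : ∀ a : A, (∀ b : A, a * b = 0) → a = 0
  nondeg_right : ∀ a : A, (∀ b : A, b * a = 0) → a = 0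
  /-- the comultiplication `Δ` -/
  comul : A →ₙₐ[k] Mult k (A ⊗[k] A)
  comul_nondeg_left : Submodule.span k {t : A ⊗[k] A | ∃ a s, t = (comul a).lmul s} = ⊤
  comul_nondeg_right : Submodule.span k {t : A ⊗[k] A | ∃ a s, t = (comul a).rmul s} = ⊤
  /-- `a ⊗ b ↦ Δ(a)(1 ⊗ b)` -/
  TΔ2 : A ⊗[k] A ≃ₗ[k] A ⊗[k] A
  TΔ2_spec : ∀ a b : A, Mult.incl (TΔ2 (a ⊗ₜ b)) = comul a * Mult.tmul 1 (Mult.incl b)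
  /-- `a ⊗ b ↦ (a ⊗ 1)Δ(b)` -/
  T1Δ : A ⊗[k] A ≃ₗ[k] A ⊗[k] A
  T1Δ_spec : ∀ a b : A, Mult.incl (T1Δ (a ⊗ₜ b)) = Mult.tmul (Mult.incl a) 1 * comul b
  /-- `a ⊗ b ↦ Δ(a)(b ⊗ 1)` -/
  TΔ1 : A ⊗[k] A ≃ₗ[k] A ⊗[k] A
  TΔ1_spec : ∀ a b : A, Mult.incl (TΔ1 (a ⊗ₜ b)) = comul a * Mult.tmul (Mult.incl b) 1
  /-- `a ⊗ b ↦ (1 ⊗ a)Δ(b)` -/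
  T2Δ : A ⊗[k] A ≃ₗ[k] A ⊗[k] A
  T2Δ_spec : ∀ a b : A, Mult.incl (T2Δ (a ⊗ₜ b)) = Mult.tmul 1 (Mult.incl a) * comul b
  /-- coassociativity, covered by `a` on the left of the first leg and by `c` on the right of the
  third: `(a ⊗ 1 ⊗ 1)(Δ ⊗ ι)(Δ(b)(1 ⊗ c)) = (ι ⊗ Δ)((a ⊗ 1)Δ(b))(1 ⊗ 1 ⊗ c)` -/
  coassoc : ∀ a b c : A,
    TensorProduct.map T1Δ.toLinearMap LinearMap.id
        ((TensorProduct.assoc k A A A).symm (a ⊗ₜ TΔ2 (b ⊗ₜ c))) =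
      (TensorProduct.assoc k A A A).symm
        (TensorProduct.map LinearMap.id TΔ2.toLinearMap
          (TensorProduct.assoc k A A A (T1Δ (a ⊗ₜ b) ⊗ₜ c)))
  /-- the left invariant functional `φ` -/
  φ : A →ₗ[k] k
  φ_ne_zero : φ ≠ 0
  /-- `(ι ⊗ φ)(Δ(a)(b ⊗ 1)) = φ(a) b` -/
  φ_invariant : ∀ a b : A, sliceR φ (TΔ1 (a ⊗ₜ b)) = φ a • b

/-! ### The dual algebra -/

section Nondeg

theorem map_id_injective {k A B : Type*} [Field k] [AddCommGroup A] [Module k A]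
    [AddCommGroup B] [Module k B] {I : Type*} (f : I → B →ₗ[k] B) (hf : ∀ b, (∀ i, f i b = 0) → b = 0)
    (u : A ⊗[k] B) (hu : ∀ i, TensorProduct.map LinearMap.id (f i) u = 0) : u = 0 := by
  classical
  let bA := Module.Basis.ofVectorSpace k A
  apply (TensorProduct.equivFinsuppOfBasisLeft (N := B) bA).injective
  rw [map_zero]
  ext i
  apply hf
  intro d
  have h := congrArg (fun z => TensorProduct.equivFinsuppOfBasisLeft (N := B) bA z i) (hu d)
  simp only [map_zero, Finsupp.coe_zero, Pi.zero_apply] at h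
  rw [← h]
  generalize u = v
  induction v with
  | zero => simp
  | add v w hv hw => simp only [map_add, Finsupp.add_apply, hv, hw]
  | tmul a b => simp

theorem map_injective_id {k A B : Type*} [Field k] [AddCommGroup A] [Module k A]
    [AddCommGroup B] [Module k B] {I : Type*} (f : I → A →ₗ[k] A) (hf : ∀ b, (∀ i, f i b = 0) → b = 0)
    (u : A ⊗[k] B) (hu : ∀ i, TensorProduct.map (f i) LinearMap.id u = 0) : u = 0 := by
  apply (TensorProduct.comm k A B).injective
  rw [map_zero]
  apply map_id_injective f hf
  intro i
  have h := congrArg (TensorProduct.comm k A B) (hu i)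
  rw [map_zero] at h
  rw [← h]
  generalize u = v
  induction v with
  | zero => simp
  | add v w hv hw => simp only [map_add, hv, hw]
  | tmul a b => simp

variable {k A B : Type*} [Field k]
  [NonUnitalRing A] [Module k A] [IsScalarTower k A A] [SMulCommClass k A A]
  [NonUnitalRing B] [Module k B] [IsScalarTower k B B] [SMulCommClass k B B]

/-- The tensor product of non-degenerate algebras is non-degenerate. -/
theorem tensor_nondeg_left (hA : ∀ a : A, (∀ b : A, a * b = 0) → a = 0)
    (hB : ∀ a : B, (∀ b : B, a * b = 0) → a = 0)
    (t : A ⊗[k] B) (ht : ∀ s, t * s = 0) : t = 0 := by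
  apply map_injective_id (fun c => LinearMap.mulRight k c) hA
  intro c
  apply map_id_injective (fun c => LinearMap.mulRight k c) hB
  intro d
  rw [← ht (c ⊗ₜ d)]
  generalize t = v
  induction v with
  | zero => simp
  | add v w hv hw => simp only [map_add, add_mul, hv, hw]
  | tmul a b => simp

theorem tensor_nondeg_right (hA : ∀ a : A, (∀ b : A, b * a = 0) → a = 0)
    (hB : ∀ a : B, (∀ b : B, b * a = 0) → a = 0)
    (t : A ⊗[k] B) (ht : ∀ s, s * t = 0) : t = 0 := by
  apply map_injective_id (fun c => LinearMap.mulLeft k c) hA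
  intro c
  apply map_id_injective (fun c => LinearMap.mulLeft k c) hB
  intro d
  rw [← ht (c ⊗ₜ d)]
  generalize t = v
  induction v with
  | zero => simp
  | add v w hv hw => simp only [map_add, mul_add, hv, hw]
  | tmul a b => simp

theorem Mult.incl_injective (hA : ∀ a : A, (∀ b : A, a * b = 0) → a = 0) :
    Function.Injective (Mult.incl : A → Mult k A) := by
  intro s t h
  rw [← sub_eq_zero]
  apply hA
  intro u
  have := congrArg (fun m => Mult.lmul m u) h
  simp only [Mult.lmul_incl] at this
  rw [sub_mul, this, sub_self]

theorem Mult.lmul_mul_eq (hA : ∀ a : A, (∀ b : A, b * a = 0) → a = 0) (m : Mult k A) (s t : A) :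
    m.lmul (s * t) = m.lmul s * t := by
  rw [← sub_eq_zero]
  apply hA
  intro w
  rw [mul_sub, Mult.central, ← mul_assoc, ← mul_assoc, Mult.central, sub_self]

theorem Mult.mul_incl (hA : ∀ a : A, (∀ b : A, b * a = 0) → a = 0) (m : Mult k A) (s : A) :
    m * Mult.incl s = Mult.incl (m.lmul s) := by
  ext u
  · simp [Mult.lmul_mul_eq hA]
  · simp [Mult.central]

end Nondeg

namespace AlgebraicQuantumGroup

variable {k A : Type*} [Field k] [NonUnitalRing A] [Module k A]
  [IsScalarTower k A A] [SMulCommClass k A A] (Q : AlgebraicQuantumGroup k A)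

/-- `a ↦ φ(· a)`. -/
def toDual : A →ₗ[k] Module.Dual k A :=
  LinearMap.mk₂ k (fun a x => Q.φ (x * a)) (by simp [mul_add])
    (by simp [mul_smul_comm]) (by simp [add_mul]) (by simp [smul_mul_assoc])

/-- The space `Â = {φ(· a) | a ∈ A}` of functionals on `A`. -/
def Dual : Type _ := LinearMap.range Q.toDual

instance : AddCommGroup Q.Dual := inferInstanceAs (AddCommGroup (LinearMap.range Q.toDual))
instance : Module k Q.Dual := inferInstanceAs (Module k (LinearMap.range Q.toDual))

/-- The inclusion of `Â` into the linear dual of `A`. -/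
def Dual.val : Q.Dual →ₗ[k] Module.Dual k A := (LinearMap.range Q.toDual).subtype

/-- `Q.hat a` is the functional `φ(· a)`, an element of `Â`. -/
def hat : A →ₗ[k] Q.Dual := Q.toDual.rangeRestrict

/-- Evaluation of the elements of `Â` at `x ∈ A`. -/
def ev (x : A) : Q.Dual →ₗ[k] k := (LinearMap.applyₗ x) ∘ₗ Dual.val Q

@[simp] theorem ev_hat (x a : A) : Q.ev x (Q.hat a) = Q.φ (x * a) := rfl

theorem hat_surjective : Function.Surjective Q.hat := Q.toDual.surjective_rangeRestrict

theorem Dual.ext {ω ω' : Q.Dual} (h : ∀ x, Q.ev x ω = Q.ev x ω') : ω = ω' :=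
  Subtype.ext (LinearMap.ext h)

theorem pair_lmul_TΔ1 (x : A) (s : A ⊗[k] A) :
    pair Q.φ Q.φ ((Q.comul x).lmul (Q.TΔ1 s)) = Q.φ (x * sliceR Q.φ s) := by
  have inj := Mult.incl_injective (k := k)
    (tensor_nondeg_left (k := k) Q.nondeg_left Q.nondeg_left)
  have nd := tensor_nondeg_right (k := k) Q.nondeg_right Q.nondeg_right
  induction s with
  | zero => simp
  | add s t hs ht => simp only [map_add, mul_add, hs, ht]
  | tmul p q =>
    have h : (Q.comul x).lmul (Q.TΔ1 (p ⊗ₜ q)) = Q.TΔ1 ((x * p) ⊗ₜ q) := by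
      apply inj
      rw [Q.TΔ1_spec, map_mul, mul_assoc, ← Q.TΔ1_spec, Mult.mul_incl nd]
    have h2 : ∀ z : A ⊗[k] A, pair Q.φ Q.φ z = Q.φ (sliceR Q.φ z) := by
      intro z
      induction z with
      | zero => simp
      | add s t hs ht => simp only [map_add, hs, ht]
      | tmul p q => simp [mul_comm]
    rw [h, h2, Q.φ_invariant]
    simp [mul_smul_comm, mul_comm]

theorem pair_lmul_tmul_left (x a a' b : A) (h : Q.hat a = Q.hat a') :
    pair Q.φ Q.φ ((Q.comul x).lmul (a ⊗ₜ b)) = pair Q.φ Q.φ ((Q.comul x).lmul (a' ⊗ₜ b)) := by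
  have nd := tensor_nondeg_right (k := k) Q.nondeg_right Q.nondeg_right
  have h1 : ∀ a : A, (Q.comul x).lmul (a ⊗ₜ b) =
      TensorProduct.map (LinearMap.mulRight k a) LinearMap.id (Q.TΔ2 (x ⊗ₜ b)) := by
    intro a
    have e : ∀ t : A ⊗[k] A, TensorProduct.map (LinearMap.mulRight k a) LinearMap.id t =
      (Mult.tmul (Mult.incl a) 1 : Mult k (A ⊗[k] A)).rmul t := fun t => rfl
    rw [e]
    rw [← sub_eq_zero]
    apply tensor_nondeg_left (k := k) Q.nondeg_left Q.nondeg_left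
    intro u
    rw [sub_mul, ← Mult.lmul_mul_eq nd, ← Mult.central, ← Mult.lmul_incl (k := k) (Q.TΔ2 (x ⊗ₜ b)),
      Q.TΔ2_spec, Mult.lmul_mul, sub_eq_zero]
    congr 1
    induction u with
    | zero => simp
    | add s t hs ht => simp only [map_add, mul_add, hs, ht]
    | tmul p q => simp [Mult.tmul]
  rw [h1, h1]
  generalize Q.TΔ2 (x ⊗ₜ b) = z
  induction z with
  | zero => simp
  | add s t hs ht => simp only [map_add, hs, ht]
  | tmul p q =>
    have := congrArg (Q.ev p) h
    simp only [ev_hat] at this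
    simp [this]

theorem pair_lmul_tmul_right (x a b b' : A) (h : Q.hat b = Q.hat b') :
    pair Q.φ Q.φ ((Q.comul x).lmul (a ⊗ₜ b)) = pair Q.φ Q.φ ((Q.comul x).lmul (a ⊗ₜ b')) := by
  have nd := tensor_nondeg_right (k := k) Q.nondeg_right Q.nondeg_right
  have h1 : ∀ b : A, (Q.comul x).lmul (a ⊗ₜ b) =
      TensorProduct.map LinearMap.id (LinearMap.mulRight k b) (Q.TΔ1 (x ⊗ₜ a)) := by
    intro b
    have e : ∀ t : A ⊗[k] A, TensorProduct.map LinearMap.id (LinearMap.mulRight k b) t =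
      (Mult.tmul 1 (Mult.incl b) : Mult k (A ⊗[k] A)).rmul t := fun t => rfl
    rw [e]
    rw [← sub_eq_zero]
    apply tensor_nondeg_left (k := k) Q.nondeg_left Q.nondeg_left
    intro u
    rw [sub_mul, ← Mult.lmul_mul_eq nd, ← Mult.central, ← Mult.lmul_incl (k := k) (Q.TΔ1 (x ⊗ₜ a)),
      Q.TΔ1_spec, Mult.lmul_mul, sub_eq_zero]
    congr 1
    induction u with
    | zero => simp
    | add s t hs ht => simp only [map_add, mul_add, hs, ht]
    | tmul p q => simp [Mult.tmul]
  rw [h1, h1]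
  generalize Q.TΔ1 (x ⊗ₜ a) = z
  induction z with
  | zero => simp
  | add s t hs ht => simp only [map_add, hs, ht]
  | tmul p q =>
    have := congrArg (Q.ev q) h
    simp only [ev_hat] at this
    simp [this]

/-- The product of `Â`; see `ev_hat_mul_hat` for its description as a convolution. -/
instance : Mul Q.Dual where
  mul ω ω' := Q.hat (sliceR Q.φ
    (Q.TΔ1.symm (Classical.choose (Q.hat_surjective ω) ⊗ₜ Classical.choose (Q.hat_surjective ω'))))

/-- `(ω ω')(x) = (ω ⊗ ω')(Δ(x))`, which for `ω = φ(· a)` and `ω' = φ(· b)` reads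
`(ω ω')(x) = (φ ⊗ φ)(Δ(x)(a ⊗ b))`. -/
theorem ev_hat_mul_hat (x a b : A) :
    Q.ev x (Q.hat a * Q.hat b) = pair Q.φ Q.φ ((Q.comul x).lmul (a ⊗ₜ b)) := by
  change Q.φ (x * sliceR Q.φ (Q.TΔ1.symm _)) = _
  rw [← pair_lmul_TΔ1, LinearEquiv.apply_symm_apply,
    Q.pair_lmul_tmul_left x _ a _ (Classical.choose_spec (Q.hat_surjective (Q.hat a))),
    Q.pair_lmul_tmul_right x _ _ b (Classical.choose_spec (Q.hat_surjective (Q.hat b)))]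

instance : NonUnitalNonAssocRing Q.Dual where
  left_distrib ω ω' ω'' := by
    obtain ⟨a, rfl⟩ := Q.hat_surjective ω
    obtain ⟨b, rfl⟩ := Q.hat_surjective ω'
    obtain ⟨c, rfl⟩ := Q.hat_surjective ω''
    apply Dual.ext
    intro x
    rw [← map_add, map_add (Q.ev x)]
    rw [ev_hat_mul_hat, ev_hat_mul_hat, ev_hat_mul_hat, TensorProduct.tmul_add, map_add, map_add]
  right_distrib ω ω' ω'' := by
    obtain ⟨a, rfl⟩ := Q.hat_surjective ω
    obtain ⟨b, rfl⟩ := Q.hat_surjective ω'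
    obtain ⟨c, rfl⟩ := Q.hat_surjective ω''
    apply Dual.ext
    intro x
    rw [← map_add, map_add (Q.ev x)]
    rw [ev_hat_mul_hat, ev_hat_mul_hat, ev_hat_mul_hat, TensorProduct.add_tmul, map_add, map_add]
  zero_mul ω := by
    obtain ⟨a, rfl⟩ := Q.hat_surjective ω
    apply Dual.ext
    intro x
    rw [← map_zero Q.hat, ev_hat_mul_hat, TensorProduct.zero_tmul]
    simp
  mul_zero ω := by
    obtain ⟨a, rfl⟩ := Q.hat_surjective ω
    apply Dual.ext
    intro x
    rw [← map_zero Q.hat, ev_hat_mul_hat, TensorProduct.tmul_zero]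
    simp

instance : IsScalarTower k Q.Dual Q.Dual where
  smul_assoc c ω ω' := by
    obtain ⟨a, rfl⟩ := Q.hat_surjective ω
    obtain ⟨b, rfl⟩ := Q.hat_surjective ω'
    apply Dual.ext
    intro x
    rw [smul_eq_mul, smul_eq_mul, ← map_smul, map_smul (Q.ev x)]
    rw [ev_hat_mul_hat, ev_hat_mul_hat, ← TensorProduct.smul_tmul', map_smul, map_smul]

instance : SMulCommClass k Q.Dual Q.Dual where
  smul_comm c ω ω' := by
    obtain ⟨a, rfl⟩ := Q.hat_surjective ω
    obtain ⟨b, rfl⟩ := Q.hat_surjective ω'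
    apply Dual.ext
    intro x
    rw [smul_eq_mul, smul_eq_mul, ← map_smul Q.hat, map_smul (Q.ev x)]
    rw [ev_hat_mul_hat, ev_hat_mul_hat, TensorProduct.tmul_smul, map_smul, map_smul]

/-- The structure maps of the algebraic quantum group `(A, Δ)` with left invariant functional `φ`,
each with the properties that define it (and determine it uniquely). -/
structure StructureMaps where
  /-- the counit `ε` -/
  ε : A →ₗ[k] k
  /-- `(ε ⊗ ι)(Δ(a)(1 ⊗ b)) = a b` -/
  counit_left : ∀ a b : A, sliceL ε (Q.TΔ2 (a ⊗ₜ b)) = a * b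
  /-- `(ι ⊗ ε)((a ⊗ 1)Δ(b)) = a b` -/
  counit_right : ∀ a b : A, sliceR ε (Q.T1Δ (a ⊗ₜ b)) = a * b
  /-- the antipode `S`, a bijective anti-homomorphism -/
  S : A ≃ₗ[k] A
  S_mul : ∀ a b : A, S (a * b) = S b * S a
  /-- `m(S ⊗ ι)(Δ(a)(1 ⊗ b)) = ε(a) b` -/
  antipode_left : ∀ a b : A,
    LinearMap.mul' k A (TensorProduct.map S.toLinearMap LinearMap.id (Q.TΔ2 (a ⊗ₜ b))) = ε a • b
  /-- `m(ι ⊗ S)((a ⊗ 1)Δ(b)) = ε(b) a` -/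
  antipode_right : ∀ a b : A,
    LinearMap.mul' k A (TensorProduct.map LinearMap.id S.toLinearMap (Q.T1Δ (a ⊗ₜ b))) = ε b • a
  /-- the modular automorphism of `φ` -/
  σ : AlgAut k A
  φ_mul : ∀ a b : A, Q.φ (a * b) = Q.φ (b * σ a)
  /-- the modular automorphism of `ψ = φ ∘ S` -/
  σ' : AlgAut k A
  ψ_mul : ∀ a b : A, Q.φ (S (a * b)) = Q.φ (S (b * σ' a))
  /-- the modular element `δ` -/
  δ : Mult k A
  /-- `(φ ⊗ ι)(Δ(a)(1 ⊗ b)) = φ(a) δ b` -/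
  δ_left : ∀ a b : A, sliceL Q.φ (Q.TΔ2 (a ⊗ₜ b)) = Q.φ a • δ.lmul b
  /-- `(φ ⊗ ι)((1 ⊗ b)Δ(a)) = φ(a) b δ` -/
  δ_right : ∀ a b : A, sliceL Q.φ (Q.T2Δ (b ⊗ₜ a)) = Q.φ a • δ.rmul b
  /-- the scaling constant `τ` -/
  τ : k
  φ_S_S : ∀ a : A, Q.φ (S (S a)) = τ * Q.φ a
  /-- the left invariant functional of the dual, `φ̂(ψ(a ·)) = ε(a)` -/
  φhat : Q.Dual →ₗ[k] k
  φhat_spec : ∀ a : A, ∃ ω : Q.Dual, (∀ x, Q.ev x ω = Q.φ (S (a * x))) ∧ φhat ω = ε a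
  /-- the modular element `δ̂ ∈ M(Â)` of the dual -/
  δhat : Mult k Q.Dual
  /-- `(φ̂ ⊗ ι)(Δ̂(ω)(1 ⊗ ω')) = φ̂(ω) δ̂ ω'`, where `ω' = φ(· b)` and `t = Δ̂(ω)(1 ⊗ ω') ∈ Â ⊗ Â` is
  given by `t(x ⊗ y) = (ω(x ·) ⊗ ω')(Δ(y)) = (ω(x ·) ⊗ φ)(Δ(y)(1 ⊗ b))` -/
  δhat_left : ∀ (ω : Q.Dual) (b : A), ∃ t : Q.Dual ⊗[k] Q.Dual,
    (∀ x y : A, pair (Q.ev x) (Q.ev y) t =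
      pair (Dual.val Q ω ∘ₗ LinearMap.mulLeft k x) Q.φ (Q.TΔ2 (y ⊗ₜ b))) ∧
    sliceL φhat t = φhat ω • δhat.lmul (Q.hat b)
  /-- `(φ̂ ⊗ ι)((1 ⊗ ω')Δ̂(ω)) = φ̂(ω) ω' δ̂`, where `ω' = φ(· b)` and `t = (1 ⊗ ω')Δ̂(ω) ∈ Â ⊗ Â` is
  given by `t(x ⊗ y) = (ω' ⊗ ω(x ·))(Δ(y)) = (φ ⊗ ω(x ·))(Δ(y)(b ⊗ 1))` -/
  δhat_right : ∀ (ω : Q.Dual) (b : A), ∃ t : Q.Dual ⊗[k] Q.Dual,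
    (∀ x y : A, pair (Q.ev x) (Q.ev y) t =
      pair Q.φ (Dual.val Q ω ∘ₗ LinearMap.mulLeft k x) (Q.TΔ1 (y ⊗ₜ b))) ∧
    sliceL φhat t = φhat ω • δhat.rmul (Q.hat b)

/-- The automorphism `S²`. -/
def StructureMaps.S2 {Q : AlgebraicQuantumGroup k A} (D : Q.StructureMaps) : AlgAut k A where
  toLinearEquiv := D.S.trans D.S
  map_mul' a b := by
    change D.S (D.S (a * b)) = D.S (D.S a) * D.S (D.S b)
    rw [D.S_mul, D.S_mul]

end AlgebraicQuantumGroup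

/-! ### Galois objects -/

section Galois

variable {k A X : Type*} [Field k]
  [NonUnitalRing A] [Module k A] [IsScalarTower k A A] [SMulCommClass k A A]
  [NonUnitalRing X] [Module k X] [IsScalarTower k X X] [SMulCommClass k X X]

/-- A right `A`-Galois object `(X, α)`: a non-degenerate algebra `X` with a reduced right coaction
`α` of `A` whose coinvariants are the scalars and whose Galois map `V` is bijective. The maps `T₁`,
`T₂` and `V` are determined by `α`. -/
structure GaloisObject (Q : AlgebraicQuantumGroup k A) (X : Type*) [NonUnitalRing X] [Module k X]
    [IsScalarTower k X X] [SMulCommClass k X X] where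
  nondeg_left : ∀ x : X, (∀ y : X, x * y = 0) → x = 0
  nondeg_right : ∀ x : X, (∀ y : X, y * x = 0) → x = 0
  /-- the coaction `α` -/
  α : X →ₙₐ[k] Mult k (X ⊗[k] A)
  α_injective : Function.Injective α
  /-- `x ⊗ a ↦ α(x)(1 ⊗ a)` -/
  T₁ : X ⊗[k] A →ₗ[k] X ⊗[k] A
  T₁_spec : ∀ (x : X) (a : A), Mult.incl (T₁ (x ⊗ₜ a)) = α x * Mult.tmul 1 (Mult.incl a)
  /-- `x ⊗ a ↦ (1 ⊗ a)α(x)` -/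
  T₂ : X ⊗[k] A →ₗ[k] X ⊗[k] A
  T₂_spec : ∀ (x : X) (a : A), Mult.incl (T₂ (x ⊗ₜ a)) = Mult.tmul 1 (Mult.incl a) * α x
  /-- the Galois map `x ⊗ y ↦ (x ⊗ 1)α(y)` -/
  V : X ⊗[k] X ≃ₗ[k] X ⊗[k] A
  V_spec : ∀ x y : X, Mult.incl (V (x ⊗ₜ y)) = Mult.tmul (Mult.incl x) 1 * α y
  /-- `(α ⊗ ι)α = (ι ⊗ Δ)α`, covered by `y` on the left of the first leg and by `a` on the right of
  the third: `(y ⊗ 1 ⊗ 1)(α ⊗ ι)(α(x)(1 ⊗ a)) = (ι ⊗ Δ)((y ⊗ 1)α(x))(1 ⊗ 1 ⊗ a)` -/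
  coassoc : ∀ (y x : X) (a : A),
    TensorProduct.map V.toLinearMap LinearMap.id
        ((TensorProduct.assoc k X X A).symm (y ⊗ₜ T₁ (x ⊗ₜ a))) =
      (TensorProduct.assoc k X A A).symm
        (TensorProduct.map LinearMap.id Q.TΔ2.toLinearMap
          (TensorProduct.assoc k X A A (V (y ⊗ₜ x) ⊗ₜ a)))
  /-- the multipliers `f` of `X` with `α(f) = f ⊗ 1` are the scalars -/
  coinvariants : ∀ f : Mult k X, Mult.IsExtensionAt α f (Mult.tmul f 1) →
    ∃ c : k, f = algebraMap k (Mult k X) c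

namespace GaloisObject

variable {Q : AlgebraicQuantumGroup k A} (G : GaloisObject Q X)

/-- `ω` is invariant: `(ω ⊗ ι)α(x) = ω(x) 1` in `M(A)` for all `x`. -/
def IsInvariant (ω : X →ₗ[k] k) : Prop :=
  ∀ (x : X) (a : A), sliceL ω (G.T₁ (x ⊗ₜ a)) = ω x • a ∧ sliceL ω (G.T₂ (x ⊗ₜ a)) = ω x • a

/-- The action of `φ(· a) ∈ Â` on `X`: `x ↦ (ι ⊗ φ(· a))α(x) = (ι ⊗ φ)(α(x)(1 ⊗ a))`. -/
def act (a : A) (x : X) : X := sliceR Q.φ (G.T₁ (x ⊗ₜ a))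

/-- The linear identification of `X ⊗ X` with `Xᵒᵖ ⊗ X`. -/
def opId : X ⊗[k] X ≃ₗ[k] Xᵐᵒᵖ ⊗[k] X :=
  TensorProduct.congr (MulOpposite.opLinearEquiv k) (LinearEquiv.refl k X)

/-- The structure maps of the Galois object `(X, α)` relative to a non-zero invariant functional
`ψX`, each with the properties that define it (and determine it uniquely). -/
structure StructureMaps (D : Q.StructureMaps) (ψX : X →ₗ[k] k) where
  /-- the bijection `x ⊗ y ↦ α(x)(y ⊗ 1)` -/
  W : X ⊗[k] X ≃ₗ[k] X ⊗[k] A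
  W_spec : ∀ x y : X, Mult.incl (W (x ⊗ₜ y)) = G.α x * Mult.tmul (Mult.incl y) 1
  /-- `β : A → M(X ⊗ X)` -/
  β : A →ₗ[k] Mult k (X ⊗[k] X)
  /-- `(x ⊗ 1)β(a) = V⁻¹(x ⊗ a)` -/
  β_left : ∀ (x : X) (a : A),
    Mult.tmul (Mult.incl x) 1 * β a = Mult.incl (G.V.symm (x ⊗ₜ a))
  /-- `β(a)(1 ⊗ y) = W⁻¹(y ⊗ S(a))` -/
  β_right : ∀ (y : X) (a : A),
    β a * Mult.tmul 1 (Mult.incl y) = Mult.incl (W.symm (y ⊗ₜ D.S a))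
  /-- `β`, regarded as a homomorphism `A → M(Xᵒᵖ ⊗ X)` -/
  βtilde : A →ₙₐ[k] Mult k (Xᵐᵒᵖ ⊗[k] X)
  βtilde_left : ∀ (a : A) (x y : X),
    Mult.incl (opId.symm ((βtilde a).lmul (MulOpposite.op x ⊗ₜ y))) =
      Mult.tmul (Mult.incl x) 1 * β a * Mult.tmul 1 (Mult.incl y)
  βtilde_right : ∀ (a : A) (x y : X),
    Mult.incl (opId.symm ((βtilde a).rmul (MulOpposite.op x ⊗ₜ y))) =
      Mult.tmul 1 (Mult.incl y) * β a * Mult.tmul (Mult.incl x) 1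
  /-- the functional `φ_X`, `(ι ⊗ φ)α(x) = φ_X(x) 1` in `M(X)` -/
  φX : X →ₗ[k] k
  φX_left : ∀ x y : X, sliceR Q.φ (W (x ⊗ₜ y)) = φX x • y
  φX_right : ∀ x y : X, sliceR Q.φ (G.V (y ⊗ₜ x)) = φX x • y
  /-- the modular element `δ_X`, an invertible multiplier -/
  δX : (Mult k X)ˣ
  φX_δX : ∀ x : X, φX ((δX : Mult k X).rmul x) = ψX x
  /-- the modular automorphism of `φ_X` -/
  σX : AlgAut k X
  φX_mul : ∀ x y : X, φX (y * σX x) = φX (x * y)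
  /-- the action `x ↦ δ̂ · x` of the multiplier `δ̂` of `Â`, determined by `δ̂ · (ω · x) = (δ̂ω) · x` -/
  δhatAct : X →ₗ[k] X
  δhatAct_spec : ∀ (a b : A) (x : X), D.δhat.lmul (Q.hat a) = Q.hat b →
    δhatAct (G.act a x) = G.act b x
  /-- the automorphism `θ_X = σ_X(δ̂ · –)` -/
  θX : AlgAut k X
  θX_eq : ∀ x : X, θX x = σX (δhatAct x)

end GaloisObject

end Galois

end GaloisObj

end

open scoped TensorProduct

noncomputable section

namespace GaloisObj

open LinearMap (mulLeft mulRight)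

/-! ### Tensor products and slices -/

section TensorLemmas

variable {k A B C M N : Type*} [Field k] [AddCommGroup A] [Module k A] [AddCommGroup B] [Module k B]
  [AddCommGroup C] [Module k C] [AddCommGroup M] [Module k M] [AddCommGroup N] [Module k N]

/-! Throughout, μ = (ι⊗χ)Δ and ν = (χ⊗ι)Δ on A and γ = (ι⊗χ)α on X (`charRight`, `charLeft`,
`charAct`), where χ = ε∘σ⁻¹ is a character of A. Every formula of the theorem comes from this
character and from strong invariance.

On A, the formulas Δσ = (S²⊗σ)Δ and Δσ' = (σ'⊗S⁻²)Δ (`T1Δ_σ`, `TΔ2_σ'`), together with χσ = ε = χσ',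
give μ = σ⁻¹S² and ν = S⁻²σ'⁻¹. Left convolution by χ sends φ(· b) to φ(· ν⁻¹(b)), and this
multiplier of the dual is its modular element. Hence the modular element of the dual acts on X as γ,
and θ_X = σ_Xγ.

On X, strong invariance reads (φ_X⊗ι)(α(x)(y⊗1)) = δS((φ_X⊗ι)((x⊗1)α(y))) (`sliceL_φX_galoisW`).
Combined with the modular property of σ_X it yields ασ_X = (σ_X⊗σν)α (`V_σX`). Coassociativity gives
(γ⊗ι)α = (ι⊗ν)α and αγ = (ι⊗μ)α. Therefore ασ_X = (σ_Xγ⊗σ)α = (θ_X⊗σ)α. Since σνμ = S²ν = σ'⁻¹, also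
αθ_X = (σ_X⊗σνμ)α = (σ_X⊗σ'⁻¹)α = (σ_X⊗S²ν)α = (θ_X⊗S²)α. Applying ι⊗φ to the last formula gives
φ_Xθ_X = τφ_X, and an automorphism that scales φ_X commutes with σ_X.

The inverse of δ_X is (ι⊗ψ)α(w) with ψ_X(w) = 1 (`exists_δX`). For ψ_X strong invariance holds
without the factor δ; comparing the two versions gives α(δ_X) = δ_X⊗δ (`V_rmul`), and this
determines β̃(δ). The identity ψ_X(δ_X⁻¹x) = τφ_X(x) yields σ_X(δ_X) = τ⁻¹δ_X and the formula for
φ_X(δ_X⁻¹ · δ_X); as γ(δ_X) = χ(δ)δ_X = τδ_X, it follows that θ_X(δ_X) = δ_X.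

Existence has to be proved from bijectivity of the canonical maps, coassociativity and invariance of
φ alone: the counit, the antipode, faithfulness of φ, δ, σ, σ' and the dual data on A; then W =
T₁(ι⊗S)V, φ_X from triviality of the coinvariants, and σ_X from V⁻¹ and W⁻¹. Since A is a Galois
object over itself (`selfGalois`), some lemmas on α serve Δ too. The structure maps used in the
formulas are determined by their properties, so it suffices to treat the constructed ones; for β̃ an
explicit formula shared by all choices is enough. Identities between multipliers are checked after
multiplication by enough elements, or after pairing one leg with a faithful functional. -/

theorem sliceR_rTensor (ω : B →ₗ[k] k) (f : A →ₗ[k] M) (t : A ⊗[k] B) :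
    sliceR ω (f.rTensor B t) = f (sliceR ω t) := by
  induction t with
  | zero => simp
  | add s t hs ht => simp only [map_add, hs, ht]
  | tmul a b => simp

theorem sliceR_lTensor (ω : M →ₗ[k] k) (f : B →ₗ[k] M) (t : A ⊗[k] B) :
    sliceR ω (f.lTensor A t) = sliceR (ω ∘ₗ f) t := by
  induction t with
  | zero => simp
  | add s t hs ht => simp only [map_add, hs, ht]
  | tmul a b => simp

theorem sliceL_lTensor (ω : A →ₗ[k] k) (f : B →ₗ[k] M) (t : A ⊗[k] B) :
    sliceL ω (f.lTensor A t) = f (sliceL ω t) := by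
  induction t with
  | zero => simp
  | add s t hs ht => simp only [map_add, hs, ht]
  | tmul a b => simp

theorem sliceL_rTensor (ω : M →ₗ[k] k) (f : A →ₗ[k] M) (t : A ⊗[k] B) :
    sliceL ω (f.rTensor B t) = sliceL (ω ∘ₗ f) t := by
  induction t with
  | zero => simp
  | add s t hs ht => simp only [map_add, hs, ht]
  | tmul a b => simp

theorem sliceR_comm (ω : A →ₗ[k] k) (t : A ⊗[k] B) :
    sliceR ω (TensorProduct.comm k A B t) = sliceL ω t := by
  induction t with
  | zero => simp
  | add s t hs ht => simp only [map_add, hs, ht]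
  | tmul a b => simp

theorem sliceL_comm (ω : B →ₗ[k] k) (t : A ⊗[k] B) :
    sliceL ω (TensorProduct.comm k A B t) = sliceR ω t := by
  induction t with
  | zero => simp
  | add s t hs ht => simp only [map_add, hs, ht]
  | tmul a b => simp

theorem comm_rTensor (f : A →ₗ[k] M) (t : A ⊗[k] B) :
    TensorProduct.comm k M B (f.rTensor B t) = f.lTensor B (TensorProduct.comm k A B t) := by
  induction t with
  | zero => simp
  | add s t hs ht => simp only [map_add, hs, ht]
  | tmul a b => simp

theorem lTensor_rTensor (f : A →ₗ[k] M) (g : B →ₗ[k] N) (t : A ⊗[k] B) :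
    g.lTensor M (f.rTensor B t) = f.rTensor N (g.lTensor A t) := by
  induction t with
  | zero => simp
  | add s t hs ht => simp only [map_add, hs, ht]
  | tmul a b => simp

theorem map_eq_lTensor_rTensor (f : A →ₗ[k] M) (g : B →ₗ[k] N) (t : A ⊗[k] B) :
    TensorProduct.map f g t = g.lTensor M (f.rTensor B t) := by
  induction t with
  | zero => simp
  | add s t hs ht => simp only [map_add, hs, ht]
  | tmul a b => simp

theorem pair_eq_sliceR (ω : A →ₗ[k] k) (ω' : B →ₗ[k] k) (t : A ⊗[k] B) :
    pair ω ω' t = ω (sliceR ω' t) := by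
  induction t with
  | zero => simp
  | add s t hs ht => simp only [map_add, hs, ht]
  | tmul a b => simp [mul_comm]

theorem pair_eq_sliceL (ω : A →ₗ[k] k) (ω' : B →ₗ[k] k) (t : A ⊗[k] B) :
    pair ω ω' t = ω' (sliceL ω t) := by
  induction t with
  | zero => simp
  | add s t hs ht => simp only [map_add, hs, ht]
  | tmul a b => simp

theorem slice_slice (ω : A →ₗ[k] k) (ω' : B →ₗ[k] k) (t : A ⊗[k] B) :
    ω (sliceR ω' t) = ω' (sliceL ω t) := by
  rw [← pair_eq_sliceR, pair_eq_sliceL]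

theorem sliceR_rTensor_assoc_symm (ω : B →ₗ[k] k) (t : A ⊗[k] (B ⊗[k] C)) :
    (sliceR ω).rTensor C ((TensorProduct.assoc k A B C).symm t) = (sliceL ω).lTensor A t := by
  induction t with
  | zero => simp
  | add s t hs ht => simp only [map_add, hs, ht]
  | tmul a t =>
    induction t with
    | zero => simp
    | add s t hs ht => simp only [map_add, TensorProduct.tmul_add, hs, ht]
    | tmul b c => simp [TensorProduct.smul_tmul]

theorem sliceR_assoc_symm (ω : C →ₗ[k] k) (t : A ⊗[k] (B ⊗[k] C)) :
    sliceR ω ((TensorProduct.assoc k A B C).symm t) = (sliceR ω).lTensor A t := by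
  induction t with
  | zero => simp
  | add s t hs ht => simp only [map_add, hs, ht]
  | tmul a t =>
    induction t with
    | zero => simp
    | add s t hs ht => simp only [map_add, TensorProduct.tmul_add, hs, ht]
    | tmul b c => simp

/-- Expanded over a basis of the first factor, the coefficients of u are killed by a separating
family. With f_i = φ(c_i ·) and φ faithful, this is how tensors are compared below. -/
theorem sliceR_eq_zero {I : Type*} (f : I → B →ₗ[k] k) (hf : ∀ b, (∀ i, f i b = 0) → b = 0)
    (u : A ⊗[k] B) (hu : ∀ i, sliceR (f i) u = 0) : u = 0 := by
  classical
  let bA := Module.Basis.ofVectorSpace k A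
  apply (TensorProduct.equivFinsuppOfBasisLeft (N := B) bA).injective
  rw [map_zero]
  ext i
  apply hf
  intro d
  have h := congrArg (fun z => bA.repr z i) (hu d)
  simp only [map_zero, Finsupp.coe_zero, Pi.zero_apply] at h
  rw [← h]
  generalize u = v
  induction v with
  | zero => simp
  | add v w hv hw => simp only [map_add, Finsupp.add_apply, hv, hw]
  | tmul a b => simp [mul_comm]

theorem sliceL_eq_zero {I : Type*} (f : I → A →ₗ[k] k) (hf : ∀ b, (∀ i, f i b = 0) → b = 0)
    (u : A ⊗[k] B) (hu : ∀ i, sliceL (f i) u = 0) : u = 0 := by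
  apply (TensorProduct.comm k A B).injective
  rw [map_zero]
  apply sliceR_eq_zero f hf
  intro i
  rw [sliceR_comm, hu]

theorem exists_dual_eq_one {a : A} (ha : a ≠ 0) : ∃ ω : A →ₗ[k] k, ω a = 1 := by
  obtain ⟨f, hf⟩ : ∃ f : Module.Dual k A, f a ≠ 0 := by
    by_contra! H
    exact ha ((Module.forall_dual_apply_eq_zero_iff k a).1 H)
  exact ⟨(f a)⁻¹ • f, by simp [hf]⟩

theorem exists_eq_one_of_ne_zero {ω : A →ₗ[k] k} (h : ω ≠ 0) : ∃ a, ω a = 1 := by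
  by_contra! H
  apply h
  ext a
  by_contra ha
  exact H ((ω a)⁻¹ • a) (by simpa using inv_mul_cancel₀ ha)

theorem tmul_left_cancel {a : A} (ha : a ≠ 0) {b b' : B} (h : a ⊗ₜ[k] b = a ⊗ₜ[k] b') : b = b' := by
  obtain ⟨ω, hω⟩ := exists_dual_eq_one (k := k) ha
  simpa [hω] using congrArg (sliceL ω) h

theorem tmul_right_cancel {b : B} (hb : b ≠ 0) {a a' : A} (h : a ⊗ₜ[k] b = a' ⊗ₜ[k] b) :
    a = a' := by
  obtain ⟨ω, hω⟩ := exists_dual_eq_one (k := k) hb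
  simpa [hω] using congrArg (sliceR ω) h

end TensorLemmas

/-! ### Cancellation by non-degeneracy. -/

section Cancel

set_option linter.unusedSectionVars false

variable {k X M : Type*} [Field k] [NonUnitalRing X] [Module k X] [IsScalarTower k X X]
  [SMulCommClass k X X] [AddCommGroup M] [Module k M]

theorem rTensor_mulLeft_cancel (h : ∀ x : X, (∀ y : X, y * x = 0) → x = 0) {t t' : X ⊗[k] M}
    (H : ∀ y, (LinearMap.mulLeft k y).rTensor M t = (LinearMap.mulLeft k y).rTensor M t') :
    t = t' := by
  rw [← sub_eq_zero]
  refine map_injective_id (fun y => LinearMap.mulLeft k y) h _ fun y => ?_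
  rw [map_sub, sub_eq_zero]
  exact H y

theorem lTensor_mulLeft_cancel (h : ∀ x : X, (∀ y : X, y * x = 0) → x = 0) {t t' : M ⊗[k] X}
    (H : ∀ y, (LinearMap.mulLeft k y).lTensor M t = (LinearMap.mulLeft k y).lTensor M t') :
    t = t' := by
  rw [← sub_eq_zero]
  refine map_id_injective (fun y => LinearMap.mulLeft k y) h _ fun y => ?_
  rw [map_sub, sub_eq_zero]
  exact H y

theorem lTensor_mulRight_cancel (h : ∀ x : X, (∀ y : X, x * y = 0) → x = 0) {t t' : M ⊗[k] X}
    (H : ∀ y, (LinearMap.mulRight k y).lTensor M t = (LinearMap.mulRight k y).lTensor M t') :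
    t = t' := by
  rw [← sub_eq_zero]
  refine map_id_injective (fun y => LinearMap.mulRight k y) h _ fun y => ?_
  rw [map_sub, sub_eq_zero]
  exact H y

end Cancel

theorem mul_left_cancel_of_nondeg {X : Type*} [NonUnitalRing X]
    (h : ∀ x : X, (∀ y : X, y * x = 0) → x = 0) {x x' : X}
    (H : ∀ y, y * x = y * x') : x = x' := by
  rw [← sub_eq_zero]
  exact h _ fun y => by rw [mul_sub, H, sub_self]

theorem mul_right_cancel_of_nondeg {X : Type*} [NonUnitalRing X]
    (h : ∀ x : X, (∀ y : X, x * y = 0) → x = 0) {x x' : X}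
    (H : ∀ y, x * y = x' * y) : x = x' := by
  rw [← sub_eq_zero]
  exact h _ fun y => by rw [sub_mul, H, sub_self]

/-! ### Multipliers -/

namespace Mult

variable {k B : Type*} [Field k] [NonUnitalRing B] [Module k B] [IsScalarTower k B B]
  [SMulCommClass k B B]

theorem rmul_mul_eq (hB : ∀ a : B, (∀ b : B, a * b = 0) → a = 0) (m : Mult k B) (s t : B) :
    m.rmul (s * t) = s * m.rmul t := by
  apply mul_right_cancel_of_nondeg hB
  intro w
  rw [← central, mul_assoc, central, mul_assoc]

theorem incl_mul (hB : ∀ a : B, (∀ b : B, a * b = 0) → a = 0) (m : Mult k B) (s : B) :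
    incl s * m = incl (m.rmul s) := by
  ext u
  · simp [central]
  · simp [rmul_mul_eq hB]

theorem incl_mul_incl (s t : B) : (incl s * incl t : Mult k B) = incl (s * t) := by
  ext u <;> simp [mul_assoc]

theorem ext_of_lmul (hB : ∀ a : B, (∀ b : B, a * b = 0) → a = 0) {m n : Mult k B}
    (h : ∀ a, m.lmul a = n.lmul a) : m = n := by
  ext a
  · exact h a
  · exact mul_right_cancel_of_nondeg hB fun b => by rw [← central, ← central, h]

theorem ext_of_rmul (hB : ∀ a : B, (∀ b : B, b * a = 0) → a = 0) {m n : Mult k B}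
    (h : ∀ a, m.rmul a = n.rmul a) : m = n := by
  ext a
  · exact mul_left_cancel_of_nondeg hB fun b => by rw [central, central, h]
  · exact h a

@[simp] theorem lmul_smul (c : k) (m : Mult k B) (a : B) : (c • m).lmul a = c • m.lmul a := rfl
@[simp] theorem rmul_smul (c : k) (m : Mult k B) (a : B) : (c • m).rmul a = c • m.rmul a := rfl

@[simp] theorem rmul_algebraMap (c : k) (a : B) : (algebraMap k (Mult k B) c).rmul a = c • a := by
  rw [Algebra.algebraMap_eq_smul_one, rmul_smul, rmul_one]

end Mult

/-- Non-degeneracy of the product of an algebra without unit. -/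
class Nondeg (A : Type*) [NonUnitalNonAssocRing A] : Prop where
  left : ∀ a : A, (∀ b : A, a * b = 0) → a = 0
  right : ∀ a : A, (∀ b : A, b * a = 0) → a = 0

/-! ### Calculus of multipliers of tensor products and of the covered forms of Δ and α. -/

section CoverLemmas

set_option linter.unusedSectionVars false

variable {k X A : Type*} [Field k]
  [NonUnitalRing X] [Module k X] [IsScalarTower k X X] [SMulCommClass k X X]
  [NonUnitalRing A] [Module k A] [IsScalarTower k A A] [SMulCommClass k A A]

instance [Nondeg X] [Nondeg A] : Nondeg (X ⊗[k] A) where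
  left := tensor_nondeg_left Nondeg.left Nondeg.left
  right := tensor_nondeg_right Nondeg.right Nondeg.right

instance [Nondeg X] : Nondeg Xᵐᵒᵖ where
  left a h := MulOpposite.unop_injective (Nondeg.right _ fun b => by
    have := congrArg MulOpposite.unop (h (MulOpposite.op b))
    simpa using this)
  right a h := MulOpposite.unop_injective (Nondeg.left _ fun b => by
    have := congrArg MulOpposite.unop (h (MulOpposite.op b))
    simpa using this)

namespace Mult

theorem tmul_mul_tmul (m m' : Mult k X) (n n' : Mult k A) :
    tmul m n * tmul m' n' = tmul (m * m') (n * n') := by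
  ext t <;> induction t with
    | zero => simp
    | add s t hs ht => simp only [map_add, hs, ht]
    | tmul a b => simp [tmul]

theorem tmul_comm (m : Mult k X) (n : Mult k A) : tmul m 1 * tmul 1 n = tmul 1 n * tmul m 1 := by
  simp [tmul_mul_tmul]

@[simp] theorem lmul_tmul (m : Mult k X) (n : Mult k A) (x : X) (a : A) :
    (tmul m n).lmul (x ⊗ₜ a) = m.lmul x ⊗ₜ n.lmul a := rfl
@[simp] theorem rmul_tmul (m : Mult k X) (n : Mult k A) (x : X) (a : A) :
    (tmul m n).rmul (x ⊗ₜ a) = m.rmul x ⊗ₜ n.rmul a := rfl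

theorem rmul_tmul_one (m : Mult k X) (t : X ⊗[k] A) :
    (tmul m 1).rmul t = m.rmul.rTensor A t := rfl
theorem lmul_one_tmul (m : Mult k A) (t : X ⊗[k] A) :
    (tmul 1 m).lmul t = m.lmul.lTensor X t := rfl

section

variable [Nondeg X]

theorem incl_inj {s t : X} : (incl s : Mult k X) = incl t ↔ s = t :=
  (incl_injective Nondeg.left).eq_iff

theorem incl_lmul (m : Mult k X) (s : X) : incl (m.lmul s) = m * incl s :=
  (mul_incl Nondeg.right m s).symm

theorem incl_rmul (m : Mult k X) (s : X) : incl (m.rmul s) = incl s * m :=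
  (incl_mul Nondeg.left m s).symm

theorem lmul_mul' (m : Mult k X) (s t : X) : m.lmul (s * t) = m.lmul s * t :=
  lmul_mul_eq Nondeg.right m s t

theorem rmul_mul' (m : Mult k X) (s t : X) : m.rmul (s * t) = s * m.rmul t :=
  rmul_mul_eq Nondeg.left m s t

theorem incl_mul' (s t : X) : (incl (s * t) : Mult k X) = incl s * incl t :=
  (incl_mul_incl s t).symm

theorem rmul_lmul_comm (m n : Mult k X) (x : X) : m.rmul (n.lmul x) = n.lmul (m.rmul x) := by
  rw [← incl_inj (k := k), incl_rmul, incl_lmul, incl_lmul, incl_rmul, mul_assoc]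

variable [Nondeg A]

theorem incl_rTensor_mulLeft (x : X) (t : X ⊗[k] A) :
    incl ((mulLeft k x).rTensor A t) = tmul (incl x) 1 * incl t :=
  incl_lmul (X := X ⊗[k] A) (tmul (incl x) 1 : Mult k (X ⊗[k] A)) t
theorem incl_rTensor_mulRight (x : X) (t : X ⊗[k] A) :
    incl ((mulRight k x).rTensor A t) = incl t * tmul (incl x) 1 :=
  incl_rmul (X := X ⊗[k] A) (tmul (incl x) 1 : Mult k (X ⊗[k] A)) t
theorem incl_lTensor_mulLeft (a : A) (t : X ⊗[k] A) :
    incl ((mulLeft k a).lTensor X t) = tmul 1 (incl a) * incl t :=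
  incl_lmul (X := X ⊗[k] A) (tmul 1 (incl a) : Mult k (X ⊗[k] A)) t
theorem incl_lTensor_mulRight (a : A) (t : X ⊗[k] A) :
    incl ((mulRight k a).lTensor X t) = incl t * tmul 1 (incl a) :=
  incl_rmul (X := X ⊗[k] A) (tmul 1 (incl a) : Mult k (X ⊗[k] A)) t
theorem incl_tmul (x : X) (a : A) :
    incl (x ⊗ₜ[k] a) = tmul (incl x) 1 * tmul 1 (incl a) := by
  rw [tmul_mul_tmul]
  ext t <;> induction t with
    | zero => simp
    | add s t hs ht => simp only [map_add, hs, ht]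
    | tmul a b => simp
theorem tmul_incl_mul_one (x y : X) :
    (tmul (incl (x * y)) 1 : Mult k (X ⊗[k] A)) = tmul (incl x) 1 * tmul (incl y) 1 := by
  rw [tmul_mul_tmul, incl_mul', one_mul]
theorem tmul_one_incl_mul (x y : A) :
    (tmul 1 (incl (x * y)) : Mult k (X ⊗[k] A)) = tmul 1 (incl x) * tmul 1 (incl y) := by
  rw [tmul_mul_tmul, incl_mul', one_mul]
theorem tmul_incl_comm (x : X) (a : A) :
    (tmul 1 (incl a) * tmul (incl x) 1 : Mult k (X ⊗[k] A)) = tmul (incl x) 1 * tmul 1 (incl a) :=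
  (tmul_comm _ _).symm
theorem tmul_incl_comm_assoc (x : X) (a : A) (m : Mult k (X ⊗[k] A)) :
    (tmul 1 (incl a) * (tmul (incl x) 1 * m) : Mult k (X ⊗[k] A)) =
      tmul (incl x) 1 * (tmul 1 (incl a) * m) := by
  rw [← mul_assoc, tmul_incl_comm, mul_assoc]

end

end Mult

open Mult

namespace AlgebraicQuantumGroup

variable (Q : AlgebraicQuantumGroup k A)

theorem nondeg (Q : AlgebraicQuantumGroup k A) : Nondeg A := ⟨Q.nondeg_left, Q.nondeg_right⟩

theorem T1Δ_mul_left (c a b : A) :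
    Q.T1Δ ((c * a) ⊗ₜ b) = (mulLeft k c).rTensor A (Q.T1Δ (a ⊗ₜ b)) := by
  have := Q.nondeg
  rw [← incl_inj (k := k), incl_rTensor_mulLeft, T1Δ_spec, T1Δ_spec, tmul_incl_mul_one, mul_assoc]

theorem T1Δ_mul_right (a b c : A) :
    Q.T1Δ (a ⊗ₜ (b * c)) = (Q.comul c).rmul (Q.T1Δ (a ⊗ₜ b)) := by
  have := Q.nondeg
  rw [← incl_inj (k := k), incl_rmul, T1Δ_spec, T1Δ_spec, map_mul, mul_assoc]

theorem TΔ2_mul_right (a b c : A) :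
    Q.TΔ2 (a ⊗ₜ (b * c)) = (mulRight k c).lTensor A (Q.TΔ2 (a ⊗ₜ b)) := by
  have := Q.nondeg
  rw [← incl_inj (k := k), incl_lTensor_mulRight, TΔ2_spec, TΔ2_spec, tmul_one_incl_mul, mul_assoc]

theorem TΔ2_mul_left (a b c : A) :
    Q.TΔ2 ((a * b) ⊗ₜ c) = (Q.comul a).lmul (Q.TΔ2 (b ⊗ₜ c)) := by
  have := Q.nondeg
  rw [← incl_inj (k := k), incl_lmul, TΔ2_spec, TΔ2_spec, map_mul, mul_assoc]

theorem T2Δ_mul_left (c a b : A) :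
    Q.T2Δ ((c * a) ⊗ₜ b) = (mulLeft k c).lTensor A (Q.T2Δ (a ⊗ₜ b)) := by
  have := Q.nondeg
  rw [← incl_inj (k := k), incl_lTensor_mulLeft, T2Δ_spec, T2Δ_spec, tmul_one_incl_mul, mul_assoc]

theorem comul_lmul_TΔ2 (a p q : A) :
    (Q.comul a).lmul (p ⊗ₜ q) = (mulRight k p).rTensor A (Q.TΔ2 (a ⊗ₜ q)) := by
  have := Q.nondeg
  rw [← incl_inj (k := k), incl_lmul, incl_rTensor_mulRight, TΔ2_spec, incl_tmul, mul_assoc,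
    tmul_incl_comm]

theorem comul_lmul_TΔ1 (a p q : A) :
    (Q.comul a).lmul (p ⊗ₜ q) = (mulRight k q).lTensor A (Q.TΔ1 (a ⊗ₜ p)) := by
  have := Q.nondeg
  rw [← incl_inj (k := k), incl_lmul, incl_lTensor_mulRight, TΔ1_spec, incl_tmul, mul_assoc]

theorem comul_rmul_T1Δ (a p q : A) :
    (Q.comul a).rmul (p ⊗ₜ q) = (mulLeft k q).lTensor A (Q.T1Δ (p ⊗ₜ a)) := by
  have := Q.nondeg
  rw [← incl_inj (k := k), incl_rmul, incl_lTensor_mulLeft, T1Δ_spec, incl_tmul, mul_assoc,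
    tmul_incl_comm_assoc]

theorem comul_rmul_T2Δ (a p q : A) :
    (Q.comul a).rmul (p ⊗ₜ q) = (mulLeft k p).rTensor A (Q.T2Δ (q ⊗ₜ a)) := by
  have := Q.nondeg
  rw [← incl_inj (k := k), incl_rmul, incl_rTensor_mulLeft, T2Δ_spec, incl_tmul, mul_assoc]

/-- Both sides are (a⊗1)Δ(b)(1⊗c): the order in which the two covers are applied is immaterial. The
next three lemmas are the same fact for other pairs of legs. -/
theorem T1Δ_TΔ2 (a b c : A) : (mulRight k c).lTensor A (Q.T1Δ (a ⊗ₜ b)) =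
    (mulLeft k a).rTensor A (Q.TΔ2 (b ⊗ₜ c)) := by
  have := Q.nondeg
  rw [← incl_inj (k := k), incl_lTensor_mulRight, incl_rTensor_mulLeft, TΔ2_spec, T1Δ_spec,
    mul_assoc]

theorem T1Δ_TΔ1 (a b c : A) : (mulRight k c).rTensor A (Q.T1Δ (a ⊗ₜ b)) =
    (mulLeft k a).rTensor A (Q.TΔ1 (b ⊗ₜ c)) := by
  have := Q.nondeg
  rw [← incl_inj (k := k), incl_rTensor_mulRight, incl_rTensor_mulLeft, TΔ1_spec, T1Δ_spec,
    mul_assoc]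

theorem T2Δ_TΔ1 (a b c : A) : (mulRight k c).rTensor A (Q.T2Δ (a ⊗ₜ b)) =
    (mulLeft k a).lTensor A (Q.TΔ1 (b ⊗ₜ c)) := by
  have := Q.nondeg
  rw [← incl_inj (k := k), incl_rTensor_mulRight, incl_lTensor_mulLeft, TΔ1_spec, T2Δ_spec,
    mul_assoc]

theorem T2Δ_TΔ2 (a b c : A) : (mulRight k c).lTensor A (Q.T2Δ (a ⊗ₜ b)) =
    (mulLeft k a).lTensor A (Q.TΔ2 (b ⊗ₜ c)) := by
  have := Q.nondeg
  rw [← incl_inj (k := k), incl_lTensor_mulRight, incl_lTensor_mulLeft, TΔ2_spec, T2Δ_spec,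
    mul_assoc]

end AlgebraicQuantumGroup

namespace GaloisObject

variable {Q : AlgebraicQuantumGroup k A} (G : GaloisObject Q X)

theorem nondeg (G : GaloisObject Q X) : Nondeg X := ⟨G.nondeg_left, G.nondeg_right⟩

theorem V_mul_left (z y x : X) :
    G.V ((z * y) ⊗ₜ x) = (mulLeft k z).rTensor A (G.V (y ⊗ₜ x)) := by
  have := Q.nondeg; have := G.nondeg
  rw [← incl_inj (k := k), incl_rTensor_mulLeft, V_spec, V_spec, tmul_incl_mul_one, mul_assoc]

theorem V_mul_right (y x z : X) :
    G.V (y ⊗ₜ (x * z)) = (G.α z).rmul (G.V (y ⊗ₜ x)) := by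
  have := Q.nondeg; have := G.nondeg
  rw [← incl_inj (k := k), incl_rmul, V_spec, V_spec, map_mul, mul_assoc]

theorem α_rmul_V (x y : X) (a : A) :
    (G.α x).rmul (y ⊗ₜ a) = (mulLeft k a).lTensor X (G.V (y ⊗ₜ x)) := by
  have := Q.nondeg; have := G.nondeg
  rw [← incl_inj (k := k), incl_rmul, incl_lTensor_mulLeft, V_spec, incl_tmul, mul_assoc,
    tmul_incl_comm_assoc]

theorem α_rmul_T₂ (x y : X) (a : A) :
    (G.α x).rmul (y ⊗ₜ a) = (mulLeft k y).rTensor A (G.T₂ (x ⊗ₜ a)) := by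
  have := Q.nondeg; have := G.nondeg
  rw [← incl_inj (k := k), incl_rmul, incl_rTensor_mulLeft, T₂_spec, incl_tmul, mul_assoc]

theorem α_lmul_T₁ (x y : X) (a : A) :
    (G.α x).lmul (y ⊗ₜ a) = (mulRight k y).rTensor A (G.T₁ (x ⊗ₜ a)) := by
  have := Q.nondeg; have := G.nondeg
  rw [← incl_inj (k := k), incl_lmul, incl_rTensor_mulRight, T₁_spec, incl_tmul, mul_assoc,
    tmul_incl_comm]

theorem V_T₁ (y x : X) (a : A) : (mulRight k a).lTensor X (G.V (y ⊗ₜ x)) =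
    (mulLeft k y).rTensor A (G.T₁ (x ⊗ₜ a)) := by
  have := Q.nondeg; have := G.nondeg
  rw [← incl_inj (k := k), incl_lTensor_mulRight, incl_rTensor_mulLeft, V_spec, T₁_spec, mul_assoc]

theorem T₂_T₁ (x : X) (b a : A) : (mulRight k a).lTensor X (G.T₂ (x ⊗ₜ b)) =
    (mulLeft k b).lTensor X (G.T₁ (x ⊗ₜ a)) := by
  have := Q.nondeg; have := G.nondeg
  rw [← incl_inj (k := k), incl_lTensor_mulRight, incl_lTensor_mulLeft, T₂_spec, T₁_spec, mul_assoc]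

theorem V_T₂ (y x : X) (a : A) : (mulLeft k a).lTensor X (G.V (y ⊗ₜ x)) =
    (mulLeft k y).rTensor A (G.T₂ (x ⊗ₜ a)) := by
  rw [← α_rmul_V, α_rmul_T₂]

end GaloisObject

end CoverLemmas

/-! ### Coassociativity as commutation of maps on neighbouring legs. -/

section Partial

variable {k L L' M M' N P : Type*} [Field k] [AddCommGroup L] [Module k L] [AddCommGroup L']
  [Module k L'] [AddCommGroup M] [Module k M] [AddCommGroup M'] [Module k M']
  [AddCommGroup N] [Module k N] [AddCommGroup P] [Module k P]

/-- `n ↦ T (m ⊗ n)`. -/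
def appL (T : M ⊗[k] N →ₗ[k] P) (m : M) : N →ₗ[k] P := T ∘ₗ TensorProduct.mk k M N m

/-- `m ↦ T (m ⊗ n)`. -/
def appR (T : M ⊗[k] N →ₗ[k] P) (n : N) : M →ₗ[k] P := T ∘ₗ (TensorProduct.mk k M N).flip n

@[simp] theorem appL_apply (T : M ⊗[k] N →ₗ[k] P) (m : M) (n : N) : appL T m n = T (m ⊗ₜ n) := rfl
@[simp] theorem appR_apply (T : M ⊗[k] N →ₗ[k] P) (m : M) (n : N) : appR T n m = T (m ⊗ₜ n) := rfl

theorem rTensor_assoc_symm_tmul (T : L ⊗[k] M →ₗ[k] P) (l : L) (u : M ⊗[k] N) :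
    T.rTensor N ((TensorProduct.assoc k L M N).symm (l ⊗ₜ u)) = (appL T l).rTensor N u := by
  induction u with
  | zero => simp
  | add s t hs ht => simp only [map_add, TensorProduct.tmul_add, hs, ht]
  | tmul a b => simp

theorem lTensor_assoc_tmul (T : M ⊗[k] N →ₗ[k] P) (n : N) (u : L ⊗[k] M) :
    T.lTensor L (TensorProduct.assoc k L M N (u ⊗ₜ n)) = (appR T n).lTensor L u := by
  induction u with
  | zero => simp
  | add s t hs ht => simp only [map_add, TensorProduct.add_tmul, hs, ht]
  | tmul a b => simp

/-- `P₁₂ R₂₃ = R'₂₃ P₁₂`, expressed through partial applications. -/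
def LegsCommute (P : L ⊗[k] M →ₗ[k] L' ⊗[k] M') (R : M ⊗[k] N →ₗ[k] M ⊗[k] N)
    (R' : M' ⊗[k] N →ₗ[k] M' ⊗[k] N) : Prop :=
  ∀ l m n, (appL P l).rTensor N (R (m ⊗ₜ n)) =
    (TensorProduct.assoc k L' M' N).symm ((appR R' n).lTensor L' (P (l ⊗ₜ m)))

/-- As an equation of composites on the triple tensor product, coassociativity lets a bijective P,
or bijective R and R', be moved to the other side; the next two lemmas do this. -/
theorem LegsCommute.comp_eq {P : L ⊗[k] M →ₗ[k] L' ⊗[k] M'} {R : M ⊗[k] N →ₗ[k] M ⊗[k] N}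
    {R' : M' ⊗[k] N →ₗ[k] M' ⊗[k] N} :
    LegsCommute P R R' ↔ ∀ t : L ⊗[k] (M ⊗[k] N),
      P.rTensor N ((TensorProduct.assoc k L M N).symm (R.lTensor L t)) =
        (TensorProduct.assoc k L' M' N).symm (R'.lTensor L' (TensorProduct.assoc k L' M' N
          (P.rTensor N ((TensorProduct.assoc k L M N).symm t)))) := by
  constructor
  · intro h t
    induction t with
    | zero => simp
    | add s t hs ht => simp only [map_add, hs, ht]
    | tmul l t =>
      induction t with
      | zero => simp
      | add s t hs ht => simp only [map_add, TensorProduct.tmul_add, hs, ht]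
      | tmul m n =>
        rw [LinearMap.lTensor_tmul, rTensor_assoc_symm_tmul, h, TensorProduct.assoc_symm_tmul,
          LinearMap.rTensor_tmul, lTensor_assoc_tmul]
  · intro h l m n
    have := h (l ⊗ₜ (m ⊗ₜ n))
    rwa [LinearMap.lTensor_tmul, rTensor_assoc_symm_tmul, TensorProduct.assoc_symm_tmul,
          LinearMap.rTensor_tmul, lTensor_assoc_tmul] at this

theorem LegsCommute.symm_right {P : L ⊗[k] M →ₗ[k] L' ⊗[k] M'} {R : M ⊗[k] N ≃ₗ[k] M ⊗[k] N}
    {R' : M' ⊗[k] N ≃ₗ[k] M' ⊗[k] N} (h : LegsCommute P R.toLinearMap R'.toLinearMap) :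
    LegsCommute P R.symm.toLinearMap R'.symm.toLinearMap := by
  rw [comp_eq] at h ⊢
  intro t
  have h' := h (R.symm.toLinearMap.lTensor L t)
  rw [← LinearMap.comp_apply (LinearMap.lTensor L R.toLinearMap), ← LinearMap.lTensor_comp] at h'
  simp only [LinearEquiv.comp_coe, LinearEquiv.symm_trans_self, LinearEquiv.refl_toLinearMap,
    LinearMap.lTensor_id, LinearMap.id_coe, id_eq] at h'
  rw [h', LinearEquiv.apply_symm_apply, ← LinearMap.comp_apply (LinearMap.lTensor L' _),
    ← LinearMap.lTensor_comp]
  simp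

theorem LegsCommute.symm_left {P : L ⊗[k] M ≃ₗ[k] L' ⊗[k] M'} {R : M ⊗[k] N →ₗ[k] M ⊗[k] N}
    {R' : M' ⊗[k] N →ₗ[k] M' ⊗[k] N} (h : LegsCommute P.toLinearMap R R') :
    LegsCommute P.symm.toLinearMap R' R := by
  rw [comp_eq] at h ⊢
  intro t
  have h' := h (TensorProduct.assoc k L M N (P.symm.toLinearMap.rTensor N
    ((TensorProduct.assoc k L' M' N).symm t)))
  rw [LinearEquiv.symm_apply_apply, ← LinearMap.comp_apply (LinearMap.rTensor N P.toLinearMap),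
    ← LinearMap.rTensor_comp] at h'
  simp only [LinearEquiv.comp_coe, LinearEquiv.symm_trans_self, LinearEquiv.refl_toLinearMap,
    LinearMap.rTensor_id, LinearMap.id_coe, id_eq, LinearEquiv.apply_symm_apply] at h'
  rw [← h', ← LinearMap.comp_apply (LinearMap.rTensor N P.symm.toLinearMap),
    ← LinearMap.rTensor_comp]
  simp

theorem LegsCommute.of_coassoc {P : L ⊗[k] M →ₗ[k] L' ⊗[k] M'} {R : M ⊗[k] N →ₗ[k] M ⊗[k] N}
    {R' : M' ⊗[k] N →ₗ[k] M' ⊗[k] N}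
    (h : ∀ l m n, TensorProduct.map P LinearMap.id
        ((TensorProduct.assoc k L M N).symm (l ⊗ₜ R (m ⊗ₜ n))) =
      (TensorProduct.assoc k L' M' N).symm
        (TensorProduct.map LinearMap.id R'
          (TensorProduct.assoc k L' M' N (P (l ⊗ₜ m) ⊗ₜ n)))) : LegsCommute P R R' := by
  intro l m n
  rw [← rTensor_assoc_symm_tmul, ← lTensor_assoc_tmul]
  exact h l m n

end Partial

namespace AlgebraicQuantumGroup

variable {k A : Type*} [Field k] [NonUnitalRing A] [Module k A]
  [IsScalarTower k A A] [SMulCommClass k A A] (Q : AlgebraicQuantumGroup k A)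

theorem legs : LegsCommute Q.T1Δ.toLinearMap Q.TΔ2.toLinearMap Q.TΔ2.toLinearMap :=
  .of_coassoc Q.coassoc

/-! ### The counit -/

theorem exists_ne_zero (Q : AlgebraicQuantumGroup k A) : ∃ a : A, a ≠ 0 := by
  obtain ⟨a, ha⟩ := exists_eq_one_of_ne_zero Q.φ_ne_zero
  exact ⟨a, fun h => by simp [h] at ha⟩

theorem rTensor_mul_assoc_symm (p : A) (t : A ⊗[k] A) :
    (mulLeft k p).rTensor A t = (LinearMap.mul' k A).rTensor A
      ((TensorProduct.assoc k A A A).symm (p ⊗ₜ t)) := by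
  induction t with
  | zero => simp
  | add s t hs ht => simp only [map_add, TensorProduct.tmul_add, hs, ht]
  | tmul a b => simp

theorem lTensor_mul_assoc_symm (f : A →ₗ[k] A ⊗[k] A) (t : A ⊗[k] A) :
    (LinearMap.mul' k A).lTensor A (TensorProduct.assoc k A A A
      ((TensorProduct.assoc k A A A).symm (f.lTensor A t))) =
    (LinearMap.mul' k A ∘ₗ f).lTensor A t := by
  rw [LinearEquiv.apply_symm_apply, LinearMap.lTensor_comp_apply]

/-- Invert `TΔ2` in the coassociativity identity and multiply the last two legs: because
T1Δ(c⊗p)(1⊗q) = (c⊗1)TΔ2(p⊗q), the inverse cancels. The next lemma is the mirror image. -/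
theorem mul'_TΔ2_symm_tmul (c a b : A) :
    (LinearMap.mul' k A ∘ₗ appR Q.TΔ2.symm.toLinearMap b).lTensor A (Q.T1Δ (c ⊗ₜ a)) =
      (c * a) ⊗ₜ b := by
  have h := Q.legs.symm_right c a b
  have h' := congrArg (fun t => (LinearMap.mul' k A).lTensor A (TensorProduct.assoc k A A A t)) h
  simp only [LinearEquiv.coe_coe] at h'
  rw [lTensor_mul_assoc_symm] at h'
  rw [← h']
  obtain ⟨u, hu⟩ := Q.TΔ2.surjective (a ⊗ₜ b)
  have key : ∀ u : A ⊗[k] A, (LinearMap.mul' k A).lTensor A (TensorProduct.assoc k A A A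
      ((appL Q.T1Δ.toLinearMap c).rTensor A u)) = (mulLeft k c).rTensor A (Q.TΔ2 u) := by
    intro u
    induction u with
    | zero => simp
    | add s t hs ht => simp only [map_add, hs, ht]
    | tmul p q =>
      rw [← T1Δ_TΔ2, LinearMap.rTensor_tmul, appL_apply]
      generalize (Q.T1Δ.toLinearMap (c ⊗ₜ p)) = s
      induction s with
      | zero => simp
      | add s t hs ht => simp only [map_add, TensorProduct.add_tmul, hs, ht]
      | tmul p q => simp
  rw [key, LinearEquiv.apply_symm_apply]
  simp

theorem mul'_T1Δ_symm_tmul (b a c : A) :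
    (LinearMap.mul' k A ∘ₗ appL Q.T1Δ.symm.toLinearMap b).rTensor A (Q.TΔ2 (a ⊗ₜ c)) =
      b ⊗ₜ (a * c) := by
  have h := Q.legs.symm_left b a c
  have h' := congrArg (fun t => (LinearMap.mul' k A).rTensor A t) h
  simp only [LinearEquiv.coe_coe] at h'
  rw [← LinearMap.rTensor_comp_apply] at h'
  rw [h']
  have key : ∀ u : A ⊗[k] A, (LinearMap.mul' k A).rTensor A ((TensorProduct.assoc k A A A).symm
      ((appR Q.TΔ2.toLinearMap c).lTensor A u)) = (mulRight k c).lTensor A (Q.T1Δ u) := by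
    intro u
    induction u with
    | zero => simp
    | add s t hs ht => simp only [map_add, hs, ht]
    | tmul p q =>
      rw [T1Δ_TΔ2, LinearMap.lTensor_tmul, appR_apply, ← rTensor_mul_assoc_symm]
      rfl
  rw [key, LinearEquiv.apply_symm_apply]
  simp

/-- With m the product, `mul'_TΔ2_symm_tmul` evaluated on T1Δ⁻¹(p⊗q) gives p ⊗ m(TΔ2⁻¹(q⊗b)) =
m(T1Δ⁻¹(p⊗q)) ⊗ b. So m(TΔ2⁻¹(q⊗b)) is a multiple of b by a scalar depending on q only, and the same
scalar appears on the other side. -/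
theorem exists_counit : ∃ ε : A →ₗ[k] k,
    (∀ a b : A, LinearMap.mul' k A (Q.TΔ2.symm (a ⊗ₜ b)) = ε a • b) ∧
    (∀ a b : A, LinearMap.mul' k A (Q.T1Δ.symm (a ⊗ₜ b)) = ε b • a) := by
  obtain ⟨e, he⟩ := Q.exists_ne_zero
  obtain ⟨χ, hχ⟩ := exists_dual_eq_one (k := k) he
  let ε : A →ₗ[k] k := χ ∘ₗ LinearMap.mul' k A ∘ₗ appL Q.T1Δ.symm.toLinearMap e
  have h1 : ∀ p q b : A, p ⊗ₜ[k] (LinearMap.mul' k A (Q.TΔ2.symm (q ⊗ₜ b))) =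
      LinearMap.mul' k A (Q.T1Δ.symm (p ⊗ₜ q)) ⊗ₜ[k] b := by
    intro p q b
    have key : ∀ u : A ⊗[k] A, (LinearMap.mul' k A ∘ₗ appR Q.TΔ2.symm.toLinearMap b).lTensor A
        (Q.T1Δ u) = LinearMap.mul' k A u ⊗ₜ b := by
      intro u
      induction u with
      | zero => simp
      | add s t hs ht => simp only [map_add, TensorProduct.add_tmul, hs, ht]
      | tmul p q => rw [mul'_TΔ2_symm_tmul]; simp
    simpa using key (Q.T1Δ.symm (p ⊗ₜ q))
  have h2 : ∀ a b : A, LinearMap.mul' k A (Q.TΔ2.symm (a ⊗ₜ b)) = ε a • b := by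
    intro a b
    simpa [hχ, ε] using congrArg (sliceL χ) (h1 e a b)
  refine ⟨ε, h2, fun a b => ?_⟩
  have := h1 a b e
  rw [h2, TensorProduct.tmul_smul, TensorProduct.smul_tmul'] at this
  exact (tmul_right_cancel he this).symm

/-- The counit. -/
def counit : A →ₗ[k] k := Classical.choose Q.exists_counit

theorem mul'_TΔ2_symm (a b : A) : LinearMap.mul' k A (Q.TΔ2.symm (a ⊗ₜ b)) = Q.counit a • b :=
  (Classical.choose_spec Q.exists_counit).1 a b

theorem mul'_T1Δ_symm (a b : A) : LinearMap.mul' k A (Q.T1Δ.symm (a ⊗ₜ b)) = Q.counit b • a :=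
  (Classical.choose_spec Q.exists_counit).2 a b

theorem sliceL_counit_TΔ2 (a b : A) : sliceL Q.counit (Q.TΔ2 (a ⊗ₜ b)) = a * b := by
  obtain ⟨e, he⟩ := Q.exists_ne_zero
  apply tmul_left_cancel (k := k) he
  rw [← mul'_T1Δ_symm_tmul]
  generalize Q.TΔ2 (a ⊗ₜ b) = t
  induction t with
  | zero => simp
  | add s t hs ht => simp only [map_add, TensorProduct.tmul_add, hs, ht]
  | tmul p q => simp [mul'_T1Δ_symm, TensorProduct.smul_tmul]

theorem sliceR_counit_T1Δ (a b : A) : sliceR Q.counit (Q.T1Δ (a ⊗ₜ b)) = a * b := by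
  obtain ⟨e, he⟩ := Q.exists_ne_zero
  apply tmul_right_cancel (k := k) he
  rw [← mul'_TΔ2_symm_tmul]
  generalize Q.T1Δ (a ⊗ₜ b) = t
  induction t with
  | zero => simp
  | add s t hs ht => simp only [map_add, TensorProduct.add_tmul, hs, ht]
  | tmul p q => simp [mul'_TΔ2_symm, TensorProduct.smul_tmul]

/-- As `T1Δ` is onto, the counit property extends to (ι⊗ε)(uΔ(c)) = (ι⊗ε)(u)c for every u in A⊗A.
For u = p⊗q this says (ι⊗ε)((1⊗q)v) = ε(q)(ι⊗ε)(v) with v = T1Δ(p⊗c), hence for all v. -/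
theorem counit_mul (a b : A) : Q.counit (a * b) = Q.counit a * Q.counit b := by
  have h1 : ∀ (u : A ⊗[k] A) (c : A), sliceR Q.counit ((Q.comul c).rmul u) =
      sliceR Q.counit u * c := by
    intro u c
    obtain ⟨u, rfl⟩ := Q.T1Δ.surjective u
    induction u with
    | zero => simp
    | add s t hs ht => simp only [map_add, add_mul, hs, ht]
    | tmul p q => rw [← T1Δ_mul_right, sliceR_counit_T1Δ, sliceR_counit_T1Δ, mul_assoc]
  have h2 : ∀ (q : A) (u : A ⊗[k] A), sliceR Q.counit ((mulLeft k q).lTensor A u) =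
      Q.counit q • sliceR Q.counit u := by
    intro q u
    obtain ⟨u, rfl⟩ := Q.T1Δ.surjective u
    induction u with
    | zero => simp
    | add s t hs ht => simp only [map_add, smul_add, hs, ht]
    | tmul p c =>
      rw [← comul_rmul_T1Δ, h1, sliceR_counit_T1Δ, sliceR_tmul, smul_mul_assoc]
  obtain ⟨e, he⟩ := Q.exists_ne_zero
  have := h2 a (e ⊗ₜ b)
  simp only [LinearMap.lTensor_tmul, sliceR_tmul, LinearMap.mulLeft_apply, smul_smul] at this
  exact smul_left_injective k he this

theorem exists_counit_eq_one : ∃ e, Q.counit e = 1 := by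
  apply exists_eq_one_of_ne_zero
  intro h
  obtain ⟨e, he⟩ := Q.exists_ne_zero
  apply he
  apply Q.nondeg_left
  intro b
  rw [← Q.sliceR_counit_T1Δ, h]
  simp [sliceR]

theorem mul'_surjective (Q : AlgebraicQuantumGroup k A) :
    Function.Surjective (LinearMap.mul' k A) := by
  obtain ⟨e, he⟩ := Q.exists_counit_eq_one
  exact fun a => ⟨Q.TΔ2.symm (e ⊗ₜ a), by rw [mul'_TΔ2_symm, he, one_smul]⟩

theorem sliceR_counit_TΔ1 (a b : A) : sliceR Q.counit (Q.TΔ1 (a ⊗ₜ b)) = a * b := by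
  apply mul_left_cancel_of_nondeg Q.nondeg_right
  intro c
  have := congrArg (sliceR Q.counit) (Q.T1Δ_TΔ1 c a b)
  rw [sliceR_rTensor, sliceR_rTensor, sliceR_counit_T1Δ] at this
  simpa [mul_assoc] using this.symm

theorem sliceL_counit_rTensor_mulLeft (a : A) (t : A ⊗[k] A) :
    sliceL Q.counit ((mulLeft k a).rTensor A t) = Q.counit a • sliceL Q.counit t := by
  induction t with
  | zero => simp
  | add s t hs ht => simp only [map_add, smul_add, hs, ht]
  | tmul p q => simp [counit_mul, smul_smul]

theorem sliceL_counit_T1Δ (a b : A) : sliceL Q.counit (Q.T1Δ (a ⊗ₜ b)) = Q.counit a • b := by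
  apply mul_right_cancel_of_nondeg Q.nondeg_left
  intro c
  have := congrArg (sliceL Q.counit) (Q.T1Δ_TΔ2 a b c)
  rw [sliceL_lTensor, sliceL_counit_rTensor_mulLeft, sliceL_counit_TΔ2] at this
  simpa [smul_mul_assoc] using this

end AlgebraicQuantumGroup

namespace AlgebraicQuantumGroup

variable {k A : Type*} [Field k] [NonUnitalRing A] [Module k A]
  [IsScalarTower k A A] [SMulCommClass k A A] (Q : AlgebraicQuantumGroup k A)

/-! ### The antipode -/

theorem TΔ2_lTensor_mulRight (b : A) (u : A ⊗[k] A) :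
    Q.TΔ2 ((mulRight k b).lTensor A u) = (mulRight k b).lTensor A (Q.TΔ2 u) := by
  induction u with
  | zero => simp
  | add s t hs ht => simp only [map_add, hs, ht]
  | tmul p q => simp [TΔ2_mul_right]

theorem TΔ2_rTensor_mulLeft (b : A) (u : A ⊗[k] A) :
    Q.TΔ2 ((mulLeft k b).rTensor A u) = (Q.comul b).lmul (Q.TΔ2 u) := by
  induction u with
  | zero => simp
  | add s t hs ht => simp only [map_add, hs, ht]
  | tmul p q => simp [TΔ2_mul_left]

theorem T1Δ_rTensor_mulLeft (b : A) (u : A ⊗[k] A) :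
    Q.T1Δ ((mulLeft k b).rTensor A u) = (mulLeft k b).rTensor A (Q.T1Δ u) := by
  induction u with
  | zero => simp
  | add s t hs ht => simp only [map_add, hs, ht]
  | tmul p q => simp [T1Δ_mul_left]

theorem T1Δ_lTensor_mulRight (b : A) (u : A ⊗[k] A) :
    Q.T1Δ ((mulRight k b).lTensor A u) = (Q.comul b).rmul (Q.T1Δ u) := by
  induction u with
  | zero => simp
  | add s t hs ht => simp only [map_add, hs, ht]
  | tmul p q => simp [T1Δ_mul_right]

/-- Coassociativity with `TΔ2` inverted and the counit on the middle leg. The map in the second leg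
on the right will turn out to be a ↦ S(a)b. The next lemma is the mirror image. -/
theorem rTensor_mulLeft_TΔ2_symm (p q b : A) :
    (mulLeft k p).rTensor A (Q.TΔ2.symm (q ⊗ₜ b)) =
      (sliceL Q.counit ∘ₗ appR Q.TΔ2.symm.toLinearMap b).lTensor A (Q.T1Δ (p ⊗ₜ q)) := by
  have h := congrArg ((sliceR Q.counit).rTensor A) (Q.legs.symm_right p q b)
  rw [sliceR_rTensor_assoc_symm, ← LinearMap.lTensor_comp_apply,
    ← LinearMap.rTensor_comp_apply] at h
  have e : sliceR Q.counit ∘ₗ appL Q.T1Δ.toLinearMap p = mulLeft k p := by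
    ext a; simp [sliceR_counit_T1Δ]
  rw [e] at h
  exact h

theorem lTensor_mulRight_T1Δ_symm (b q p : A) :
    (mulRight k p).lTensor A (Q.T1Δ.symm (b ⊗ₜ q)) =
      (sliceR Q.counit ∘ₗ appL Q.T1Δ.symm.toLinearMap b).rTensor A (Q.TΔ2 (q ⊗ₜ p)) := by
  have h := congrArg ((sliceR Q.counit).rTensor A) (Q.legs.symm_left b q p)
  rw [sliceR_rTensor_assoc_symm, ← LinearMap.lTensor_comp_apply,
    ← LinearMap.rTensor_comp_apply] at h
  have e : sliceL Q.counit ∘ₗ appR Q.TΔ2.toLinearMap p = mulRight k p := by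
    ext a; simp [sliceL_counit_TΔ2]
  rw [e] at h
  exact h.symm

/-- Apply T1Δ⁻¹ and TΔ2⁻¹ to c⊗a⊗b in either order and multiply the three legs together. This makes
the left and the right formula for the antipode define one and the same multiplier. -/
theorem slice_counit_central (c a b : A) : sliceR Q.counit (Q.T1Δ.symm (c ⊗ₜ a)) * b =
    c * sliceL Q.counit (Q.TΔ2.symm (a ⊗ₜ b)) := by
  have h := congrArg (fun t => LinearMap.mul' k A ((LinearMap.mul' k A).rTensor A t))
    (Q.legs.symm_right.symm_left c a b)
  simp only [LinearEquiv.coe_coe] at h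
  have e1 : ∀ u : A ⊗[k] A, LinearMap.mul' k A ((LinearMap.mul' k A).rTensor A
      ((appL Q.T1Δ.symm.toLinearMap c).rTensor A u)) = c * sliceL Q.counit u := by
    intro u
    induction u with
    | zero => simp
    | add s t hs ht => simp only [map_add, mul_add, hs, ht]
    | tmul p q => simp [mul'_T1Δ_symm, mul_smul_comm, smul_mul_assoc]
  have e2 : ∀ w : A ⊗[k] (A ⊗[k] A), LinearMap.mul' k A ((LinearMap.mul' k A).rTensor A
      ((TensorProduct.assoc k A A A).symm w)) =
      LinearMap.mul' k A ((LinearMap.mul' k A).lTensor A w) := by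
    intro w
    induction w with
    | zero => simp
    | add s t hs ht => simp only [map_add, hs, ht]
    | tmul p w =>
      induction w with
      | zero => simp
      | add s t hs ht => simp only [map_add, TensorProduct.tmul_add, hs, ht]
      | tmul q r => simp [mul_assoc]
  have e3 : ∀ u : A ⊗[k] A, LinearMap.mul' k A ((LinearMap.mul' k A).lTensor A
      ((appR Q.TΔ2.symm.toLinearMap b).lTensor A u)) = sliceR Q.counit u * b := by
    intro u
    induction u with
    | zero => simp
    | add s t hs ht => simp only [map_add, add_mul, hs, ht]
    | tmul p q => simp [mul'_TΔ2_symm, smul_mul_assoc]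
  rw [e1, e2, e3] at h
  exact h.symm

theorem lTensor_mulRight_TΔ2_symm_TΔ1 (b : A) (u : A ⊗[k] A) :
    (mulRight k b).lTensor A (Q.TΔ2.symm (Q.TΔ1 u)) =
      (sliceL Q.counit ∘ₗ appR Q.TΔ2.symm.toLinearMap b).lTensor A (Q.T1Δ u) := by
  induction u with
  | zero => simp
  | add s t hs ht => simp only [map_add, hs, ht]
  | tmul p q =>
    rw [← rTensor_mulLeft_TΔ2_symm]
    apply Q.TΔ2.injective
    rw [TΔ2_lTensor_mulRight, TΔ2_rTensor_mulLeft, LinearEquiv.apply_symm_apply,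
      LinearEquiv.apply_symm_apply, comul_lmul_TΔ1]

/-- The composite TΔ2⁻¹TΔ1T1Δ⁻¹ has the form ι⊗S: multiplied by b in the second leg it sends x⊗a to
x ⊗ (ε⊗ι)TΔ2⁻¹(a⊗b). Being a composite of bijections, it makes S bijective. -/
theorem exists_antipode : ∃ S : A ≃ₗ[k] A,
    (∀ t, Q.TΔ1 t = Q.TΔ2 (S.toLinearMap.lTensor A (Q.T1Δ t))) ∧
    ∀ a b : A, S a * b = sliceL Q.counit (Q.TΔ2.symm (a ⊗ₜ b)) := by
  obtain ⟨e, he⟩ := Q.exists_ne_zero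
  obtain ⟨χ, hχ⟩ := exists_dual_eq_one (k := k) he
  let Ψ : A ⊗[k] A ≃ₗ[k] A ⊗[k] A := Q.T1Δ.symm ≪≫ₗ Q.TΔ1 ≪≫ₗ Q.TΔ2.symm
  let S : A →ₗ[k] A := sliceL χ ∘ₗ appL Ψ.toLinearMap e
  have h1 : ∀ x a b : A, (mulRight k b).lTensor A (Ψ (x ⊗ₜ a)) =
      x ⊗ₜ sliceL Q.counit (Q.TΔ2.symm (a ⊗ₜ b)) := by
    intro x a b
    simp only [Ψ, LinearEquiv.trans_apply]
    rw [lTensor_mulRight_TΔ2_symm_TΔ1, LinearEquiv.apply_symm_apply]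
    simp
  have h2 : ∀ a b : A, S a * b = sliceL Q.counit (Q.TΔ2.symm (a ⊗ₜ b)) := by
    intro a b
    have := congrArg (sliceL χ) (h1 e a b)
    rw [sliceL_lTensor] at this
    simpa [hχ, S] using this
  have h3 : ∀ u, Ψ u = S.lTensor A u := by
    intro u
    induction u with
    | zero => simp
    | add s t hs ht => simp only [map_add, hs, ht]
    | tmul x a =>
      apply lTensor_mulRight_cancel Q.nondeg_left
      intro b
      rw [h1, LinearMap.lTensor_tmul, LinearMap.lTensor_tmul, LinearMap.mulRight_apply, h2]
  have hinj : Function.Injective S := by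
    rw [← LinearMap.ker_eq_bot, LinearMap.ker_eq_bot']
    intro a ha
    have : Ψ (e ⊗ₜ a) = Ψ (e ⊗ₜ 0) := by simp [h3, ha]
    exact tmul_left_cancel he (Ψ.injective this)
  have hsurj : Function.Surjective S := by
    intro b
    refine ⟨sliceL χ (Ψ.symm (e ⊗ₜ b)), ?_⟩
    rw [← sliceL_lTensor, ← h3, LinearEquiv.apply_symm_apply]
    simp [hχ]
  refine ⟨LinearEquiv.ofBijective S ⟨hinj, hsurj⟩, fun t => ?_, h2⟩
  have := h3 (Q.T1Δ t)
  simp only [Ψ, LinearEquiv.trans_apply, LinearEquiv.symm_apply_apply] at this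
  rw [LinearEquiv.symm_apply_eq] at this
  exact this

/-- The antipode. -/
def antipode : A ≃ₗ[k] A := Classical.choose Q.exists_antipode

theorem TΔ1_eq (t : A ⊗[k] A) :
    Q.TΔ1 t = Q.TΔ2 (Q.antipode.toLinearMap.lTensor A (Q.T1Δ t)) :=
  (Classical.choose_spec Q.exists_antipode).1 t

theorem antipode_mul_eq (a b : A) :
    Q.antipode a * b = sliceL Q.counit (Q.TΔ2.symm (a ⊗ₜ b)) :=
  (Classical.choose_spec Q.exists_antipode).2 a b

theorem mul_antipode_eq (a b : A) :
    a * Q.antipode b = sliceR Q.counit (Q.T1Δ.symm (a ⊗ₜ b)) := by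
  apply mul_right_cancel_of_nondeg Q.nondeg_left
  intro c
  rw [slice_counit_central, mul_assoc, antipode_mul_eq]

theorem mul'_antipode_rTensor (t : A ⊗[k] A) :
    LinearMap.mul' k A (Q.antipode.toLinearMap.rTensor A t) =
      sliceL Q.counit (Q.TΔ2.symm t) := by
  induction t with
  | zero => simp
  | add s t hs ht => simp only [map_add, hs, ht]
  | tmul a b => simp [antipode_mul_eq]

theorem mul'_antipode_lTensor (t : A ⊗[k] A) :
    LinearMap.mul' k A (Q.antipode.toLinearMap.lTensor A t) =
      sliceR Q.counit (Q.T1Δ.symm t) := by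
  induction t with
  | zero => simp
  | add s t hs ht => simp only [map_add, hs, ht]
  | tmul a b => simp [mul_antipode_eq]

theorem mul'_antipode_TΔ2 (a b : A) :
    LinearMap.mul' k A (Q.antipode.toLinearMap.rTensor A (Q.TΔ2 (a ⊗ₜ b))) = Q.counit a • b := by
  rw [mul'_antipode_rTensor, LinearEquiv.symm_apply_apply, sliceL_tmul]

theorem mul'_antipode_T1Δ (a b : A) :
    LinearMap.mul' k A (Q.antipode.toLinearMap.lTensor A (Q.T1Δ (a ⊗ₜ b))) = Q.counit b • a := by
  rw [mul'_antipode_lTensor, LinearEquiv.symm_apply_apply, sliceR_tmul]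

theorem mul'_antipode_comul_lmul (a : A) (t : A ⊗[k] A) :
    LinearMap.mul' k A (Q.antipode.toLinearMap.rTensor A ((Q.comul a).lmul t)) =
      Q.counit a • LinearMap.mul' k A (Q.antipode.toLinearMap.rTensor A t) := by
  obtain ⟨u, rfl⟩ := Q.TΔ2.surjective t
  rw [← TΔ2_rTensor_mulLeft, mul'_antipode_rTensor, mul'_antipode_rTensor,
    LinearEquiv.symm_apply_apply, LinearEquiv.symm_apply_apply, sliceL_counit_rTensor_mulLeft]

theorem sliceR_counit_lTensor_mulRight (a : A) (t : A ⊗[k] A) :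
    sliceR Q.counit ((mulRight k a).lTensor A t) = Q.counit a • sliceR Q.counit t := by
  induction t with
  | zero => simp
  | add s t hs ht => simp only [map_add, smul_add, hs, ht]
  | tmul p q => simp [counit_mul, smul_smul, mul_comm]

theorem mul'_antipode_comul_rmul (a : A) (t : A ⊗[k] A) :
    LinearMap.mul' k A (Q.antipode.toLinearMap.lTensor A ((Q.comul a).rmul t)) =
      Q.counit a • LinearMap.mul' k A (Q.antipode.toLinearMap.lTensor A t) := by
  obtain ⟨u, rfl⟩ := Q.T1Δ.surjective t
  rw [← T1Δ_lTensor_mulRight, mul'_antipode_lTensor, mul'_antipode_lTensor,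
    LinearEquiv.symm_apply_apply, LinearEquiv.symm_apply_apply, sliceR_counit_lTensor_mulRight]

/-- With m the product, m(S⊗ι)(Δ(a)t) = ε(a)m(S⊗ι)(t). As `TΔ2` is onto, this gives m(S⊗ι)(t(p⊗1)) =
S(p)m(S⊗ι)(t) for all t, in particular for t = a⊗c. -/
theorem antipode_mul (a b : A) : Q.antipode (a * b) = Q.antipode b * Q.antipode a := by
  have key : ∀ (p : A) (t : A ⊗[k] A),
      LinearMap.mul' k A (Q.antipode.toLinearMap.rTensor A ((mulRight k p).rTensor A t)) =
      Q.antipode p * LinearMap.mul' k A (Q.antipode.toLinearMap.rTensor A t) := by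
    intro p t
    obtain ⟨u, rfl⟩ := Q.TΔ2.surjective t
    induction u with
    | zero => simp
    | add s t hs ht => simp only [map_add, mul_add, hs, ht]
    | tmul a q =>
      rw [← comul_lmul_TΔ2, mul'_antipode_comul_lmul, mul'_antipode_TΔ2]
      simp [mul_smul_comm]
  apply mul_right_cancel_of_nondeg Q.nondeg_left
  intro c
  simpa [mul_assoc] using key b (a ⊗ₜ c)

theorem counit_antipode (a : A) : Q.counit (Q.antipode a) = Q.counit a := by
  obtain ⟨e, he⟩ := Q.exists_counit_eq_one
  have h1 := congrArg Q.counit (Q.mul_antipode_eq e a)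
  have h2 := congrArg Q.counit (Q.mul'_T1Δ_symm e a)
  rw [counit_mul, he, one_mul] at h1
  rw [map_smul, he, smul_eq_mul, mul_one] at h2
  rw [h1, ← h2]
  generalize Q.T1Δ.symm (e ⊗ₜ a) = t
  induction t with
  | zero => simp
  | add s t hs ht => simp only [map_add, hs, ht]
  | tmul p q => simp [counit_mul, mul_comm]

theorem mul'_antipode_TΔ1 (a c : A) :
    LinearMap.mul' k A (Q.antipode.toLinearMap.rTensor A (Q.TΔ1 (a ⊗ₜ c))) =
      Q.counit a • Q.antipode c := by
  apply mul_right_cancel_of_nondeg Q.nondeg_left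
  intro q
  have h := Q.mul'_antipode_comul_lmul a (c ⊗ₜ q)
  rw [comul_lmul_TΔ1] at h
  simp only [LinearMap.rTensor_tmul, LinearMap.mul'_apply, LinearEquiv.coe_coe] at h
  rw [smul_mul_assoc, ← h]
  generalize Q.TΔ1 (a ⊗ₜ c) = t
  induction t with
  | zero => simp
  | add s t hs ht => simp only [map_add, add_mul, hs, ht]
  | tmul p q => simp [mul_assoc]

theorem mul'_antipode_T2Δ (b q : A) :
    LinearMap.mul' k A (Q.antipode.toLinearMap.lTensor A (Q.T2Δ (b ⊗ₜ q))) =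
      Q.counit q • Q.antipode b := by
  apply mul_left_cancel_of_nondeg Q.nondeg_right
  intro c
  have h := Q.mul'_antipode_comul_rmul q (c ⊗ₜ b)
  rw [comul_rmul_T2Δ] at h
  simp only [LinearMap.lTensor_tmul, LinearMap.mul'_apply, LinearEquiv.coe_coe] at h
  rw [mul_smul_comm, ← h]
  generalize Q.T2Δ (b ⊗ₜ q) = t
  induction t with
  | zero => simp
  | add s t hs ht => simp only [map_add, mul_add, hs, ht]
  | tmul p q => simp [mul_assoc]

theorem T2Δ_eq (t : A ⊗[k] A) :
    Q.T2Δ t = Q.T1Δ (Q.antipode.toLinearMap.rTensor A (Q.TΔ2 t)) := by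
  rw [← LinearEquiv.symm_apply_eq]
  induction t with
  | zero => simp
  | add s t hs ht => simp only [map_add, hs, ht]
  | tmul q p =>
    apply rTensor_mulLeft_cancel Q.nondeg_right
    intro b
    have h := Q.lTensor_mulRight_T1Δ_symm b q p
    have e : sliceR Q.counit ∘ₗ appL Q.T1Δ.symm.toLinearMap b =
        mulLeft k b ∘ₗ Q.antipode.toLinearMap := by
      ext a; simp [mul_antipode_eq]
    rw [e, LinearMap.rTensor_comp_apply] at h
    rw [← h]
    apply Q.T1Δ.injective
    rw [T1Δ_rTensor_mulLeft, T1Δ_lTensor_mulRight, LinearEquiv.apply_symm_apply,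
      LinearEquiv.apply_symm_apply, comul_rmul_T2Δ]

end AlgebraicQuantumGroup

/-! ### Coassociativity of a Galois object -/

theorem lTensor_rTensor_assoc_symm {k A B B' C : Type*} [Field k] [AddCommGroup A] [Module k A]
    [AddCommGroup B] [Module k B] [AddCommGroup B'] [Module k B'] [AddCommGroup C] [Module k C]
    (f : B →ₗ[k] B') (t : A ⊗[k] (B ⊗[k] C)) :
    (f.lTensor A).rTensor C ((TensorProduct.assoc k A B C).symm t) =
      (TensorProduct.assoc k A B' C).symm ((f.rTensor C).lTensor A t) := by
  induction t with
  | zero => simp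
  | add s t hs ht => simp only [map_add, hs, ht]
  | tmul a t =>
    induction t with
    | zero => simp
    | add s t hs ht => simp only [map_add, TensorProduct.tmul_add, hs, ht]
    | tmul b c => simp

theorem lTensor_assoc_symm {k A B C C' : Type*} [Field k] [AddCommGroup A] [Module k A]
    [AddCommGroup B] [Module k B] [AddCommGroup C'] [Module k C'] [AddCommGroup C] [Module k C]
    (f : C →ₗ[k] C') (t : A ⊗[k] (B ⊗[k] C)) :
    f.lTensor (A ⊗[k] B) ((TensorProduct.assoc k A B C).symm t) =
      (TensorProduct.assoc k A B C').symm ((f.lTensor B).lTensor A t) := by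
  induction t with
  | zero => simp
  | add s t hs ht => simp only [map_add, hs, ht]
  | tmul a t =>
    induction t with
    | zero => simp
    | add s t hs ht => simp only [map_add, TensorProduct.tmul_add, hs, ht]
    | tmul b c => simp

theorem lTensor_smulRight {k A X : Type*} [Field k] [AddCommGroup A] [Module k A]
    [AddCommGroup X] [Module k X] (p : A →ₗ[k] k) (b : A) (t : X ⊗[k] A) :
    (p.smulRight b).lTensor X t = sliceR p t ⊗ₜ b := by
  induction t with
  | zero => simp
  | add s t hs ht => simp only [map_add, TensorProduct.add_tmul, hs, ht]
  | tmul p q => simp [TensorProduct.smul_tmul]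

namespace AlgebraicQuantumGroup

variable {k A : Type*} [Field k] [NonUnitalRing A] [Module k A]
  [IsScalarTower k A A] [SMulCommClass k A A] (Q : AlgebraicQuantumGroup k A)

/-- An algebraic quantum group, seen as a Galois object over itself. -/
def selfGalois : GaloisObject Q A where
  nondeg_left := Q.nondeg_left
  nondeg_right := Q.nondeg_right
  α := Q.comul
  α_injective a b h := by
    obtain ⟨e, he⟩ := Q.exists_ne_zero
    have := Q.nondeg
    refine tmul_left_cancel (k := k) he (Q.T1Δ.injective ?_)
    rw [← Mult.incl_inj (k := k), T1Δ_spec, T1Δ_spec, h]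
  T₁ := Q.TΔ2.toLinearMap
  T₁_spec := Q.TΔ2_spec
  T₂ := Q.T2Δ.toLinearMap ∘ₗ (TensorProduct.comm k A A).toLinearMap
  T₂_spec a b := Q.T2Δ_spec b a
  V := Q.T1Δ
  V_spec := Q.T1Δ_spec
  coassoc := Q.coassoc
  coinvariants f hf := by
    have := Q.nondeg
    obtain ⟨e, he⟩ := Q.exists_counit_eq_one
    refine ⟨Q.counit (f.lmul e), Mult.ext_of_rmul Q.nondeg_right fun a => ?_⟩
    -- The counit has the value ε(fe) at the multiplier f; applying ε⊗ι to (e⊗1)Δ(af) =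
    -- (e⊗1)Δ(a)(f⊗1) then gives af = ε(fe)a.
    have h1 : Q.counit ∘ₗ f.rmul = Q.counit (f.lmul e) • Q.counit := by
      ext p
      have := congrArg Q.counit (f.central p e)
      rw [counit_mul, counit_mul, he, mul_one] at this
      simp [← this, mul_comm]
    have h2 : Q.T1Δ (e ⊗ₜ f.rmul a) = f.rmul.rTensor A (Q.T1Δ (e ⊗ₜ a)) := by
      rw [← Mult.rmul_tmul_one, ← Mult.incl_inj (k := k), Mult.incl_rmul, T1Δ_spec, T1Δ_spec,
        ← (hf a).2, mul_assoc]
    have h3 := congrArg (sliceL Q.counit) h2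
    rw [sliceL_rTensor, sliceL_counit_T1Δ, he, one_smul, h1] at h3
    rw [h3, Mult.rmul_algebraMap]
    have h4 : ∀ c : k, sliceL (c • Q.counit) (Q.T1Δ (e ⊗ₜ a)) =
        c • sliceL Q.counit (Q.T1Δ (e ⊗ₜ a)) := by
      intro c
      generalize Q.T1Δ (e ⊗ₜ a) = t
      induction t with
      | zero => simp
      | add s t hs ht => simp only [map_add, smul_add, hs, ht]
      | tmul p q => simp [smul_smul]
    rw [h4, sliceL_counit_T1Δ, he, one_smul]

end AlgebraicQuantumGroup

namespace GaloisObject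

variable {k A X : Type*} [Field k]
  [NonUnitalRing A] [Module k A] [IsScalarTower k A A] [SMulCommClass k A A]
  [NonUnitalRing X] [Module k X] [IsScalarTower k X X] [SMulCommClass k X X]
  {Q : AlgebraicQuantumGroup k A} (G : GaloisObject Q X)

theorem legs : LegsCommute G.V.toLinearMap G.T₁ Q.TΔ2.toLinearMap := .of_coassoc G.coassoc

/-- `x ↦ u α(x)` for `u ∈ X ⊗ A`. -/
def mulα : X ⊗[k] A →ₗ[k] X →ₗ[k] X ⊗[k] A :=
  LinearMap.mk₂ k (fun u x => (G.α x).rmul u) (by simp) (by simp)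
    (fun u x y => by rw [map_add]; rfl) (fun c u x => by rw [map_smul]; rfl)

@[simp] theorem mulα_apply (u : X ⊗[k] A) (x : X) : G.mulα u x = (G.α x).rmul u := rfl

theorem V_rTensor_T₂ (y x : X) (b : A) :
    (appL G.V.toLinearMap y).rTensor A (G.T₂ (x ⊗ₜ b)) = (TensorProduct.assoc k X A A).symm
      ((appL Q.T2Δ.toLinearMap b).lTensor X (G.V (y ⊗ₜ x))) := by
  apply lTensor_mulRight_cancel Q.nondeg_left
  intro a
  rw [lTensor_rTensor, T₂_T₁, ← lTensor_rTensor, G.legs, lTensor_assoc_symm, lTensor_assoc_symm,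
    ← LinearMap.lTensor_comp_apply, ← LinearMap.lTensor_comp_apply]
  congr 2
  ext c
  simp [Q.T2Δ_TΔ2]

/-- Since α is multiplicative and coassociative, (z⊗1⊗1)(α⊗ι)((x⊗1)α(y)) = ((z⊗1)α(x)⊗1)(ι⊗Δ)α(y). A
term p⊗b of V(z⊗x) contributes (p⊗b⊗1)(ι⊗Δ)α(y), which is T1Δ(b⊗ ·) on the second leg of V(p⊗y). -/
theorem V_pentagon (z x y : X) :
    (appL G.V.toLinearMap z).rTensor A (G.V (x ⊗ₜ y)) = (TensorProduct.assoc k X A A).symm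
      (Q.T1Δ.toLinearMap.lTensor X (TensorProduct.leftComm k A X A
        ((appR G.V.toLinearMap y).lTensor A (TensorProduct.comm k X A (G.V (z ⊗ₜ x)))))) := by
  apply lTensor_mulRight_cancel Q.nondeg_left
  intro a
  rw [lTensor_rTensor, V_T₁, ← LinearMap.rTensor_comp_apply]
  have e : appL G.V.toLinearMap z ∘ₗ mulLeft k x = G.mulα (G.V (z ⊗ₜ x)) := by
    ext w
    simp [V_mul_right]
  rw [e]
  generalize G.V (z ⊗ₜ x) = u
  induction u with
  | zero => simp
  | add s t hs ht => simp only [map_add, LinearMap.rTensor_add, LinearMap.add_apply, hs, ht]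
  | tmul p b =>
    have e1 : G.mulα (p ⊗ₜ b) = (mulLeft k b).lTensor X ∘ₗ appL G.V.toLinearMap p := by
      ext w
      simp [α_rmul_V]
    have e2 : ∀ s : X ⊗[k] A, Q.T1Δ.toLinearMap.lTensor X (TensorProduct.leftComm k A X A
        (b ⊗ₜ s)) = (appL Q.T1Δ.toLinearMap b).lTensor X s := by
      intro s
      induction s with
      | zero => simp
      | add s t hs ht => simp only [map_add, TensorProduct.tmul_add, hs, ht]
      | tmul p q => simp
    rw [e1, LinearMap.rTensor_comp_apply, G.legs, lTensor_rTensor_assoc_symm,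
      TensorProduct.comm_tmul, LinearMap.lTensor_tmul, e2, lTensor_assoc_symm,
      ← LinearMap.lTensor_comp_apply, ← LinearMap.lTensor_comp_apply]
    simp only [appR_apply, LinearEquiv.coe_coe]
    congr 2
    ext c
    simp [Q.T1Δ_TΔ2]

/-- The pentagon identity, followed by a linear map on the last two legs. -/
theorem V_pentagon_lTensor {M : Type*} [AddCommGroup M] [Module k M] (f : A ⊗[k] A →ₗ[k] M)
    (z x y : X) (F : X ⊗[k] A →ₗ[k] X ⊗[k] M)
    (hF : ∀ p b, F (p ⊗ₜ b) = (f ∘ₗ appL Q.T1Δ.toLinearMap b).lTensor X (G.V (p ⊗ₜ y))) :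
    f.lTensor X (TensorProduct.assoc k X A A
      ((appL G.V.toLinearMap z).rTensor A (G.V (x ⊗ₜ y)))) = F (G.V (z ⊗ₜ x)) := by
  rw [V_pentagon, LinearEquiv.apply_symm_apply, ← LinearMap.lTensor_comp_apply]
  generalize G.V (z ⊗ₜ x) = u
  induction u with
  | zero => simp
  | add s t hs ht => simp only [map_add, hs, ht]
  | tmul p b =>
    rw [hF]
    simp only [TensorProduct.comm_tmul, LinearMap.lTensor_tmul, appR_apply, LinearEquiv.coe_coe]
    generalize G.V (p ⊗ₜ y) = s
    induction s with
    | zero => simp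
    | add s t hs ht => simp only [map_add, TensorProduct.tmul_add, hs, ht]
    | tmul p q => simp

/-- The counit property of α is not an axiom; it follows from injectivity of V. The pentagon with ε
on the last leg says that V(x ⊗ (ι⊗ε)V(x⊗y)) = V(x⊗x)α(y), and this is V(x⊗xy). -/
theorem sliceR_counit_V (x y : X) : sliceR Q.counit (G.V (x ⊗ₜ y)) = x * y := by
  by_cases hx : x = 0
  · simp [hx]
  refine tmul_left_cancel (k := k) hx (G.V.injective ?_)
  rw [V_mul_right]
  have h := G.V_pentagon_lTensor (sliceR Q.counit) x x y (G.mulα.flip y) (fun p b => by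
    have e : sliceR Q.counit ∘ₗ appL Q.T1Δ.toLinearMap b = mulLeft k b := by
      ext c; simp [Q.sliceR_counit_T1Δ]
    rw [e]
    simp [α_rmul_V])
  rw [← sliceR_assoc_symm, LinearEquiv.symm_apply_apply, sliceR_rTensor] at h
  exact h

theorem sliceR_counit_V' (t : X ⊗[k] X) : sliceR Q.counit (G.V t) = LinearMap.mul' k X t := by
  induction t with
  | zero => simp
  | add s t hs ht => simp only [map_add, hs, ht]
  | tmul p q => simp [sliceR_counit_V]

theorem rTensor_mulLeft_T₁_lTensor_antipode (z : X) (t : X ⊗[k] A) :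
    (LinearMap.mul' k A ∘ₗ Q.antipode.toLinearMap.lTensor A).lTensor X
      (TensorProduct.assoc k X A A ((appL G.V.toLinearMap z).rTensor A t)) =
    (mulLeft k z).rTensor A (G.T₁ (Q.antipode.toLinearMap.lTensor X t)) := by
  induction t with
  | zero => simp
  | add s t hs ht => simp only [map_add, hs, ht]
  | tmul x a =>
    rw [LinearMap.rTensor_tmul, lTensor_assoc_tmul, LinearMap.lTensor_tmul, ← V_T₁]
    congr 2

/-- In Sweedler notation, x₍₀₎y₍₀₎ ⊗ x₍₁₎y₍₁₎S(y₍₂₎) = x₍₀₎y ⊗ x₍₁₎. This is W = T₁(ι⊗S)V, covered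
by z. -/
theorem T₁_antipode_V (z x y : X) :
    (mulLeft k z).rTensor A (G.T₁ (Q.antipode.toLinearMap.lTensor X (G.V (x ⊗ₜ y)))) =
      (mulRight k y).rTensor A (G.V (z ⊗ₜ x)) := by
  rw [← rTensor_mulLeft_T₁_lTensor_antipode]
  apply G.V_pentagon_lTensor
  intro p b
  have e : (LinearMap.mul' k A ∘ₗ Q.antipode.toLinearMap.lTensor A) ∘ₗ appL Q.T1Δ.toLinearMap b =
      Q.counit.smulRight b := by
    ext c
    simp [Q.mul'_antipode_T1Δ]
  rw [e, lTensor_smulRight, sliceR_counit_V]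
  simp

/-- In Sweedler notation, x₍₀₎ ⊗ x₍₁₎S(bx₍₂₎) = x ⊗ S(b). Together with the next lemma it provides
the inverse (ι⊗S)T₂(ι⊗S⁻¹) of T₁, which makes W bijective. -/
theorem T₁_antipode_T₂ (x : X) (b : A) :
    G.T₁ (Q.antipode.toLinearMap.lTensor X (G.T₂ (x ⊗ₜ b))) = x ⊗ₜ Q.antipode b := by
  apply rTensor_mulLeft_cancel G.nondeg_right
  intro z
  rw [← rTensor_mulLeft_T₁_lTensor_antipode, V_rTensor_T₂, LinearEquiv.apply_symm_apply,
    ← LinearMap.lTensor_comp_apply]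
  have e : (LinearMap.mul' k A ∘ₗ Q.antipode.toLinearMap.lTensor A) ∘ₗ appL Q.T2Δ.toLinearMap b =
      Q.counit.smulRight (Q.antipode b) := by
    ext c
    simp [Q.mul'_antipode_T2Δ]
  rw [e, lTensor_smulRight, sliceR_counit_V]
  simp

theorem T₂_antipode_symm_T₁ (x : X) (b : A) :
    G.T₂ (Q.antipode.symm.toLinearMap.lTensor X (G.T₁ (x ⊗ₜ b))) = x ⊗ₜ Q.antipode.symm b := by
  apply rTensor_mulLeft_cancel G.nondeg_right
  intro z
  have h := congrArg (fun t => (LinearMap.mul' k A ∘ₗ (TensorProduct.comm k A A).toLinearMap ∘ₗ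
    Q.antipode.symm.toLinearMap.lTensor A).lTensor X (TensorProduct.assoc k X A A t))
      (G.legs z x b)
  simp only [LinearEquiv.apply_symm_apply, LinearEquiv.coe_coe] at h
  have e : (LinearMap.mul' k A ∘ₗ (TensorProduct.comm k A A).toLinearMap ∘ₗ
      Q.antipode.symm.toLinearMap.lTensor A) ∘ₗ appR Q.TΔ2.toLinearMap b =
      Q.counit.smulRight (Q.antipode.symm b) := by
    ext c
    apply Q.antipode.injective
    simp only [LinearMap.comp_apply, appR_apply, LinearEquiv.coe_coe, LinearMap.smulRight_apply,
      map_smul, LinearEquiv.apply_symm_apply]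
    rw [← Q.mul'_antipode_TΔ2]
    generalize Q.TΔ2 (c ⊗ₜ b) = t
    induction t with
    | zero => simp
    | add s t hs ht => simp only [map_add, hs, ht]
    | tmul p q => simp [Q.antipode_mul]
  rw [← LinearMap.lTensor_comp_apply, e, lTensor_smulRight, sliceR_counit_V] at h
  rw [LinearMap.rTensor_tmul, LinearMap.mulLeft_apply, ← h]
  generalize G.T₁ (x ⊗ₜ b) = t
  induction t with
  | zero => simp
  | add s t hs ht => simp only [map_add, hs, ht]
  | tmul x a =>
    rw [LinearMap.rTensor_tmul, lTensor_assoc_tmul, LinearMap.lTensor_tmul, ← V_T₂]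
    congr 2

/-- `T₁` as a linear equivalence. -/
def T₁equiv : X ⊗[k] A ≃ₗ[k] X ⊗[k] A :=
  LinearEquiv.ofLinearMap G.T₁
    (Q.antipode.toLinearMap.lTensor X ∘ₗ G.T₂ ∘ₗ Q.antipode.symm.toLinearMap.lTensor X)
    (by
      ext x b
      simp [T₁_antipode_T₂])
    (by
      ext x b
      simp [T₂_antipode_symm_T₁])

/-- The bijection `x ⊗ y ↦ α(x)(y ⊗ 1)`. -/
def galoisW : X ⊗[k] X ≃ₗ[k] X ⊗[k] A :=
  G.V ≪≫ₗ Q.antipode.lTensor X ≪≫ₗ G.T₁equiv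

theorem galoisW_eq (t : X ⊗[k] X) :
    G.galoisW t = G.T₁ (Q.antipode.toLinearMap.lTensor X (G.V t)) := rfl

open Mult in
theorem galoisW_spec (x y : X) : incl (G.galoisW (x ⊗ₜ y)) = G.α x * tmul (incl y) 1 := by
  have := G.nondeg; have := Q.nondeg
  have h : ∀ z, tmul (incl z) 1 * incl (G.galoisW (x ⊗ₜ y)) =
      tmul (incl z) 1 * (G.α x * tmul (incl y) 1) := by
    intro z
    rw [← incl_rTensor_mulLeft, galoisW_eq, T₁_antipode_V, incl_rTensor_mulRight, V_spec, mul_assoc]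
  exact Mult.ext_of_lmul Nondeg.left fun t => rTensor_mulLeft_cancel G.nondeg_right fun z =>
    congrArg (fun m => m.lmul t) (h z)

theorem mul'_surjective (G : GaloisObject Q X) : Function.Surjective (LinearMap.mul' k X) := by
  obtain ⟨e, he⟩ := Q.exists_counit_eq_one
  exact fun x => ⟨G.V.symm (x ⊗ₜ e), by
    rw [← G.sliceR_counit_V', LinearEquiv.apply_symm_apply, sliceR_tmul, he, one_smul]⟩

end GaloisObject

/-- When all slices vanish, w lies in A⊗N, where N is the common kernel of the functionals; hence it
is enough that G vanishes on A⊗N. -/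
theorem map_eq_zero_of_sliceR {k A B M I : Type*} [Field k] [AddCommGroup A] [Module k A]
    [AddCommGroup B] [Module k B] [AddCommGroup M] [Module k M] (f : I → B →ₗ[k] k)
    (G : A ⊗[k] B →ₗ[k] M) (hG : ∀ a b, (∀ i, f i b = 0) → G (a ⊗ₜ b) = 0) (w : A ⊗[k] B)
    (hw : ∀ i, sliceR (f i) w = 0) : G w = 0 := by
  classical
  obtain ⟨c, rfl⟩ := TensorProduct.eq_repr_basis_left (Module.Basis.ofVectorSpace k A) w
  rw [Finsupp.sum, map_sum]
  refine Finset.sum_eq_zero fun i hi => hG _ _ fun j => ?_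
  have h := hw j
  simp only [Finsupp.sum, map_sum, sliceR_tmul] at h
  have := linearIndependent_iff'.1 (Module.Basis.ofVectorSpace k A).linearIndependent _ _ h i hi
  exact this

theorem sliceR_tmul_mul {k A B : Type*} [Field k] [NonUnitalRing A] [Module k A]
    [IsScalarTower k A A] [SMulCommClass k A A] [NonUnitalRing B] [Module k B]
    [IsScalarTower k B B] [SMulCommClass k B B] (f : B →ₗ[k] k) (u : A) (v : B) (w : A ⊗[k] B) :
    sliceR f ((u ⊗ₜ v) * w) = u * sliceR (f ∘ₗ mulLeft k v) w := by
  induction w with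
  | zero => simp
  | add s t hs ht => simp only [map_add, mul_add, hs, ht]
  | tmul p q => simp [mul_smul_comm]

theorem sliceR_mul_tmul {k A B : Type*} [Field k] [NonUnitalRing A] [Module k A]
    [IsScalarTower k A A] [SMulCommClass k A A] [NonUnitalRing B] [Module k B]
    [IsScalarTower k B B] [SMulCommClass k B B] (f : B →ₗ[k] k) (u : A) (v : B) (w : A ⊗[k] B) :
    sliceR f (w * (u ⊗ₜ v)) = sliceR (f ∘ₗ mulRight k v) w * u := by
  induction w with
  | zero => simp
  | add s t hs ht => simp only [map_add, add_mul, hs, ht]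
  | tmul p q => simp [smul_mul_assoc]

namespace AlgebraicQuantumGroup

variable {k A : Type*} [Field k] [NonUnitalRing A] [Module k A]
  [IsScalarTower k A A] [SMulCommClass k A A] (Q : AlgebraicQuantumGroup k A)

/-! ### The antipode and the comultiplication -/

/-- The pentagon as an equation between composites of invertible maps, a form in which inverses of
`T1Δ` can be inserted. -/
theorem T1Δ_pentagon (s : A ⊗[k] (A ⊗[k] A)) :
    Q.T1Δ.toLinearMap.rTensor A ((TensorProduct.assoc k A A A).symm
      (Q.T1Δ.toLinearMap.lTensor A s)) =
    (TensorProduct.assoc k A A A).symm (Q.T1Δ.toLinearMap.lTensor A (TensorProduct.leftComm k A A A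
      (Q.T1Δ.toLinearMap.lTensor A (TensorProduct.leftComm k A A A (TensorProduct.assoc k A A A
        (Q.T1Δ.toLinearMap.rTensor A ((TensorProduct.assoc k A A A).symm s))))))) := by
  induction s with
  | zero => simp
  | add s t hs ht => simp only [map_add, hs, ht]
  | tmul z s =>
    induction s with
    | zero => simp
    | add s t hs ht => simp only [map_add, TensorProduct.tmul_add, hs, ht]
    | tmul x y =>
      rw [LinearMap.lTensor_tmul, rTensor_assoc_symm_tmul]
      refine (Q.selfGalois.V_pentagon z x y).trans ?_
      congr 3
      rw [TensorProduct.assoc_symm_tmul, LinearMap.rTensor_tmul]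
      change (appR Q.T1Δ.toLinearMap y).lTensor A (TensorProduct.comm k A A (Q.T1Δ (z ⊗ₜ x))) = _
      generalize Q.T1Δ (z ⊗ₜ x) = u
      induction u with
      | zero => simp
      | add s t hs ht => simp only [map_add, TensorProduct.add_tmul, hs, ht]
      | tmul p q => simp

/-- Insert inverses of `T1Δ` in the pentagon and apply ε to the last leg; since (ι⊗ε)T1Δ⁻¹(a⊗y) =
aS(y), products with S(y) appear. -/
theorem comul_antipode_rmul (z x y : A) : (Q.comul (Q.antipode y)).rmul (z ⊗ₜ x) =
    TensorProduct.comm k A A ((mulLeft k z ∘ₗ Q.antipode.toLinearMap).lTensor A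
      (Q.T1Δ.symm (x ⊗ₜ y))) := by
  obtain ⟨u, hu⟩ := Q.T1Δ.surjective (z ⊗ₜ x)
  have hT : ∀ t : A ⊗[k] (A ⊗[k] A), Q.T1Δ.toLinearMap.lTensor A
      (Q.T1Δ.symm.toLinearMap.lTensor A t) = t := by
    intro t
    rw [← LinearMap.lTensor_comp_apply]
    simp
  have hT' : ∀ t : A ⊗[k] (A ⊗[k] A), Q.T1Δ.symm.toLinearMap.lTensor A
      (Q.T1Δ.toLinearMap.lTensor A t) = t := by
    intro t
    rw [← LinearMap.lTensor_comp_apply]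
    simp
  have h := Q.T1Δ_pentagon (Q.T1Δ.symm.toLinearMap.lTensor A (TensorProduct.assoc k A A A (u ⊗ₜ y)))
  rw [hT, LinearEquiv.symm_apply_apply, LinearMap.rTensor_tmul, LinearEquiv.coe_coe, hu,
    LinearEquiv.eq_symm_apply] at h
  have h2 := congrArg (fun t => (TensorProduct.leftComm k A A A).symm
    (Q.T1Δ.symm.toLinearMap.lTensor A ((TensorProduct.leftComm k A A A).symm
      (Q.T1Δ.symm.toLinearMap.lTensor A t)))) h
  simp only [hT', LinearEquiv.symm_apply_apply] at h2
  have h3 := congrArg (fun t => sliceR Q.counit ((TensorProduct.assoc k A A A).symm t)) h2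
  simp only [LinearEquiv.symm_apply_apply] at h3
  have e : sliceR Q.counit ∘ₗ appR Q.T1Δ.symm.toLinearMap y = mulRight k (Q.antipode y) := by
    ext a; simp [mul_antipode_eq]
  have e' : sliceR Q.counit ((TensorProduct.assoc k A A A).symm (Q.T1Δ.symm.toLinearMap.lTensor A
      (TensorProduct.assoc k A A A (u ⊗ₜ y)))) = (mulRight k (Q.antipode y)).lTensor A u := by
    rw [sliceR_assoc_symm, lTensor_assoc_tmul, ← LinearMap.lTensor_comp_apply, e]
  rw [sliceR_rTensor, e', LinearEquiv.coe_coe, T1Δ_lTensor_mulRight, hu] at h3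
  rw [← h3]
  simp only [TensorProduct.assoc_tmul, LinearMap.lTensor_tmul, LinearEquiv.coe_coe]
  generalize Q.T1Δ.symm (x ⊗ₜ y) = w
  induction w with
  | zero => simp
  | add s t hs ht => simp only [map_add, TensorProduct.tmul_add, hs, ht]
  | tmul p q =>
    simp only [TensorProduct.leftComm_symm_tmul, LinearMap.lTensor_tmul, LinearEquiv.coe_coe,
      TensorProduct.comm_tmul, LinearMap.comp_apply, LinearMap.mulLeft_apply, mul_antipode_eq]
    generalize Q.T1Δ.symm (z ⊗ₜ q) = w
    induction w with
    | zero => simp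
    | add s t hs ht => simp only [map_add, TensorProduct.tmul_add, TensorProduct.add_tmul, hs, ht]
    | tmul p q => simp [TensorProduct.smul_tmul']

/-- The covered form of the fact that S reverses Δ; it is what turns left invariance of φ into right
invariance of φ∘S. -/
theorem T1Δ_antipode (b a : A) : Q.T1Δ (Q.antipode b ⊗ₜ Q.antipode a) =
    TensorProduct.comm k A A (TensorProduct.map Q.antipode.toLinearMap Q.antipode.toLinearMap
      (Q.TΔ2 (a ⊗ₜ b))) := by
  apply lTensor_mulLeft_cancel Q.nondeg_right
  intro x
  rw [← comul_rmul_T1Δ, comul_antipode_rmul, ← comm_rTensor]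
  congr 1
  have e : mulLeft k (Q.antipode b) ∘ₗ Q.antipode.toLinearMap =
      Q.antipode.toLinearMap ∘ₗ mulRight k b := by
    ext c; simp [antipode_mul]
  rw [e, LinearMap.lTensor_comp_apply, lTensor_mulRight_T1Δ_symm, map_eq_lTensor_rTensor]
  have e2 : sliceR Q.counit ∘ₗ appL Q.T1Δ.symm.toLinearMap x =
      mulLeft k x ∘ₗ Q.antipode.toLinearMap := by
    ext c; simp [mul_antipode_eq]
  rw [e2, LinearMap.rTensor_comp_apply, lTensor_rTensor]

theorem TΔ2_antipode (a b : A) : Q.TΔ2 (Q.antipode a ⊗ₜ Q.antipode b) =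
    TensorProduct.comm k A A (TensorProduct.map Q.antipode.toLinearMap Q.antipode.toLinearMap
      (Q.T1Δ (b ⊗ₜ a))) := by
  apply rTensor_mulLeft_cancel Q.nondeg_right
  intro c
  obtain ⟨c, rfl⟩ := Q.antipode.surjective c
  have h := congrArg (fun t => TensorProduct.comm k A A
    (TensorProduct.map Q.antipode.toLinearMap Q.antipode.toLinearMap t)) (Q.T1Δ_TΔ2 b a c)
  rw [← T1Δ_TΔ2, T1Δ_antipode]
  have e1 : ∀ t : A ⊗[k] A, (mulRight k (Q.antipode b)).lTensor A (TensorProduct.comm k A A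
      (TensorProduct.map Q.antipode.toLinearMap Q.antipode.toLinearMap t)) =
      TensorProduct.comm k A A (TensorProduct.map Q.antipode.toLinearMap Q.antipode.toLinearMap
        ((mulLeft k b).rTensor A t)) := by
    intro t
    induction t with
    | zero => simp
    | add s t hs ht => simp only [map_add, hs, ht]
    | tmul p q => simp [antipode_mul]
  have e2 : ∀ t : A ⊗[k] A, (mulLeft k (Q.antipode c)).rTensor A (TensorProduct.comm k A A
      (TensorProduct.map Q.antipode.toLinearMap Q.antipode.toLinearMap t)) =
      TensorProduct.comm k A A (TensorProduct.map Q.antipode.toLinearMap Q.antipode.toLinearMap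
        ((mulRight k c).lTensor A t)) := by
    intro t
    induction t with
    | zero => simp
    | add s t hs ht => simp only [map_add, hs, ht]
    | tmul p q => simp [antipode_mul]
  rw [e1, e2]
  exact h.symm

/-! ### Faithfulness of the invariant functional -/

theorem sliceR_φ_T1Δ (b a : A) : sliceR Q.φ (Q.T1Δ (b ⊗ₜ a)) = Q.φ a • b := by
  apply mul_right_cancel_of_nondeg Q.nondeg_left
  intro c
  have := congrArg (sliceR Q.φ) (Q.T1Δ_TΔ1 b a c)
  rw [sliceR_rTensor, sliceR_rTensor, Q.φ_invariant] at this
  simpa [smul_mul_assoc, mul_smul_comm] using this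

theorem exists_φ_mul_ne_zero : ∃ a b : A, Q.φ (a * b) ≠ 0 := by
  by_contra! H
  apply Q.φ_ne_zero
  ext a
  obtain ⟨t, rfl⟩ := Q.mul'_surjective a
  induction t with
  | zero => simp
  | add s t hs ht => rw [map_add, map_add, hs, ht, map_add]
  | tmul p q => simp [H]

theorem T1Δ_mul_TΔ1 (d x a c : A) : Q.T1Δ (d ⊗ₜ x) * Q.TΔ1 (a ⊗ₜ c) =
    (mulLeft k d).rTensor A (Q.TΔ1 ((x * a) ⊗ₜ c)) := by
  have := Q.nondeg
  rw [← Mult.incl_inj (k := k), Mult.incl_mul', T1Δ_spec, Mult.incl_rTensor_mulLeft, TΔ1_spec,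
    TΔ1_spec, map_mul]
  simp only [mul_assoc]

/-- Let N be the set of all a with φ(xa) = 0 for all x. Invariance and surjectivity of `T1Δ` put the
second leg of Δ(a)(c⊗1) in N when a is in N. Applying φ(p m(S⊗ι)( · )), m the product, which kills
A⊗N, gives ε(a)φ(pS(c)) = 0, so ε vanishes on N. Then ac = (ι⊗ε)(Δ(a)(c⊗1)) = 0. -/
theorem φ_faithful_right (a : A) (h : ∀ x, Q.φ (x * a) = 0) : a = 0 := by
  have key : ∀ a : A, (∀ x, Q.φ (x * a) = 0) → ∀ c v,
      sliceR (Q.φ ∘ₗ mulLeft k v) (Q.TΔ1 (a ⊗ₜ c)) = 0 := by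
    intro a h c v
    apply Q.nondeg_right
    intro u
    rw [← sliceR_tmul_mul]
    generalize (u ⊗ₜ[k] v) = t
    obtain ⟨t, rfl⟩ := Q.T1Δ.surjective t
    induction t with
    | zero => simp
    | add s t hs ht => simp only [map_add, add_mul, hs, ht, add_zero]
    | tmul d x =>
      rw [T1Δ_mul_TΔ1, sliceR_rTensor, Q.φ_invariant, h]
      simp
  have hε : ∀ a : A, (∀ x, Q.φ (x * a) = 0) → Q.counit a = 0 := by
    intro a h
    obtain ⟨p, q, hpq⟩ := Q.exists_φ_mul_ne_zero
    obtain ⟨q, rfl⟩ := Q.antipode.surjective q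
    have := map_eq_zero_of_sliceR (fun v => Q.φ ∘ₗ mulLeft k v)
      (Q.φ ∘ₗ mulLeft k p ∘ₗ LinearMap.mul' k A ∘ₗ Q.antipode.toLinearMap.rTensor A)
      (fun a b hb => by simpa [mul_assoc] using hb (p * Q.antipode a)) _ (key a h q)
    simp only [LinearMap.comp_apply, mul'_antipode_TΔ1, map_smul, LinearMap.mulLeft_apply] at this
    exact (smul_eq_zero.1 this).resolve_right hpq
  apply Q.nondeg_left
  intro c
  rw [← Q.sliceR_counit_TΔ1]
  exact map_eq_zero_of_sliceR (fun v => Q.φ ∘ₗ mulLeft k v) _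
    (fun p q hq => by rw [sliceR_tmul, hε q hq, zero_smul]) _ (key a h c)

theorem φ_faithful_left (a : A) (h : ∀ x, Q.φ (a * x) = 0) : a = 0 := by
  have key : ∀ a : A, (∀ x, Q.φ (a * x) = 0) → ∀ d v,
      sliceR (Q.φ ∘ₗ mulRight k v) (Q.T1Δ (d ⊗ₜ a)) = 0 := by
    intro a h d v
    apply Q.nondeg_left
    intro u
    rw [← sliceR_mul_tmul]
    generalize (u ⊗ₜ[k] v) = t
    obtain ⟨t, rfl⟩ := Q.TΔ1.surjective t
    induction t with
    | zero => simp
    | add s t hs ht => simp only [map_add, mul_add, hs, ht, add_zero]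
    | tmul x c =>
      rw [T1Δ_mul_TΔ1, sliceR_rTensor, Q.φ_invariant, h]
      simp
  have hε : ∀ a : A, (∀ x, Q.φ (a * x) = 0) → Q.counit a = 0 := by
    intro a h
    obtain ⟨p, q, hpq⟩ := Q.exists_φ_mul_ne_zero
    obtain ⟨p, rfl⟩ := Q.antipode.symm.surjective p
    have := map_eq_zero_of_sliceR (fun v => Q.φ ∘ₗ mulRight k v)
      (Q.φ ∘ₗ mulRight k q ∘ₗ Q.antipode.symm.toLinearMap ∘ₗ LinearMap.mul' k A ∘ₗ
        Q.antipode.toLinearMap.lTensor A)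
      (fun a b hb => by
        have e : Q.antipode.symm (a * Q.antipode b) = b * Q.antipode.symm a := by
          apply Q.antipode.injective
          simp [antipode_mul]
        simpa [mul_assoc, e] using hb (Q.antipode.symm a * q)) _ (key a h p)
    simp only [LinearMap.comp_apply, mul'_antipode_T1Δ, map_smul, LinearMap.mulRight_apply,
      LinearEquiv.coe_coe] at this
    exact (smul_eq_zero.1 this).resolve_right hpq
  apply Q.nondeg_right
  intro c
  rw [← Q.sliceR_counit_T1Δ]
  exact map_eq_zero_of_sliceR (fun v => Q.φ ∘ₗ mulRight k v) _
    (fun p q hq => by rw [sliceR_tmul, hε q hq, zero_smul]) _ (key a h c)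

end AlgebraicQuantumGroup

/-! ### Modular automorphisms and invertible multipliers, in general. -/

section Modular

variable {k B : Type*} [Field k] [NonUnitalRing B] [Module k B]

theorem faithful_right_ext {f : B →ₗ[k] k} (hr : ∀ a, (∀ x, f (x * a) = 0) → a = 0) {a b : B}
    (h : ∀ x, f (x * a) = f (x * b)) : a = b := by
  rw [← sub_eq_zero]
  exact hr _ fun x => by rw [mul_sub, map_sub, h, sub_self]

theorem faithful_left_ext {f : B →ₗ[k] k} (hl : ∀ a, (∀ x, f (a * x) = 0) → a = 0) {a b : B}
    (h : ∀ x, f (a * x) = f (b * x)) : a = b := by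
  rw [← sub_eq_zero]
  exact hl _ fun x => by rw [sub_mul, map_sub, h, sub_self]

variable [IsScalarTower k B B] [SMulCommClass k B B]

/-- A faithful functional `f` such that the functionals `f(a ·)` are the functionals `f(· b)` has
a modular automorphism. -/
theorem exists_modular (f : B →ₗ[k] k) (hl : ∀ a, (∀ x, f (a * x) = 0) → a = 0)
    (hr : ∀ a, (∀ x, f (x * a) = 0) → a = 0) (h1 : ∀ a, ∃ b, ∀ x, f (a * x) = f (x * b))
    (h2 : ∀ b, ∃ a, ∀ x, f (a * x) = f (x * b)) :
    ∃ σ : AlgAut k B, ∀ a b, f (a * b) = f (b * σ a) := by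
  choose s hs using h1
  choose s' hs' using h2
  let e : B ≃ₗ[k] B :=
    { toFun := s
      invFun := s'
      map_add' := fun a b => faithful_right_ext hr fun x => by
        rw [← hs, mul_add, map_add, ← hs, ← hs, add_mul, map_add]
      map_smul' := fun c a => faithful_right_ext hr fun x => by
        rw [← hs, RingHom.id_apply, mul_smul_comm, map_smul, ← hs, smul_mul_assoc, map_smul]
      left_inv := fun a => faithful_left_ext hl fun x => by rw [hs', ← hs]
      right_inv := fun a => faithful_right_ext hr fun x => by rw [← hs, hs'] }
  refine ⟨⟨e, fun a b => ?_⟩, fun a b => hs a b⟩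
  change s (a * b) = s a * s b
  refine faithful_right_ext hr fun x => ?_
  rw [← hs, mul_assoc, hs, mul_assoc, hs, ← mul_assoc]

/-- A multiplier whose two multiplication maps are invertible is invertible. -/
def Mult.unitOfBijective (m : Mult k B) (l r : B →ₗ[k] B) (h1 : ∀ a, m.lmul (l a) = a)
    (h2 : ∀ a, l (m.lmul a) = a) (h3 : ∀ a, m.rmul (r a) = a) (h4 : ∀ a, r (m.rmul a) = a) :
    (Mult k B)ˣ where
  val := m
  inv := Mult.mk l r fun a b => by
    conv_lhs => rw [← h3 a, ← central, h1]
  val_inv := by ext a <;> simp [h1, h4]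
  inv_val := by ext a <;> simp [h2, h3]

theorem sliceL_smul {k A B : Type*} [Field k] [AddCommGroup A] [Module k A] [AddCommGroup B]
    [Module k B] (c : k) (f : A →ₗ[k] k) (t : A ⊗[k] B) : sliceL (c • f) t = c • sliceL f t := by
  induction t with
  | zero => simp
  | add s t hs ht => simp only [map_add, smul_add, hs, ht]
  | tmul p q => simp [smul_smul]

theorem sliceR_smul {k A B : Type*} [Field k] [AddCommGroup A] [Module k A] [AddCommGroup B]
    [Module k B] (c : k) (f : B →ₗ[k] k) (t : A ⊗[k] B) : sliceR (c • f) t = c • sliceR f t := by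
  induction t with
  | zero => simp
  | add s t hs ht => simp only [map_add, smul_add, hs, ht]
  | tmul p q => simp [smul_smul]

end Modular

namespace AlgebraicQuantumGroup

variable {k A : Type*} [Field k] [NonUnitalRing A] [Module k A]
  [IsScalarTower k A A] [SMulCommClass k A A] (Q : AlgebraicQuantumGroup k A)

/-! ### The right invariant functional -/

/-- The right invariant functional `ψ = φ ∘ S`. -/
def ψ : A →ₗ[k] k := Q.φ ∘ₗ Q.antipode.toLinearMap

theorem ψ_apply (a : A) : Q.ψ a = Q.φ (Q.antipode a) := rfl

theorem sliceL_comp_antipode_TΔ2 (f : A →ₗ[k] k)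
    (hf : ∀ b a, sliceR f (Q.T1Δ (b ⊗ₜ a)) = f a • b) (a b : A) :
    sliceL (f ∘ₗ Q.antipode.toLinearMap) (Q.TΔ2 (a ⊗ₜ b)) = f (Q.antipode a) • b := by
  have h := congrArg (sliceR f) (Q.T1Δ_antipode b a)
  rw [hf, sliceR_comm, map_eq_lTensor_rTensor, sliceL_lTensor, sliceL_rTensor] at h
  apply Q.antipode.injective
  rw [map_smul]
  exact h.symm

theorem sliceR_φ_T1Δ' (t : A ⊗[k] A) : sliceR Q.φ (Q.T1Δ t) = sliceR Q.φ t := by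
  induction t with
  | zero => simp
  | add s t hs ht => simp only [map_add, hs, ht]
  | tmul p q => rw [sliceR_φ_T1Δ, sliceR_tmul]

theorem sliceL_ψ_TΔ2 (a b : A) : sliceL Q.ψ (Q.TΔ2 (a ⊗ₜ b)) = Q.ψ a • b :=
  Q.sliceL_comp_antipode_TΔ2 Q.φ Q.sliceR_φ_T1Δ a b

theorem sliceL_ψ_TΔ2' (t : A ⊗[k] A) : sliceL Q.ψ (Q.TΔ2 t) = sliceL Q.ψ t := by
  induction t with
  | zero => simp
  | add s t hs ht => simp only [map_add, hs, ht]
  | tmul p q => rw [sliceL_ψ_TΔ2, sliceL_tmul]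

/-- Strong left invariance: T2Δ = T1Δ(S⊗ι)TΔ2, and ι⊗φ absorbs `T1Δ`. Its counterpart for ψ is
`sliceL_ψ_TΔ1`. -/
theorem sliceR_φ_T2Δ (t : A ⊗[k] A) :
    sliceR Q.φ (Q.T2Δ t) = Q.antipode (sliceR Q.φ (Q.TΔ2 t)) := by
  rw [T2Δ_eq, sliceR_φ_T1Δ', sliceR_rTensor, LinearEquiv.coe_coe]

theorem sliceL_ψ_TΔ1 (t : A ⊗[k] A) :
    sliceL Q.ψ (Q.TΔ1 t) = Q.antipode (sliceL Q.ψ (Q.T1Δ t)) := by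
  rw [TΔ1_eq, sliceL_ψ_TΔ2', sliceL_lTensor, LinearEquiv.coe_coe]

theorem ψ_faithful_right (a : A) (h : ∀ x, Q.ψ (x * a) = 0) : a = 0 := by
  apply Q.antipode.injective
  rw [map_zero]
  apply Q.φ_faithful_left
  intro x
  obtain ⟨x, rfl⟩ := Q.antipode.surjective x
  rw [← antipode_mul]
  exact h x

theorem ψ_faithful_left (a : A) (h : ∀ x, Q.ψ (a * x) = 0) : a = 0 := by
  apply Q.antipode.injective
  rw [map_zero]
  apply Q.φ_faithful_right
  intro x
  obtain ⟨x, rfl⟩ := Q.antipode.surjective x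
  rw [← antipode_mul]
  exact h x

theorem ψ_ne_zero : Q.ψ ≠ 0 := by
  intro h
  apply Q.φ_ne_zero
  ext a
  obtain ⟨a, rfl⟩ := Q.antipode.surjective a
  exact LinearMap.congr_fun h a

/-! ### Uniqueness of the invariant functional, and the modular element -/

/-- Slice by φ instead: strong invariance gives (ι⊗φ)((1⊗b)Δ(a)) = S((ι⊗φ)(Δ(b)(1⊗a))), and f∘S is
right invariant. -/
theorem φ_sliceL_T2Δ (f : A →ₗ[k] k) (hf : ∀ b a, sliceR f (Q.T1Δ (b ⊗ₜ a)) = f a • b) (b a : A) :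
    Q.φ (sliceL f (Q.T2Δ (b ⊗ₜ a))) = f (Q.antipode b) * Q.φ a := by
  rw [← slice_slice, sliceR_φ_T2Δ]
  change (f ∘ₗ Q.antipode.toLinearMap) _ = _
  rw [slice_slice, sliceL_comp_antipode_TΔ2 _ _ hf, map_smul, smul_eq_mul]

/-- By the previous lemma and faithfulness of φ, (f⊗ι)Δ(a) is φ(a) times a fixed multiplier.
Applying ε shows that f is a multiple of φ; for f = φ the fixed multiplier is the modular element.
-/
theorem sliceL_T2Δ_unique (f : A →ₗ[k] k) (hf : ∀ b a, sliceR f (Q.T1Δ (b ⊗ₜ a)) = f a • b) {e : A}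
    (he : Q.φ e = 1) (b a : A) :
    sliceL f (Q.T2Δ (b ⊗ₜ a)) = Q.φ a • sliceL f (Q.T2Δ (b ⊗ₜ e)) := by
  apply faithful_right_ext Q.φ_faithful_right
  intro c
  have h : ∀ a, c * sliceL f (Q.T2Δ (b ⊗ₜ a)) = sliceL f (Q.T2Δ ((c * b) ⊗ₜ a)) := by
    intro a
    rw [T2Δ_mul_left, sliceL_lTensor, LinearMap.mulLeft_apply]
  rw [mul_smul_comm, h, h, map_smul, φ_sliceL_T2Δ _ _ hf, φ_sliceL_T2Δ _ _ hf, he, smul_eq_mul]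
  ring

theorem sliceR_counit_T2Δ (a b : A) : sliceR Q.counit (Q.T2Δ (a ⊗ₜ b)) = Q.counit a • b := by
  apply mul_right_cancel_of_nondeg Q.nondeg_left
  intro c
  have := congrArg (sliceR Q.counit) (Q.T2Δ_TΔ1 a b c)
  have e : Q.counit ∘ₗ mulLeft k a = Q.counit a • Q.counit := by
    ext x; simp [counit_mul]
  rw [sliceR_rTensor, sliceR_lTensor, e, sliceR_smul, sliceR_counit_TΔ1] at this
  simpa [smul_mul_assoc] using this

theorem invariant_unique (f : A →ₗ[k] k) (hf : ∀ b a, sliceR f (Q.T1Δ (b ⊗ₜ a)) = f a • b) :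
    ∃ c : k, ∀ a, f a = c * Q.φ a := by
  obtain ⟨e, he⟩ := exists_eq_one_of_ne_zero Q.φ_ne_zero
  obtain ⟨u, hu⟩ := Q.exists_counit_eq_one
  refine ⟨f e, fun a => ?_⟩
  have h := congrArg Q.counit (Q.sliceL_T2Δ_unique f hf he u a)
  rw [map_smul, ← slice_slice, ← slice_slice, sliceR_counit_T2Δ, sliceR_counit_T2Δ, hu, one_smul,
    one_smul, smul_eq_mul] at h
  rw [h, mul_comm]

theorem T1Δ_antipode_antipode (b a : A) :
    Q.T1Δ (Q.antipode (Q.antipode b) ⊗ₜ Q.antipode (Q.antipode a)) =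
      TensorProduct.map (Q.antipode.toLinearMap ∘ₗ Q.antipode.toLinearMap)
        (Q.antipode.toLinearMap ∘ₗ Q.antipode.toLinearMap) (Q.T1Δ (b ⊗ₜ a)) := by
  rw [T1Δ_antipode, TΔ2_antipode]
  generalize Q.T1Δ (b ⊗ₜ a) = t
  induction t with
  | zero => simp
  | add s t hs ht => simp only [map_add, hs, ht]
  | tmul p q => simp

theorem exists_scaling : ∃ c : k, ∀ a, Q.φ (Q.antipode (Q.antipode a)) = c * Q.φ a := by
  apply Q.invariant_unique (Q.φ ∘ₗ Q.antipode.toLinearMap ∘ₗ Q.antipode.toLinearMap)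
  intro b a
  apply Q.antipode.injective
  apply Q.antipode.injective
  have h := congrArg (sliceR Q.φ) (Q.T1Δ_antipode_antipode b a)
  rw [sliceR_φ_T1Δ, map_eq_lTensor_rTensor, sliceR_lTensor, sliceR_rTensor] at h
  simp only [map_smul]
  exact h.symm

/-- The scaling constant. -/
def scaling : k := Classical.choose Q.exists_scaling

theorem φ_antipode_antipode (a : A) : Q.φ (Q.antipode (Q.antipode a)) = Q.scaling * Q.φ a :=
  Classical.choose_spec Q.exists_scaling a

theorem scaling_ne_zero : Q.scaling ≠ 0 := by
  intro h
  apply Q.φ_ne_zero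
  ext a
  obtain ⟨a, rfl⟩ := Q.antipode.surjective a
  obtain ⟨a, rfl⟩ := Q.antipode.surjective a
  rw [φ_antipode_antipode, h]
  simp

theorem exists_modularElement : ∃ δ : Mult k A,
    (∀ a b : A, sliceL Q.φ (Q.TΔ2 (a ⊗ₜ b)) = Q.φ a • δ.lmul b) ∧
    (∀ a b : A, sliceL Q.φ (Q.T2Δ (b ⊗ₜ a)) = Q.φ a • δ.rmul b) := by
  obtain ⟨e, he⟩ := exists_eq_one_of_ne_zero Q.φ_ne_zero
  have hc : ∀ a b c : A, b * sliceL Q.φ (Q.TΔ2 (a ⊗ₜ c)) = sliceL Q.φ (Q.T2Δ (b ⊗ₜ a)) * c := by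
    intro a b c
    have := congrArg (sliceL Q.φ) (Q.T2Δ_TΔ2 b a c)
    rw [sliceL_lTensor, sliceL_lTensor] at this
    exact this.symm
  refine ⟨Mult.mk (sliceL Q.φ ∘ₗ appL Q.TΔ2.toLinearMap e) (sliceL Q.φ ∘ₗ appR Q.T2Δ.toLinearMap e)
    (fun a b => hc e a b), fun a b => ?_, fun a b => ?_⟩
  · apply mul_left_cancel_of_nondeg Q.nondeg_right
    intro c
    rw [hc, Q.sliceL_T2Δ_unique _ Q.sliceR_φ_T1Δ he, mul_smul_comm, smul_mul_assoc]
    congr 1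
    exact (hc e c b).symm
  · exact Q.sliceL_T2Δ_unique _ Q.sliceR_φ_T1Δ he b a

/-- The modular element, as a multiplier. -/
def modularElement : Mult k A := Classical.choose Q.exists_modularElement

theorem sliceL_φ_TΔ2 (a b : A) :
    sliceL Q.φ (Q.TΔ2 (a ⊗ₜ b)) = Q.φ a • Q.modularElement.lmul b :=
  (Classical.choose_spec Q.exists_modularElement).1 a b

theorem sliceL_φ_T2Δ (a b : A) :
    sliceL Q.φ (Q.T2Δ (b ⊗ₜ a)) = Q.φ a • Q.modularElement.rmul b :=
  (Classical.choose_spec Q.exists_modularElement).2 a b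

theorem φ_modularElement_rmul (b : A) : Q.φ (Q.modularElement.rmul b) = Q.ψ b := by
  obtain ⟨e, he⟩ := exists_eq_one_of_ne_zero Q.φ_ne_zero
  have h := Q.φ_sliceL_T2Δ Q.φ Q.sliceR_φ_T1Δ b e
  rwa [sliceL_φ_T2Δ, he, one_smul, mul_one] at h

theorem counit_modularElement_rmul (b : A) : Q.counit (Q.modularElement.rmul b) = Q.counit b := by
  obtain ⟨e, he⟩ := exists_eq_one_of_ne_zero Q.φ_ne_zero
  have h := congrArg Q.counit (Q.sliceL_φ_T2Δ e b)
  rwa [← slice_slice, sliceR_counit_T2Δ, map_smul, he, one_smul, smul_eq_mul, mul_one, eq_comm] at h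

theorem counit_modularElement_lmul (b : A) : Q.counit (Q.modularElement.lmul b) = Q.counit b := by
  obtain ⟨e, he⟩ := Q.exists_counit_eq_one
  have h := congrArg Q.counit (Q.modularElement.central e b)
  rwa [counit_mul, counit_mul, counit_modularElement_rmul, he, one_mul, one_mul] at h

theorem sliceR_ψ_T1Δ (b a : A) : sliceR Q.ψ (Q.T1Δ (b ⊗ₜ a)) =
    Q.ψ a • Q.antipode.symm (Q.modularElement.lmul (Q.antipode b)) := by
  have h := congrArg (sliceL Q.φ) (Q.TΔ2_antipode a b)
  rw [sliceL_φ_TΔ2, sliceL_comm, map_eq_lTensor_rTensor, sliceR_lTensor, sliceR_rTensor] at h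
  apply Q.antipode.injective
  rw [map_smul, LinearEquiv.apply_symm_apply]
  exact h.symm

/-- Evaluate (ψ⊗φ)(Δ(x)(y⊗1)) twice. Left invariance gives φ(x)ψ(y); strong invariance of ψ turns it
into (ψ⊗ψ)((x⊗1)Δ(y)), which is ψ(y)φ(δS(x)). -/
theorem φ_modularElement_lmul (x : A) :
    Q.φ (Q.modularElement.lmul x) = Q.φ (Q.antipode.symm x) := by
  obtain ⟨y, hy⟩ := exists_eq_one_of_ne_zero Q.ψ_ne_zero
  obtain ⟨x, rfl⟩ := Q.antipode.surjective x
  have h : Q.ψ (sliceR Q.φ (Q.TΔ1 (x ⊗ₜ y))) = Q.ψ (sliceR Q.ψ (Q.T1Δ (x ⊗ₜ y))) := by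
    rw [slice_slice, slice_slice, sliceL_ψ_TΔ1]
    rfl
  rw [Q.φ_invariant, sliceR_ψ_T1Δ, map_smul, map_smul, hy, one_smul, smul_eq_mul, mul_one] at h
  rw [LinearEquiv.symm_apply_apply, h, ψ_apply, LinearEquiv.apply_symm_apply]

/-- The modular element, as an invertible multiplier. -/
def δu : (Mult k A)ˣ :=
  have := Q.nondeg
  -- The map x ↦ S⁻¹(δS(x)) commutes with left multiplications. It inverts x ↦ xδ because φ(xδ) =
  -- φ(S(x)) and φ(δx) = φ(S⁻¹(x)).
  have hR : ∀ y x, Q.antipode.symm (Q.modularElement.lmul (Q.antipode (y * x))) =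
      y * Q.antipode.symm (Q.modularElement.lmul (Q.antipode x)) := by
    intro y x
    apply Q.antipode.injective
    rw [antipode_mul, antipode_mul, Mult.lmul_mul', LinearEquiv.apply_symm_apply,
      LinearEquiv.apply_symm_apply]
  have h3 : ∀ x, Q.modularElement.rmul
      (Q.antipode.symm (Q.modularElement.lmul (Q.antipode x))) = x := by
    intro x
    apply faithful_right_ext Q.φ_faithful_right
    intro y
    rw [← Mult.rmul_mul', ← hR, φ_modularElement_rmul, ψ_apply, LinearEquiv.apply_symm_apply,
      φ_modularElement_lmul, LinearEquiv.symm_apply_apply]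
  have h4 : ∀ x, Q.antipode.symm (Q.modularElement.lmul
      (Q.antipode (Q.modularElement.rmul x))) = x := by
    intro x
    apply faithful_right_ext Q.ψ_faithful_right
    intro y
    rw [← hR, ψ_apply, LinearEquiv.apply_symm_apply, φ_modularElement_lmul,
      LinearEquiv.symm_apply_apply, ← φ_modularElement_rmul, Mult.rmul_mul']
  Mult.unitOfBijective Q.modularElement
    (Q.antipode.toLinearMap ∘ₗ Q.modularElement.rmul ∘ₗ Q.antipode.symm.toLinearMap)
    (Q.antipode.symm.toLinearMap ∘ₗ Q.modularElement.lmul ∘ₗ Q.antipode.toLinearMap)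
    (fun a => by
      obtain ⟨a, rfl⟩ := Q.antipode.surjective a
      simpa using congrArg Q.antipode (h4 a))
    (fun a => by
      obtain ⟨a, rfl⟩ := Q.antipode.surjective a
      simpa using congrArg Q.antipode (h3 a))
    (fun a => by simpa using h3 a)
    (fun a => by simpa using h4 a)

/-! ### The modular automorphisms -/

/-- For t = b⊗a both sides equal φ((ψ⊗ι)((a⊗1)Δ(x))b). The slices run through all of A, so the
functionals ψ(d ·) are exactly the functionals φ(· c). -/
theorem ψ_mul_eq_φ_mul (t : A ⊗[k] A) (x : A) :
    Q.ψ (sliceR (Q.φ ∘ₗ Q.antipode.symm.toLinearMap)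
        (Q.T2Δ (Q.antipode.toLinearMap.rTensor A t)) * x) =
      Q.φ (x * sliceL Q.φ (Q.TΔ1 (Q.antipode.toLinearMap.lTensor A t))) := by
  induction t with
  | zero => simp
  | add s t hs ht => simp only [map_add, add_mul, mul_add, hs, ht]
  | tmul b a =>
    simp only [LinearMap.rTensor_tmul, LinearMap.lTensor_tmul, LinearEquiv.coe_coe]
    trans Q.φ (sliceL Q.ψ (Q.T1Δ (a ⊗ₜ x)) * b)
    · have h1 : sliceL Q.ψ (Q.T1Δ (a ⊗ₜ x)) = Q.antipode.symm (sliceL Q.ψ (Q.TΔ1 (a ⊗ₜ x))) := by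
        rw [sliceL_ψ_TΔ1, LinearEquiv.symm_apply_apply]
      have h2 : ∀ y, Q.antipode.symm y * b = Q.antipode.symm (Q.antipode b * y) := by
        intro y
        apply Q.antipode.injective
        simp [antipode_mul]
      have h3 := congrArg (sliceL Q.ψ) (Q.T2Δ_TΔ1 (Q.antipode b) a x)
      rw [sliceL_lTensor, LinearMap.mulLeft_apply] at h3
      rw [h1, h2, ← h3]
      change _ = (Q.φ ∘ₗ Q.antipode.symm.toLinearMap) _
      rw [← slice_slice, sliceR_rTensor, LinearMap.mulRight_apply]
    · have h1 := congrArg (sliceL Q.ψ) (Q.T1Δ_TΔ2 a x b)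
      rw [sliceL_lTensor, LinearMap.mulRight_apply] at h1
      have h2 := congrArg (sliceR Q.φ) (Q.T2Δ_TΔ1 x b (Q.antipode a))
      rw [sliceR_rTensor, LinearMap.mulRight_apply, sliceR_φ_T2Δ, ← antipode_mul] at h2
      rw [h1, ← slice_slice, sliceR_rTensor, LinearMap.mulLeft_apply, ψ_apply, h2, slice_slice,
        sliceL_lTensor, LinearMap.mulLeft_apply]

theorem sliceR_surjective {M N : Type*} [AddCommGroup M] [Module k M] [AddCommGroup N] [Module k N]
    {f : N →ₗ[k] k} (hf : f ≠ 0) : Function.Surjective (sliceR f : M ⊗[k] N →ₗ[k] M) := by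
  obtain ⟨e, he⟩ := exists_eq_one_of_ne_zero hf
  exact fun m => ⟨m ⊗ₜ e, by simp [he]⟩

theorem sliceL_surjective {M N : Type*} [AddCommGroup M] [Module k M] [AddCommGroup N] [Module k N]
    {f : M →ₗ[k] k} (hf : f ≠ 0) : Function.Surjective (sliceL f : M ⊗[k] N →ₗ[k] N) := by
  obtain ⟨e, he⟩ := exists_eq_one_of_ne_zero hf
  exact fun m => ⟨e ⊗ₜ m, by simp [he]⟩

theorem φ_mul_δu_rmul (x c : A) : Q.φ (x * (Q.δu : Mult k A).rmul c) = Q.ψ (x * c) := by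
  have := Q.nondeg
  rw [← φ_modularElement_rmul, Mult.rmul_mul']
  rfl

theorem exists_σ' : ∃ σ' : AlgAut k A, ∀ a b, Q.ψ (a * b) = Q.ψ (b * σ' a) := by
  apply exists_modular _ Q.ψ_faithful_left Q.ψ_faithful_right
  · intro d
    obtain ⟨w, rfl⟩ := sliceR_surjective (f := Q.φ ∘ₗ Q.antipode.symm.toLinearMap) (M := A)
      (fun h => Q.φ_ne_zero (by
        ext a
        obtain ⟨a, rfl⟩ := Q.antipode.symm.surjective a
        exact LinearMap.congr_fun h a)) d
    obtain ⟨w, rfl⟩ := Q.T2Δ.surjective w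
    obtain ⟨w, rfl⟩ := (Q.antipode.rTensor A).surjective w
    -- Here φ(· c) = ψ(· cδ⁻¹), because φ(xδ) = ψ(x).
    refine ⟨((Q.δu⁻¹ : (Mult k A)ˣ) : Mult k A).rmul
      (sliceL Q.φ (Q.TΔ1 (Q.antipode.toLinearMap.lTensor A w))), fun x => ?_⟩
    rw [← Q.φ_mul_δu_rmul x, ← Mult.rmul_mul, Units.inv_mul, Mult.rmul_one]
    exact Q.ψ_mul_eq_φ_mul w x
  · intro c
    obtain ⟨w, hw⟩ := sliceL_surjective (N := A) Q.φ_ne_zero ((Q.δu : Mult k A).rmul c)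
    obtain ⟨w, rfl⟩ := Q.TΔ1.surjective w
    obtain ⟨w, rfl⟩ := (Q.antipode.lTensor A).surjective w
    refine ⟨sliceR (Q.φ ∘ₗ Q.antipode.symm.toLinearMap)
      (Q.T2Δ (Q.antipode.toLinearMap.rTensor A w)), fun x => ?_⟩
    rw [← Q.φ_mul_δu_rmul x, ← hw]
    exact Q.ψ_mul_eq_φ_mul w x

/-- The modular automorphism of `ψ`. -/
def σ' : AlgAut k A := Classical.choose Q.exists_σ'

theorem ψ_mul (a b : A) : Q.ψ (a * b) = Q.ψ (b * Q.σ' a) := Classical.choose_spec Q.exists_σ' a b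

/-- The antipode reverses products and carries ψ to φ, so it transports the modular property of σ'
to φ. -/
theorem φ_mul_comm (d x : A) : Q.φ (Q.antipode (Q.σ' d) * x) = Q.φ (x * Q.antipode d) := by
  obtain ⟨x, rfl⟩ := Q.antipode.surjective x
  rw [← antipode_mul, ← antipode_mul]
  exact (Q.ψ_mul d x).symm

theorem exists_σ : ∃ σ : AlgAut k A, ∀ a b, Q.φ (a * b) = Q.φ (b * σ a) := by
  apply exists_modular _ Q.φ_faithful_left Q.φ_faithful_right
  · intro a
    obtain ⟨a, rfl⟩ := Q.antipode.surjective a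
    obtain ⟨d, rfl⟩ := Q.σ'.toLinearEquiv.surjective a
    exact ⟨Q.antipode d, Q.φ_mul_comm d⟩
  · intro b
    obtain ⟨d, rfl⟩ := Q.antipode.surjective b
    exact ⟨_, Q.φ_mul_comm d⟩

/-- The modular automorphism of `φ`. -/
def σ : AlgAut k A := Classical.choose Q.exists_σ

theorem φ_mul (a b : A) : Q.φ (a * b) = Q.φ (b * Q.σ a) := Classical.choose_spec Q.exists_σ a b

theorem σ_antipode_σ' (a : A) : Q.σ (Q.antipode (Q.σ' a)) = Q.antipode a := by
  apply faithful_right_ext Q.φ_faithful_right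
  intro x
  rw [← φ_mul, φ_mul_comm]

end AlgebraicQuantumGroup

/-- Composition of automorphisms, first `s` and then `t`. -/
def AlgAut.trans {k A : Type*} [Field k] [NonUnitalNonAssocRing A] [Module k A]
    (s t : AlgAut k A) : AlgAut k A where
  toLinearEquiv := s.toLinearEquiv ≪≫ₗ t.toLinearEquiv
  map_mul' a b := by
    change t.toLinearEquiv (s.toLinearEquiv (a * b)) = t.toLinearEquiv (s.toLinearEquiv a) *
      t.toLinearEquiv (s.toLinearEquiv b)
    rw [s.map_mul, t.map_mul]

@[simp] theorem AlgAut.trans_apply {k A : Type*} [Field k] [NonUnitalNonAssocRing A] [Module k A]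
    (s t : AlgAut k A) (a : A) :
    (s.trans t).toLinearEquiv a = t.toLinearEquiv (s.toLinearEquiv a) := rfl

@[simp] theorem AlgAut.symm_toLinearEquiv {k A : Type*} [Field k] [NonUnitalNonAssocRing A]
    [Module k A] (s : AlgAut k A) : s.symm.toLinearEquiv = s.toLinearEquiv.symm := rfl

theorem AlgAut.symm_map_mul {k A : Type*} [Field k] [NonUnitalNonAssocRing A] [Module k A]
    (s : AlgAut k A) (a b : A) : s.toLinearEquiv.symm (a * b) =
      s.toLinearEquiv.symm a * s.toLinearEquiv.symm b := s.symm.map_mul a b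

namespace Mult

variable {k B : Type*} [Field k] [NonUnitalRing B] [Module k B] [IsScalarTower k B B]
  [SMulCommClass k B B]

@[simp] theorem inv_lmul_lmul (u : (Mult k B)ˣ) (b : B) :
    ((u⁻¹ : (Mult k B)ˣ) : Mult k B).lmul ((u : Mult k B).lmul b) = b := by
  rw [← lmul_mul, Units.inv_mul, lmul_one]

@[simp] theorem rmul_inv_rmul (u : (Mult k B)ˣ) (b : B) :
    (u : Mult k B).rmul (((u⁻¹ : (Mult k B)ˣ) : Mult k B).rmul b) = b := by
  rw [← rmul_mul, Units.inv_mul, rmul_one]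

@[simp] theorem inv_rmul_rmul (u : (Mult k B)ˣ) (b : B) :
    ((u⁻¹ : (Mult k B)ˣ) : Mult k B).rmul ((u : Mult k B).rmul b) = b := by
  rw [← rmul_mul, Units.mul_inv, rmul_one]

end Mult

namespace AlgebraicQuantumGroup

variable {k A : Type*} [Field k] [NonUnitalRing A] [Module k A]
  [IsScalarTower k A A] [SMulCommClass k A A] (Q : AlgebraicQuantumGroup k A)

/-- The square of the antipode. -/
def antipodeSq : AlgAut k A where
  toLinearEquiv := Q.antipode ≪≫ₗ Q.antipode
  map_mul' a b := by
    change Q.antipode (Q.antipode (a * b)) = Q.antipode (Q.antipode a) * Q.antipode (Q.antipode b)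
    rw [antipode_mul, antipode_mul]

theorem antipodeSq_apply (a : A) : Q.antipodeSq a = Q.antipode (Q.antipode a) := rfl

theorem φ_antipodeSq (a : A) : Q.φ (Q.antipodeSq a) = Q.scaling * Q.φ a := Q.φ_antipode_antipode a

theorem ext_of_mul (Q : AlgebraicQuantumGroup k A) {f g : A →ₗ[k] k} (h : ∀ a b, f (a * b) = g (a * b)) (x : A) : f x = g x := by
  obtain ⟨t, rfl⟩ := Q.mul'_surjective x
  induction t with
  | zero => simp
  | add s t hs ht => simp only [map_add, hs, ht]
  | tmul p q => exact h p q

theorem φ_σ (a : A) : Q.φ (Q.σ a) = Q.φ a := by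
  refine Q.ext_of_mul (f := Q.φ ∘ₗ Q.σ.toLinearEquiv.toLinearMap) (fun a b => ?_) a
  simp only [LinearMap.comp_apply, LinearEquiv.coe_coe]
  rw [AlgAut.map_mul, ← φ_mul, ← φ_mul]

theorem σ_antipodeSq (a : A) : Q.σ (Q.antipodeSq a) = Q.antipodeSq (Q.σ a) := by
  apply faithful_right_ext Q.φ_faithful_right
  intro x
  obtain ⟨x, rfl⟩ := Q.antipodeSq.toLinearEquiv.surjective x
  rw [← φ_mul, ← AlgAut.map_mul, ← AlgAut.map_mul, φ_antipodeSq, φ_antipodeSq, φ_mul]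

theorem ψ_antipodeSq (a : A) : Q.ψ (Q.antipodeSq a) = Q.scaling * Q.ψ a :=
  Q.φ_antipode_antipode (Q.antipode a)

theorem σ'_antipodeSq (a : A) : Q.σ' (Q.antipodeSq a) = Q.antipodeSq (Q.σ' a) := by
  apply faithful_right_ext Q.ψ_faithful_right
  intro x
  obtain ⟨x, rfl⟩ := Q.antipodeSq.toLinearEquiv.surjective x
  rw [← ψ_mul, ← AlgAut.map_mul, ← AlgAut.map_mul, ψ_antipodeSq, ψ_antipodeSq, ψ_mul]

/-! ### The modular element and the automorphisms -/

theorem coe_δu : (Q.δu : Mult k A) = Q.modularElement := rfl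

theorem δu_inv_lmul_antipode (a : A) : ((Q.δu⁻¹ : (Mult k A)ˣ) : Mult k A).lmul (Q.antipode a) =
    Q.antipode ((Q.δu : Mult k A).rmul a) := by
  change Q.antipode ((Q.δu : Mult k A).rmul (Q.antipode.symm (Q.antipode a))) = _
  rw [LinearEquiv.symm_apply_apply]

theorem φ_δu_rmul (a : A) : Q.φ ((Q.δu : Mult k A).rmul a) = Q.ψ a := Q.φ_modularElement_rmul a

theorem antipodeSq_δu_rmul (x : A) :
    Q.antipodeSq ((Q.δu : Mult k A).rmul x) = (Q.δu : Mult k A).rmul (Q.antipodeSq x) := by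
  have := Q.nondeg
  apply faithful_right_ext Q.φ_faithful_right
  intro y
  obtain ⟨y, rfl⟩ := Q.antipodeSq.toLinearEquiv.surjective y
  rw [← AlgAut.map_mul, φ_antipodeSq, φ_mul_δu_rmul, φ_mul_δu_rmul, ← AlgAut.map_mul, ψ_apply,
    ψ_apply, ← φ_antipodeSq]
  rfl

theorem δu_rmul_antipode_δu_lmul (a : A) :
    (Q.δu : Mult k A).rmul (Q.antipode ((Q.δu : Mult k A).lmul a)) = Q.antipode a := by
  obtain ⟨b, hb⟩ := Q.antipode.surjective ((Q.δu : Mult k A).lmul a)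
  have h := Q.δu_inv_lmul_antipode b
  rw [hb, Mult.inv_lmul_lmul] at h
  rw [← hb, h, ← antipodeSq_apply, ← antipodeSq_apply, antipodeSq_δu_rmul]

/-- The functionals φ(δ ·) = φ∘S⁻¹ and φ(· δ) = φ∘S differ by φ∘S² = τφ. -/
theorem σ_δu_rmul (x : A) :
    Q.σ ((Q.δu : Mult k A).rmul x) = Q.scaling⁻¹ • (Q.δu : Mult k A).rmul (Q.σ x) := by
  have := Q.nondeg
  apply faithful_right_ext Q.φ_faithful_right
  intro y
  have h := Q.φ_antipode_antipode (Q.antipode.symm (y * Q.σ x))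
  rw [LinearEquiv.apply_symm_apply] at h
  rw [← φ_mul, ← Mult.central, φ_mul, ← Mult.lmul_mul', mul_smul_comm, map_smul, φ_mul_δu_rmul,
    ψ_apply, h, coe_δu, φ_modularElement_lmul, smul_eq_mul, inv_mul_cancel_left₀ Q.scaling_ne_zero]

theorem σ_δu_lmul (x : A) :
    Q.σ ((Q.δu : Mult k A).lmul x) = Q.scaling⁻¹ • (Q.δu : Mult k A).lmul (Q.σ x) := by
  apply mul_left_cancel_of_nondeg Q.nondeg_right
  intro y
  obtain ⟨y, rfl⟩ := Q.σ.toLinearEquiv.surjective y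
  rw [← AlgAut.map_mul, Mult.central, AlgAut.map_mul, σ_δu_rmul, mul_smul_comm, Mult.central,
    smul_mul_assoc]

theorem δu_rmul_σ' (a : A) :
    (Q.δu : Mult k A).rmul (Q.σ' a) = (Q.δu : Mult k A).lmul (Q.σ a) := by
  have := Q.nondeg
  apply faithful_right_ext Q.φ_faithful_right
  intro b
  rw [φ_mul_δu_rmul, ← ψ_mul, ← φ_mul_δu_rmul, φ_mul, Mult.central]

theorem σ'_σ (a : A) : Q.σ' (Q.σ a) = Q.σ (Q.σ' a) := by
  have h := congrArg Q.σ.toLinearEquiv (Q.δu_rmul_σ' a)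
  rw [σ_δu_rmul, σ_δu_lmul, ← δu_rmul_σ'] at h
  have h' := smul_right_injective A (inv_ne_zero Q.scaling_ne_zero) h
  simpa using (congrArg ((Q.δu⁻¹ : (Mult k A)ˣ) : Mult k A).rmul h').symm

theorem σ_symm_δu_rmul (x : A) : Q.σ.toLinearEquiv.symm ((Q.δu : Mult k A).rmul x) =
    Q.scaling • (Q.δu : Mult k A).rmul (Q.σ.toLinearEquiv.symm x) := by
  rw [LinearEquiv.symm_apply_eq, map_smul, σ_δu_rmul, smul_smul,
    mul_inv_cancel₀ Q.scaling_ne_zero, one_smul, LinearEquiv.apply_symm_apply]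

theorem σ_symm_δu_lmul (x : A) : Q.σ.toLinearEquiv.symm ((Q.δu : Mult k A).lmul x) =
    Q.scaling • (Q.δu : Mult k A).lmul (Q.σ.toLinearEquiv.symm x) := by
  rw [LinearEquiv.symm_apply_eq, map_smul, σ_δu_lmul, smul_smul,
    mul_inv_cancel₀ Q.scaling_ne_zero, one_smul, LinearEquiv.apply_symm_apply]

theorem φ_δu_lmul (x : A) : Q.φ ((Q.δu : Mult k A).lmul x) =
    Q.scaling⁻¹ * Q.φ ((Q.δu : Mult k A).rmul x) := by
  have h := Q.φ_antipode_antipode (Q.antipode.symm x)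
  rw [LinearEquiv.apply_symm_apply] at h
  rw [φ_δu_rmul, ψ_apply, h, coe_δu, φ_modularElement_lmul,
    inv_mul_cancel_left₀ Q.scaling_ne_zero]

/-- Here σ'(a) = δσ(a)δ⁻¹, φ is σ-invariant, and φ(δxδ⁻¹) = τ⁻¹φ(x). -/
theorem φ_σ' (a : A) : Q.φ (Q.σ' a) = Q.scaling⁻¹ * Q.φ a := by
  have := Q.nondeg
  have h := congrArg ((Q.δu⁻¹ : (Mult k A)ˣ) : Mult k A).rmul (Q.δu_rmul_σ' a)
  rw [Mult.inv_rmul_rmul, Mult.rmul_lmul_comm] at h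
  rw [h, φ_δu_lmul, Mult.rmul_inv_rmul, φ_σ]

/-! ### The distinguished character -/

/-- The character `ε ∘ σ⁻¹`; it is the modular element of the dual. -/
def χ : A →ₗ[k] k := Q.counit ∘ₗ Q.σ.toLinearEquiv.symm.toLinearMap

theorem χ_apply (a : A) : Q.χ a = Q.counit (Q.σ.toLinearEquiv.symm a) := rfl

theorem χ_mul (a b : A) : Q.χ (a * b) = Q.χ a * Q.χ b := by
  rw [χ_apply, AlgAut.symm_map_mul, counit_mul]
  rfl

theorem χ_δu_rmul (a : A) : Q.χ ((Q.δu : Mult k A).rmul a) = Q.scaling * Q.χ a := by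
  rw [χ_apply, σ_symm_δu_rmul, map_smul, coe_δu, counit_modularElement_rmul]
  rfl

/-- Apply χ to σ'(a)δ = δσ(a); each δ contributes a factor τ. So χ is also ε∘σ'⁻¹, which makes it
computable on both legs of Δ. -/
theorem χ_σ' (a : A) : Q.χ (Q.σ' a) = Q.counit a := by
  apply mul_left_cancel₀ Q.scaling_ne_zero
  rw [← χ_δu_rmul, δu_rmul_σ', χ_apply, σ_symm_δu_lmul, map_smul, coe_δu,
    counit_modularElement_lmul, LinearEquiv.symm_apply_apply, smul_eq_mul]

theorem χ_antipode (a : A) : Q.χ (Q.antipode a) = Q.counit (Q.σ' a) := by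
  rw [← σ_antipode_σ', χ_apply, LinearEquiv.symm_apply_apply, counit_antipode]

theorem counit_σ (a : A) : Q.counit (Q.σ a) = Q.counit (Q.σ' a) := by
  have h := congrArg Q.counit (Q.δu_rmul_σ' a)
  rwa [coe_δu, counit_modularElement_rmul, counit_modularElement_lmul, eq_comm] at h

theorem exists_χ_eq_one : ∃ e, Q.χ e = 1 := by
  obtain ⟨e, he⟩ := Q.exists_counit_eq_one
  exact ⟨Q.σ e, by rw [χ_apply, LinearEquiv.symm_apply_apply, he]⟩

/-! ### Comultiplication and the modular automorphisms -/

theorem sliceR_φ_TΔ2_σ (c a : A) :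
    sliceR Q.φ (Q.TΔ2 (c ⊗ₜ Q.σ a)) = sliceR Q.φ (Q.T2Δ (a ⊗ₜ c)) := by
  apply mul_left_cancel_of_nondeg Q.nondeg_right
  intro d
  have h := congrArg (sliceR Q.φ) (Q.T1Δ_TΔ2 d c (Q.σ a))
  have h' := congrArg (sliceR Q.φ) (Q.comul_rmul_T1Δ c d a)
  rw [comul_rmul_T2Δ, sliceR_rTensor, sliceR_lTensor] at h'
  rw [sliceR_rTensor, sliceR_lTensor] at h
  have e : Q.φ ∘ₗ mulRight k (Q.σ a) = Q.φ ∘ₗ mulLeft k a := by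
    ext x; simp [Q.φ_mul a x]
  rw [e] at h
  exact h.symm.trans h'.symm

/-- Test the second leg against φ(c ·). Strong invariance is used twice, and in between σ carries a
from one side of Δ(c) to the other; each use contributes one S, hence S² on the first leg. -/
theorem T1Δ_σ (b a : A) : Q.T1Δ (Q.antipodeSq b ⊗ₜ Q.σ a) =
    TensorProduct.map Q.antipodeSq.toLinearEquiv.toLinearMap Q.σ.toLinearEquiv.toLinearMap
      (Q.T1Δ (b ⊗ₜ a)) := by
  rw [← sub_eq_zero]
  refine sliceR_eq_zero (fun c => Q.φ ∘ₗ mulLeft k c) (fun b hb => Q.φ_faithful_right b hb) _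
    fun c => ?_
  rw [map_sub, sub_eq_zero, map_eq_lTensor_rTensor, sliceR_lTensor, sliceR_rTensor]
  have h1 := congrArg (sliceR Q.φ) (Q.comul_rmul_T1Δ (Q.σ a) (Q.antipodeSq b) c)
  rw [comul_rmul_T2Δ, sliceR_rTensor, sliceR_lTensor, sliceR_φ_T2Δ, sliceR_φ_TΔ2_σ, sliceR_φ_T2Δ,
    LinearMap.mulLeft_apply, ← antipodeSq_apply, ← AlgAut.map_mul] at h1
  have h2 := congrArg (sliceR Q.φ) (Q.T1Δ_TΔ2 b a c)
  rw [sliceR_rTensor, sliceR_lTensor, LinearMap.mulLeft_apply] at h2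
  have e : (Q.φ ∘ₗ mulLeft k c) ∘ₗ Q.σ.toLinearEquiv.toLinearMap = Q.φ ∘ₗ mulRight k c := by
    ext x; simp [Q.φ_mul x c]
  rw [e, h2, ← h1, LinearEquiv.coe_coe]

theorem sliceL_ψ_TΔ1_σ' (c a : A) :
    sliceL Q.ψ (Q.TΔ1 (c ⊗ₜ Q.σ' a)) = sliceL Q.ψ (Q.T1Δ (a ⊗ₜ c)) := by
  apply mul_right_cancel_of_nondeg Q.nondeg_left
  intro d
  have h := congrArg (sliceL Q.ψ) (Q.comul_lmul_TΔ1 c (Q.σ' a) d)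
  have h' := congrArg (sliceL Q.ψ) (Q.T1Δ_TΔ2 a c d)
  rw [comul_lmul_TΔ2, sliceL_rTensor, sliceL_lTensor] at h
  rw [sliceL_rTensor, sliceL_lTensor] at h'
  have e : Q.ψ ∘ₗ mulRight k (Q.σ' a) = Q.ψ ∘ₗ mulLeft k a := by
    ext x; simp [Q.ψ_mul a x]
  rw [e] at h
  exact h.symm.trans h'.symm

/-- Mirror image of `T1Δ_σ`, with strong invariance of ψ; here the two antipodes land on the
opposite side of the equation, hence S⁻². -/
theorem TΔ2_σ' (a b : A) : Q.TΔ2 (Q.σ' a ⊗ₜ b) =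
    Q.σ'.toLinearEquiv.toLinearMap.rTensor A (Q.antipodeSq.toLinearEquiv.symm.toLinearMap.lTensor A
      (Q.TΔ2 (a ⊗ₜ Q.antipodeSq b))) := by
  rw [← sub_eq_zero]
  refine sliceL_eq_zero (fun c => Q.ψ ∘ₗ mulLeft k c) (fun b hb => Q.ψ_faithful_right b hb) _
    fun c => ?_
  rw [map_sub, sub_eq_zero, sliceL_rTensor, sliceL_lTensor]
  have e : (Q.ψ ∘ₗ mulLeft k c) ∘ₗ Q.σ'.toLinearEquiv.toLinearMap = Q.ψ ∘ₗ mulRight k c := by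
    ext x; simp [Q.ψ_mul x c]
  have h1 := congrArg (sliceL Q.ψ) (Q.T1Δ_TΔ2 c (Q.σ' a) b)
  have h2 := congrArg (sliceL Q.ψ) (Q.comul_lmul_TΔ1 a c (Q.antipodeSq b))
  rw [sliceL_lTensor, sliceL_rTensor] at h1
  rw [comul_lmul_TΔ2, sliceL_lTensor, sliceL_rTensor] at h2
  have h3 : Q.antipodeSq (sliceL Q.ψ (Q.T1Δ (c ⊗ₜ Q.σ' a))) = sliceL Q.ψ (Q.TΔ1 (a ⊗ₜ c)) := by
    rw [antipodeSq_apply, ← sliceL_ψ_TΔ1, sliceL_ψ_TΔ1_σ', sliceL_ψ_TΔ1]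
  rw [e, h2, ← h1, LinearEquiv.coe_coe, LinearEquiv.eq_symm_apply, LinearMap.mulRight_apply,
    LinearMap.mulRight_apply, AlgAut.map_mul, h3]

/-! ### Translation by the distinguished character -/

/-- `a ↦ (ι ⊗ χ)Δ(a)`. -/
def charRight : AlgAut k A := Q.antipodeSq.trans Q.σ.symm

/-- `a ↦ (χ ⊗ ι)Δ(a)`. -/
def charLeft : AlgAut k A := Q.σ'.symm.trans Q.antipodeSq.symm

theorem σ_charRight (a : A) : Q.σ (Q.charRight a) = Q.antipodeSq a := by
  simp [charRight]

/-- As χσ = ε, applying ι⊗χ to Δσ = (S²⊗σ)Δ leaves S². The next lemma uses χσ' = ε in the same way.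
-/
theorem sliceR_χ_T1Δ (b a : A) : sliceR Q.χ (Q.T1Δ (b ⊗ₜ a)) = b * Q.charRight a := by
  obtain ⟨b, rfl⟩ := Q.antipodeSq.toLinearEquiv.surjective b
  obtain ⟨a, rfl⟩ := Q.σ.toLinearEquiv.surjective a
  have e : Q.χ ∘ₗ Q.σ.toLinearEquiv.toLinearMap = Q.counit := by
    ext x; simp [χ_apply]
  rw [T1Δ_σ, map_eq_lTensor_rTensor, sliceR_lTensor, sliceR_rTensor, e, sliceR_counit_T1Δ,
    LinearEquiv.coe_coe, AlgAut.map_mul]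
  simp [charRight, ← σ_antipodeSq]

theorem sliceL_χ_TΔ2 (a b : A) : sliceL Q.χ (Q.TΔ2 (a ⊗ₜ b)) = Q.charLeft a * b := by
  obtain ⟨a, rfl⟩ := Q.σ'.toLinearEquiv.surjective a
  have e : Q.χ ∘ₗ Q.σ'.toLinearEquiv.toLinearMap = Q.counit := by
    ext x; simp [χ_σ']
  rw [TΔ2_σ', sliceL_rTensor, sliceL_lTensor, e, sliceL_counit_TΔ2,
    LinearEquiv.coe_coe, AlgAut.symm_map_mul, LinearEquiv.symm_apply_apply]
  simp [charLeft]

theorem χ_charRight_symm (a : A) : Q.χ (Q.charRight.toLinearEquiv.symm a) = Q.counit a := by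
  obtain ⟨a, rfl⟩ := Q.charRight.toLinearEquiv.surjective a
  rw [LinearEquiv.symm_apply_apply]
  simp only [charRight, AlgAut.trans_apply, AlgAut.symm_toLinearEquiv]
  rw [← χ_apply]
  obtain ⟨a, rfl⟩ := Q.σ.toLinearEquiv.surjective a
  rw [← σ_antipodeSq, χ_apply, χ_apply, LinearEquiv.symm_apply_apply, LinearEquiv.symm_apply_apply,
    antipodeSq_apply, counit_antipode, counit_antipode]

theorem φ_charRight (a : A) : Q.φ (Q.charRight a) = Q.scaling * Q.φ a := by
  rw [← φ_σ, σ_charRight, φ_antipodeSq]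

theorem antipodeSq_charLeft (a : A) : Q.antipodeSq (Q.charLeft a) = Q.σ'.toLinearEquiv.symm a := by
  simp [charLeft]

theorem φ_charLeft (a : A) : Q.φ (Q.charLeft a) = Q.φ a := by
  apply mul_left_cancel₀ Q.scaling_ne_zero
  have h := Q.φ_σ' (Q.σ'.toLinearEquiv.symm a)
  rw [LinearEquiv.apply_symm_apply] at h
  rw [← φ_antipodeSq, antipodeSq_charLeft, h, mul_inv_cancel_left₀ Q.scaling_ne_zero]

theorem σ_charLeft_charRight (a : A) :
    Q.σ (Q.charLeft (Q.charRight a)) = Q.antipodeSq (Q.charLeft a) := by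
  apply Q.antipodeSq.toLinearEquiv.injective
  apply Q.σ'.toLinearEquiv.injective
  rw [← σ_antipodeSq, antipodeSq_charLeft, σ'_σ, LinearEquiv.apply_symm_apply, σ_charRight,
    antipodeSq_charLeft, σ'_antipodeSq, LinearEquiv.apply_symm_apply]

/-- `ρ = σ ν` satisfies `δ S²(ρ(a)) = a δ`. -/
theorem δu_lmul_antipodeSq_σ_charLeft (a : A) :
    (Q.δu : Mult k A).lmul (Q.antipodeSq (Q.σ (Q.charLeft a))) = (Q.δu : Mult k A).rmul a := by
  rw [← σ_antipodeSq, antipodeSq_charLeft, ← δu_rmul_σ', LinearEquiv.apply_symm_apply]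

end AlgebraicQuantumGroup

/-! ### The action of a character on a Galois object -/

namespace GaloisObject

variable {k A X : Type*} [Field k]
  [NonUnitalRing A] [Module k A] [IsScalarTower k A A] [SMulCommClass k A A]
  [NonUnitalRing X] [Module k X] [IsScalarTower k X X] [SMulCommClass k X X]
  {Q : AlgebraicQuantumGroup k A} (G : GaloisObject Q X)

/-- `x ↦ (ι ⊗ f)(α(x)(1 ⊗ e))`. -/
def charMap (f : A →ₗ[k] k) (e : A) : X →ₗ[k] X := sliceR f ∘ₗ appR G.T₁ e

theorem sliceR_comp_mulRight {k A : Type*} [Field k] [NonUnitalRing A] [Module k A]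
    [IsScalarTower k A A] {M : Type*} [AddCommGroup M] [Module k M] {f : A →ₗ[k] k}
    (hf : ∀ a b, f (a * b) = f a * f b) {e : A} (he : f e = 1) (t : M ⊗[k] A) :
    sliceR (f ∘ₗ mulRight k e) t = sliceR f t := by
  congr 2
  ext x
  simp [hf, he]

/-- For multiplicative f with f(e) = 1 the cover e has no effect, so `charMap` is the slice (ι⊗f)α.
-/
theorem mul_charMap {f : A →ₗ[k] k} (hf : ∀ a b, f (a * b) = f a * f b) {e : A} (he : f e = 1)
    (y x : X) : y * G.charMap f e x = sliceR f (G.V (y ⊗ₜ x)) := by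
  have h := congrArg (sliceR f) (G.V_T₁ y x e)
  rw [sliceR_lTensor, sliceR_rTensor, sliceR_comp_mulRight hf he] at h
  exact h.symm

theorem charMap_mul {f : A →ₗ[k] k} (hf : ∀ a b, f (a * b) = f a * f b) {e : A} (he : f e = 1)
    (x x' : X) : G.charMap f e (x * x') = G.charMap f e x * G.charMap f e x' := by
  apply mul_left_cancel_of_nondeg G.nondeg_right
  intro y
  rw [← mul_assoc, mul_charMap _ hf he y (x * x'), mul_charMap _ hf he y x, V_mul_right]
  generalize G.V (y ⊗ₜ x) = t
  induction t with
  | zero => simp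
  | add s t hs ht => simp only [map_add, add_mul, hs, ht]
  | tmul p a =>
    have e1 : f ∘ₗ mulLeft k a = f a • f := by ext b; simp [hf]
    rw [α_rmul_V, sliceR_lTensor, e1, sliceR_smul, sliceR_tmul, smul_mul_assoc,
      mul_charMap _ hf he]

/-- Coassociativity with f on the last leg; the hypothesis on N says that N = (ι⊗f)Δ. -/
theorem V_charMap {f : A →ₗ[k] k} (hf : ∀ a b, f (a * b) = f a * f b) {e : A} (he : f e = 1)
    {N : A →ₗ[k] A} (hN : ∀ b a, sliceR f (Q.T1Δ (b ⊗ₜ a)) = b * N a) (y x : X) :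
    G.V (y ⊗ₜ G.charMap f e x) = N.lTensor X (G.V (y ⊗ₜ x)) := by
  have h := congrArg (sliceR f) (G.legs y x e)
  rw [sliceR_rTensor, sliceR_assoc_symm, ← LinearMap.lTensor_comp_apply] at h
  have e1 : sliceR f ∘ₗ appR Q.TΔ2.toLinearMap e = N := by
    ext b
    apply mul_left_cancel_of_nondeg Q.nondeg_right
    intro c
    have h := congrArg (sliceR f) (Q.T1Δ_TΔ2 c b e)
    rw [sliceR_lTensor, sliceR_rTensor, sliceR_comp_mulRight hf he, hN] at h
    exact h.symm
  rw [e1] at h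
  exact h

end GaloisObject

namespace AlgebraicQuantumGroup

variable {k A : Type*} [Field k] [NonUnitalRing A] [Module k A]
  [IsScalarTower k A A] [SMulCommClass k A A] (Q : AlgebraicQuantumGroup k A)

/-- An element with `χ(e) = 1`. -/
def χOne : A := Classical.choose Q.exists_χ_eq_one

theorem χ_χOne : Q.χ Q.χOne = 1 := Classical.choose_spec Q.exists_χ_eq_one

theorem selfGalois_charMap (a : A) : Q.selfGalois.charMap Q.χ Q.χOne a = Q.charRight a := by
  apply mul_left_cancel_of_nondeg Q.nondeg_right
  intro y
  rw [Q.selfGalois.mul_charMap Q.χ_mul Q.χ_χOne, ← sliceR_χ_T1Δ]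
  rfl

theorem T1Δ_charRight (b a : A) : Q.T1Δ (b ⊗ₜ Q.charRight a) =
    Q.charRight.toLinearEquiv.toLinearMap.lTensor A (Q.T1Δ (b ⊗ₜ a)) := by
  rw [← selfGalois_charMap]
  exact Q.selfGalois.V_charMap Q.χ_mul Q.χ_χOne (N := Q.charRight.toLinearEquiv.toLinearMap)
    Q.sliceR_χ_T1Δ b a

/-- The inverse of the character `χ`. -/
def χInv : A →ₗ[k] k := Q.counit ∘ₗ Q.σ.toLinearEquiv.toLinearMap

theorem χInv_apply (a : A) : Q.χInv a = Q.counit (Q.σ a) := rfl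

theorem χInv_mul (a b : A) : Q.χInv (a * b) = Q.χInv a * Q.χInv b := by
  rw [χInv_apply, AlgAut.map_mul, counit_mul]
  rfl

theorem χInv_charRight (a : A) : Q.χInv (Q.charRight a) = Q.counit a := by
  rw [χInv_apply, σ_charRight, antipodeSq_apply, counit_antipode, counit_antipode]

theorem χ_antipode_eq (a : A) : Q.χ (Q.antipode a) = Q.χInv a := by
  rw [χ_antipode, χInv_apply, counit_σ]

theorem χ_antipode_symm (a : A) : Q.χ (Q.antipode.symm a) = Q.χInv a := by
  obtain ⟨a, rfl⟩ := Q.antipode.surjective a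
  obtain ⟨a, rfl⟩ := Q.σ'.toLinearEquiv.surjective a
  rw [LinearEquiv.symm_apply_apply, χInv_apply, σ_antipode_σ', counit_antipode, χ_σ']

theorem exists_χInv_eq_one : ∃ e, Q.χInv e = 1 := by
  obtain ⟨e, he⟩ := Q.exists_counit_eq_one
  exact ⟨Q.σ.toLinearEquiv.symm e, by rw [χInv_apply, LinearEquiv.apply_symm_apply, he]⟩

/-- An element with `χ⁻¹(e) = 1`. -/
def χInvOne : A := Classical.choose Q.exists_χInv_eq_one

theorem χInv_χInvOne : Q.χInv Q.χInvOne = 1 := Classical.choose_spec Q.exists_χInv_eq_one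

theorem sliceR_χInv_T1Δ (b a : A) :
    sliceR Q.χInv (Q.T1Δ (b ⊗ₜ a)) = b * Q.charRight.toLinearEquiv.symm a := by
  obtain ⟨a, rfl⟩ := Q.charRight.toLinearEquiv.surjective a
  have e : Q.χInv ∘ₗ Q.charRight.toLinearEquiv.toLinearMap = Q.counit := by
    ext x; simp [χInv_charRight]
  rw [T1Δ_charRight, sliceR_lTensor, e, sliceR_counit_T1Δ, LinearEquiv.symm_apply_apply]

end AlgebraicQuantumGroup

namespace GaloisObject

variable {k A X : Type*} [Field k]
  [NonUnitalRing A] [Module k A] [IsScalarTower k A A] [SMulCommClass k A A]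
  [NonUnitalRing X] [Module k X] [IsScalarTower k X X] [SMulCommClass k X X]
  {Q : AlgebraicQuantumGroup k A} (G : GaloisObject Q X)

open AlgebraicQuantumGroup

/-- `x ↦ (ι ⊗ χ)α(x)`, the action of the modular element of the dual. -/
def charAct : AlgAut k X where
  toLinearEquiv := LinearEquiv.ofLinearMap (G.charMap Q.χ Q.χOne) (G.charMap Q.χInv Q.χInvOne)
    (by
      ext x
      apply mul_left_cancel_of_nondeg G.nondeg_right
      intro y
      rw [LinearMap.comp_apply, G.mul_charMap Q.χ_mul Q.χ_χOne,
        G.V_charMap Q.χInv_mul Q.χInv_χInvOne Q.sliceR_χInv_T1Δ (N :=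
          Q.charRight.toLinearEquiv.symm.toLinearMap), sliceR_lTensor]
      have e : Q.χ ∘ₗ Q.charRight.toLinearEquiv.symm.toLinearMap = Q.counit := by
        ext x; simp [χ_charRight_symm]
      rw [e, sliceR_counit_V, LinearMap.id_apply])
    (by
      ext x
      apply mul_left_cancel_of_nondeg G.nondeg_right
      intro y
      rw [LinearMap.comp_apply, G.mul_charMap Q.χInv_mul Q.χInv_χInvOne,
        G.V_charMap Q.χ_mul Q.χ_χOne Q.sliceR_χ_T1Δ (N :=
          Q.charRight.toLinearEquiv.toLinearMap), sliceR_lTensor]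
      have e : Q.χInv ∘ₗ Q.charRight.toLinearEquiv.toLinearMap = Q.counit := by
        ext x; simp [χInv_charRight]
      rw [e, sliceR_counit_V, LinearMap.id_apply])
  map_mul' := G.charMap_mul Q.χ_mul Q.χ_χOne

theorem mul_charAct (y x : X) : y * G.charAct x = sliceR Q.χ (G.V (y ⊗ₜ x)) :=
  G.mul_charMap Q.χ_mul Q.χ_χOne y x

theorem V_charAct (y x : X) : G.V (y ⊗ₜ G.charAct x) =
    Q.charRight.toLinearEquiv.toLinearMap.lTensor X (G.V (y ⊗ₜ x)) :=
  G.V_charMap Q.χ_mul Q.χ_χOne (N := Q.charRight.toLinearEquiv.toLinearMap) Q.sliceR_χ_T1Δ y x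

/-- Coassociativity with χ on the middle leg, where it can be read as acting on X or on A. The cover
changes from ν(b) to b because ν = (χ⊗ι)Δ is multiplicative. -/
theorem charAct_rTensor_T₁ (x : X) (b : A) :
    G.charAct.toLinearEquiv.toLinearMap.rTensor A (G.T₁ (x ⊗ₜ Q.charLeft b)) =
      Q.charLeft.toLinearEquiv.toLinearMap.lTensor X (G.T₁ (x ⊗ₜ b)) := by
  apply rTensor_mulLeft_cancel G.nondeg_right
  intro y
  have h := congrArg ((sliceR Q.χ).rTensor A) (G.legs y x (Q.charLeft b))
  rw [sliceR_rTensor_assoc_symm, ← LinearMap.lTensor_comp_apply,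
    ← LinearMap.rTensor_comp_apply] at h
  have e1 : sliceR Q.χ ∘ₗ appL G.V.toLinearMap y =
      mulLeft k y ∘ₗ G.charAct.toLinearEquiv.toLinearMap := by
    ext z
    exact (G.mul_charAct y z).symm
  have e2 : sliceL Q.χ ∘ₗ appR Q.TΔ2.toLinearMap (Q.charLeft b) =
      Q.charLeft.toLinearEquiv.toLinearMap ∘ₗ mulRight k b := by
    ext z
    simp only [LinearMap.comp_apply, LinearEquiv.coe_coe, LinearMap.mulRight_apply]
    rw [AlgAut.map_mul, ← sliceL_χ_TΔ2]
    rfl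
  rw [e1, e2, LinearMap.rTensor_comp_apply, LinearMap.lTensor_comp_apply,
    LinearEquiv.coe_coe G.V, V_T₁] at h
  rw [h, lTensor_rTensor]

end GaloisObject

/-! ### The dual -/

namespace AlgebraicQuantumGroup

variable {k A : Type*} [Field k] [NonUnitalRing A] [Module k A]
  [IsScalarTower k A A] [SMulCommClass k A A] (Q : AlgebraicQuantumGroup k A)

theorem charRight_rTensor_TΔ2 (a b : A) :
    Q.charRight.toLinearEquiv.toLinearMap.rTensor A (Q.TΔ2 (a ⊗ₜ Q.charLeft b)) =
      Q.charLeft.toLinearEquiv.toLinearMap.lTensor A (Q.TΔ2 (a ⊗ₜ b)) := by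
  have e : Q.selfGalois.charAct.toLinearEquiv.toLinearMap =
      Q.charRight.toLinearEquiv.toLinearMap := LinearMap.ext Q.selfGalois_charMap
  rw [← e]
  exact Q.selfGalois.charAct_rTensor_T₁ a b

theorem hat_injective : Function.Injective Q.hat := by
  intro a b h
  apply faithful_right_ext Q.φ_faithful_right
  intro x
  rw [← ev_hat, h, ev_hat]

/-- The linear isomorphism `a ↦ φ(· a)` of `A` with its dual. -/
def hatEquiv : A ≃ₗ[k] Q.Dual := LinearEquiv.ofBijective Q.hat ⟨Q.hat_injective, Q.hat_surjective⟩

@[simp] theorem hatEquiv_apply (a : A) : Q.hatEquiv a = Q.hat a := rfl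

@[simp] theorem hatEquiv_symm_hat (a : A) : Q.hatEquiv.symm (Q.hat a) = a :=
  Q.hatEquiv.symm_apply_apply a

theorem val_hat (a : A) : Dual.val Q (Q.hat a) = Q.φ ∘ₗ mulRight k a := rfl

theorem ev_comp_hat (x : A) : Q.ev x ∘ₗ Q.hat = Q.φ ∘ₗ mulLeft k x := rfl

/-- This is the associativity ω(χω') = (ωχ)ω' of convolution. Moving a translation onto the element
that represents a functional costs the factor by which it scales φ: 1 for `charLeft`, τ for
`charRight`. -/
theorem pair_lmul_charLeft_symm (x a b : A) :
    pair Q.φ Q.φ ((Q.comul x).lmul (a ⊗ₜ Q.charLeft.toLinearEquiv.symm b)) =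
      Q.scaling * pair Q.φ Q.φ ((Q.comul x).lmul (Q.charRight.toLinearEquiv.symm a ⊗ₜ b)) := by
  obtain ⟨a, rfl⟩ := Q.charRight.toLinearEquiv.surjective a
  obtain ⟨b, rfl⟩ := Q.charLeft.toLinearEquiv.surjective b
  simp only [LinearEquiv.symm_apply_apply]
  have e1 : Q.φ ∘ₗ Q.charLeft.toLinearEquiv.toLinearMap = Q.φ := LinearMap.ext Q.φ_charLeft
  have e2 : (Q.φ ∘ₗ mulRight k (Q.charRight a)) ∘ₗ Q.charRight.toLinearEquiv.toLinearMap =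
      Q.scaling • (Q.φ ∘ₗ mulRight k a) := by
    ext y
    simp only [LinearMap.comp_apply, LinearEquiv.coe_coe, LinearMap.mulRight_apply,
      LinearMap.smul_apply]
    rw [← AlgAut.map_mul, φ_charRight, smul_eq_mul]
  have h : ∀ (c : A) (t : A ⊗[k] A), pair Q.φ Q.φ ((mulRight k c).rTensor A t) =
      Q.φ (sliceL (Q.φ ∘ₗ mulRight k c) t) := by
    intro c t
    rw [pair_eq_sliceL, sliceL_rTensor]
  have h1 := congrArg (sliceL (Q.φ ∘ₗ mulRight k (Q.charRight a))) (Q.charRight_rTensor_TΔ2 x b)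
  rw [sliceL_rTensor, e2, sliceL_smul, sliceL_lTensor] at h1
  have h2 := congrArg Q.φ h1
  rw [map_smul] at h2
  rw [comul_lmul_TΔ2, comul_lmul_TΔ2, h, h, ← smul_eq_mul, h2]
  exact (LinearMap.congr_fun e1 _).symm

/-- The modular element of the dual. -/
def dualModular : Mult k Q.Dual :=
  Mult.mk (Q.hat ∘ₗ Q.charLeft.toLinearEquiv.symm.toLinearMap ∘ₗ Q.hatEquiv.symm.toLinearMap)
    (Q.scaling • (Q.hat ∘ₗ Q.charRight.toLinearEquiv.symm.toLinearMap ∘ₗ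
      Q.hatEquiv.symm.toLinearMap))
    (by
      intro ω ω'
      obtain ⟨a, rfl⟩ := Q.hat_surjective ω
      obtain ⟨b, rfl⟩ := Q.hat_surjective ω'
      apply Dual.ext
      intro x
      simp only [LinearMap.smul_apply, LinearMap.comp_apply, LinearEquiv.coe_coe,
        hatEquiv_symm_hat, smul_mul_assoc, map_smul]
      rw [ev_hat_mul_hat, ev_hat_mul_hat, pair_lmul_charLeft_symm, smul_eq_mul])

theorem dualModular_lmul (b : A) :
    Q.dualModular.lmul (Q.hat b) = Q.hat (Q.charLeft.toLinearEquiv.symm b) := by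
  simp [dualModular]

theorem dualModular_rmul (b : A) : Q.dualModular.rmul (Q.hat b) =
    Q.scaling • Q.hat (Q.charRight.toLinearEquiv.symm b) := by
  simp [dualModular]

/-- The left invariant functional of the dual. -/
def dualφ : Q.Dual →ₗ[k] k := Q.scaling⁻¹ • (Q.χ ∘ₗ Q.hatEquiv.symm.toLinearMap)

theorem dualφ_hat (b : A) : Q.dualφ (Q.hat b) = Q.scaling⁻¹ * Q.χ b := by
  simp [dualφ]

theorem dualφ_spec (a : A) : ∃ ω : Q.Dual, (∀ x, Q.ev x ω = Q.φ (Q.antipode (a * x))) ∧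
    Q.dualφ ω = Q.counit a := by
  -- One has ψ(a ·) = φ(· σ'(a)δ) and χ(σ'(a)δ) = τε(a); this accounts for the factor τ⁻¹ in
  -- `dualφ`.
  refine ⟨Q.hat ((Q.δu : Mult k A).rmul (Q.σ' a)), fun x => ?_, ?_⟩
  · rw [ev_hat, φ_mul_δu_rmul, ← ψ_mul]
    rfl
  · rw [dualφ_hat, χ_δu_rmul, inv_mul_cancel_left₀ Q.scaling_ne_zero, χ_σ']

theorem sliceL_χInv_TΔ2 (a b : A) :
    sliceL Q.χInv (Q.TΔ2 (a ⊗ₜ b)) = Q.charLeft.toLinearEquiv.symm a * b := by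
  obtain ⟨b, rfl⟩ := Q.antipodeSq.toLinearEquiv.surjective b
  have h := congrArg (sliceL Q.counit) (Q.TΔ2_σ' a b)
  have e : Q.counit ∘ₗ Q.σ'.toLinearEquiv.toLinearMap = Q.χInv := by
    ext x; simp [χInv_apply, counit_σ]
  rw [sliceL_counit_TΔ2, sliceL_rTensor, sliceL_lTensor, e, LinearEquiv.coe_coe,
    LinearEquiv.eq_symm_apply, AlgAut.map_mul, ← σ'_antipodeSq] at h
  exact h.symm

theorem sliceL_χInv_T1Δ (p b : A) :
    sliceL Q.χInv (Q.T1Δ (p ⊗ₜ b)) = Q.χInv p • Q.charLeft.toLinearEquiv.symm b := by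
  apply mul_right_cancel_of_nondeg Q.nondeg_left
  intro d
  have h := congrArg (sliceL Q.χInv) (Q.T1Δ_TΔ2 p b d)
  have e : Q.χInv ∘ₗ mulLeft k p = Q.χInv p • Q.χInv := by
    ext x; simp [χInv_mul]
  rw [sliceL_lTensor, sliceL_rTensor, e, sliceL_smul, sliceL_χInv_TΔ2, ← smul_mul_assoc] at h
  exact h

theorem sliceR_χInv_T2Δ (q b : A) :
    sliceR Q.χInv (Q.T2Δ (q ⊗ₜ b)) = Q.χInv q • Q.charRight.toLinearEquiv.symm b := by
  apply mul_left_cancel_of_nondeg Q.nondeg_right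
  intro d
  have h := congrArg (sliceR Q.χInv) (Q.comul_rmul_T1Δ b d q)
  have e : Q.χInv ∘ₗ mulLeft k q = Q.χInv q • Q.χInv := by
    ext x; simp [χInv_mul]
  rw [comul_rmul_T2Δ, sliceR_lTensor, sliceR_rTensor, e, sliceR_smul, sliceR_χInv_T1Δ,
    ← mul_smul_comm] at h
  exact h

theorem sliceL_φ_TΔ1_δu (y b : A) : sliceL Q.φ (Q.TΔ1 (y ⊗ₜ (Q.δu : Mult k A).rmul b)) =
    sliceL Q.ψ (Q.TΔ1 (y ⊗ₜ b)) := by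
  apply mul_right_cancel_of_nondeg Q.nondeg_left
  intro d
  have h1 := congrArg (sliceL Q.φ) (Q.comul_lmul_TΔ1 y ((Q.δu : Mult k A).rmul b) d)
  have h2 := congrArg (sliceL Q.ψ) (Q.comul_lmul_TΔ1 y b d)
  have e : Q.φ ∘ₗ mulRight k ((Q.δu : Mult k A).rmul b) = Q.ψ ∘ₗ mulRight k b := by
    ext x; simp [φ_mul_δu_rmul]
  rw [comul_lmul_TΔ2, sliceL_rTensor, sliceL_lTensor, e] at h1
  rw [comul_lmul_TΔ2, sliceL_rTensor, sliceL_lTensor] at h2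
  exact h1.symm.trans h2

theorem charRight_symm_δu_rmul (b : A) : Q.charRight.toLinearEquiv.symm ((Q.δu : Mult k A).rmul b) =
    Q.scaling⁻¹ • (Q.δu : Mult k A).rmul (Q.charRight.toLinearEquiv.symm b) := by
  obtain ⟨b, rfl⟩ := Q.charRight.toLinearEquiv.surjective b
  rw [LinearEquiv.symm_apply_apply, LinearEquiv.symm_apply_eq, map_smul]
  simp only [charRight, AlgAut.trans_apply, AlgAut.symm_toLinearEquiv]
  rw [antipodeSq_δu_rmul, σ_symm_δu_rmul, smul_smul, inv_mul_cancel₀ Q.scaling_ne_zero, one_smul]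

theorem dualModular_left (ω : Q.Dual) (b : A) : ∃ t : Q.Dual ⊗[k] Q.Dual,
    (∀ x y : A, pair (Q.ev x) (Q.ev y) t =
      pair (Dual.val Q ω ∘ₗ LinearMap.mulLeft k x) Q.φ (Q.TΔ2 (y ⊗ₜ b))) ∧
    sliceL Q.dualφ t = Q.dualφ ω • Q.dualModular.lmul (Q.hat b) := by
  obtain ⟨c, rfl⟩ := Q.hat_surjective ω
  -- By strong invariance the required tensor is ∑ φ(· S⁻¹(p)) ⊗ φ(· q), where ∑ p⊗q = (S(c)⊗1)Δ(b).
  refine ⟨TensorProduct.map (Q.hat ∘ₗ Q.antipode.symm.toLinearMap) Q.hat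
    (Q.T1Δ (Q.antipode c ⊗ₜ b)), fun x y => ?_, ?_⟩
  · rw [pair_eq_sliceR, pair_eq_sliceR, map_eq_lTensor_rTensor, sliceR_lTensor, sliceR_rTensor,
      ev_comp_hat, val_hat]
    have h := congrArg (sliceR Q.φ) (Q.comul_rmul_T1Δ b (Q.antipode c) y)
    rw [comul_rmul_T2Δ, sliceR_rTensor, sliceR_lTensor, sliceR_φ_T2Δ, LinearMap.mulLeft_apply,
      ← antipode_mul] at h
    rw [← h]
    simp [mul_assoc]
  · rw [map_eq_lTensor_rTensor, sliceL_lTensor, sliceL_rTensor, dualφ_hat, dualModular_lmul,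
      ← map_smul]
    have e : Q.dualφ ∘ₗ Q.hat ∘ₗ Q.antipode.symm.toLinearMap = Q.scaling⁻¹ • Q.χInv := by
      ext x
      simp [dualφ_hat, χ_antipode_symm]
    rw [e, sliceL_smul, sliceL_χInv_T1Δ, ← χ_antipode_symm, LinearEquiv.symm_apply_apply, smul_smul]

theorem dualModular_right (ω : Q.Dual) (b : A) : ∃ t : Q.Dual ⊗[k] Q.Dual,
    (∀ x y : A, pair (Q.ev x) (Q.ev y) t =
      pair Q.φ (Dual.val Q ω ∘ₗ LinearMap.mulLeft k x) (Q.TΔ1 (y ⊗ₜ b))) ∧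
    sliceL Q.dualφ t = Q.dualφ ω • Q.dualModular.rmul (Q.hat b) := by
  obtain ⟨c, rfl⟩ := Q.hat_surjective ω
  -- Writing b as b'δ replaces φ(· b) by ψ(· b'), for which strong invariance is available in the
  -- first leg.
  obtain ⟨b, rfl⟩ : ∃ b', (Q.δu : Mult k A).rmul b' = b := ⟨_, Mult.rmul_inv_rmul Q.δu b⟩
  refine ⟨TensorProduct.comm k _ _ (TensorProduct.map (Q.hat ∘ₗ (Q.δu : Mult k A).rmul)
    (Q.hat ∘ₗ Q.antipode.toLinearMap) (Q.T2Δ (Q.antipode.symm c ⊗ₜ b))), fun x y => ?_, ?_⟩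
  · rw [pair_eq_sliceR, pair_eq_sliceL, sliceR_comm, map_eq_lTensor_rTensor, sliceL_lTensor,
      sliceL_rTensor, sliceL_φ_TΔ1_δu, val_hat]
    have e : Q.ev y ∘ₗ Q.hat ∘ₗ (Q.δu : Mult k A).rmul = Q.ψ ∘ₗ mulLeft k y := by
      ext x
      simp [φ_mul_δu_rmul]
    have h := congrArg (sliceL Q.ψ) (Q.comul_rmul_T1Δ b y (Q.antipode.symm c))
    rw [comul_rmul_T2Δ, sliceL_rTensor, sliceL_lTensor, LinearMap.mulLeft_apply] at h
    rw [e, h]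
    simp [antipode_mul, sliceL_ψ_TΔ1, mul_assoc]
  · have e : Q.dualφ ∘ₗ Q.hat ∘ₗ Q.antipode.toLinearMap = Q.scaling⁻¹ • Q.χInv := by
      ext x
      simp [dualφ_hat, χ_antipode_eq]
    rw [sliceL_comm, map_eq_lTensor_rTensor, sliceR_lTensor, sliceR_rTensor, e, sliceR_smul,
      sliceR_χInv_T2Δ, dualφ_hat, dualModular_rmul, charRight_symm_δu_rmul, ← χ_antipode_eq,
      LinearEquiv.apply_symm_apply]
    simp only [map_smul, LinearMap.comp_apply, smul_smul]
    rw [mul_inv_cancel₀ Q.scaling_ne_zero, mul_one]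

/-- The structure maps of an algebraic quantum group. -/
def structureMaps : Q.StructureMaps where
  ε := Q.counit
  counit_left := Q.sliceL_counit_TΔ2
  counit_right := Q.sliceR_counit_T1Δ
  S := Q.antipode
  S_mul := Q.antipode_mul
  antipode_left := Q.mul'_antipode_TΔ2
  antipode_right := Q.mul'_antipode_T1Δ
  σ := Q.σ
  φ_mul := Q.φ_mul
  σ' := Q.σ'
  ψ_mul := Q.ψ_mul
  δ := Q.modularElement
  δ_left := Q.sliceL_φ_TΔ2
  δ_right := Q.sliceL_φ_T2Δ
  τ := Q.scaling
  φ_S_S := Q.φ_antipode_antipode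
  φhat := Q.dualφ
  φhat_spec := Q.dualφ_spec
  δhat := Q.dualModular
  δhat_left := Q.dualModular_left
  δhat_right := Q.dualModular_right

end AlgebraicQuantumGroup

theorem rTensor_smulRight {k X Y A : Type*} [Field k] [AddCommGroup A] [Module k A]
    [AddCommGroup X] [Module k X] [AddCommGroup Y] [Module k Y] (p : X →ₗ[k] k) (y : Y)
    (t : X ⊗[k] A) : (p.smulRight y).rTensor A t = y ⊗ₜ sliceL p t := by
  induction t with
  | zero => simp
  | add s t hs ht => simp only [map_add, TensorProduct.tmul_add, hs, ht]
  | tmul q a => simp [TensorProduct.smul_tmul]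

theorem AlgebraicQuantumGroup.sliceL_ψ_T2Δ {k A : Type*} [Field k] [NonUnitalRing A] [Module k A]
    [IsScalarTower k A A] [SMulCommClass k A A] (Q : AlgebraicQuantumGroup k A) (b a : A) :
    sliceL Q.ψ (Q.T2Δ (b ⊗ₜ a)) = Q.ψ a • b := by
  apply mul_right_cancel_of_nondeg Q.nondeg_left
  intro c
  have h := congrArg (sliceL Q.ψ) (Q.T2Δ_TΔ2 b a c)
  rw [sliceL_lTensor, sliceL_lTensor, sliceL_ψ_TΔ2, map_smul] at h
  rw [smul_mul_assoc]
  exact h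

namespace GaloisObject

variable {k A X : Type*} [Field k]
  [NonUnitalRing A] [Module k A] [IsScalarTower k A A] [SMulCommClass k A A]
  [NonUnitalRing X] [Module k X] [IsScalarTower k X X] [SMulCommClass k X X]
  {Q : AlgebraicQuantumGroup k A} (G : GaloisObject Q X)

open AlgebraicQuantumGroup

/-! ### The second Galois map -/

section

open Mult

theorem galoisW_mul_right (x y z : X) :
    G.galoisW (x ⊗ₜ (y * z)) = (mulRight k z).rTensor A (G.galoisW (x ⊗ₜ y)) := by
  have := Q.nondeg; have := G.nondeg
  rw [← incl_inj (k := k), incl_rTensor_mulRight, galoisW_spec, galoisW_spec, tmul_incl_mul_one,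
    mul_assoc]

theorem galoisW_mul_left (x y z : X) :
    G.galoisW ((x * y) ⊗ₜ z) = (G.α x).lmul (G.galoisW (y ⊗ₜ z)) := by
  have := Q.nondeg; have := G.nondeg
  rw [← incl_inj (k := k), incl_lmul, galoisW_spec, galoisW_spec, map_mul, mul_assoc]

theorem galoisW_rmul (m : Mult k X) (x y : X) :
    G.galoisW (x ⊗ₜ m.rmul y) = m.rmul.rTensor A (G.galoisW (x ⊗ₜ y)) := by
  have := Q.nondeg; have := G.nondeg
  have h : (tmul (incl y * m) 1 : Mult k (X ⊗[k] A)) = tmul (incl y) 1 * tmul m 1 := by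
    rw [tmul_mul_tmul, mul_one]
  rw [← incl_inj (k := k), ← rmul_tmul_one, incl_rmul, galoisW_spec, galoisW_spec, incl_rmul, h,
    mul_assoc]

theorem V_galoisW (y x z : X) : (mulRight k z).rTensor A (G.V (y ⊗ₜ x)) =
    (mulLeft k y).rTensor A (G.galoisW (x ⊗ₜ z)) := by
  have := Q.nondeg; have := G.nondeg
  rw [← incl_inj (k := k), incl_rTensor_mulRight, incl_rTensor_mulLeft, galoisW_spec, V_spec,
    mul_assoc]

theorem α_lmul_galoisW (x y : X) (a : A) :
    (G.α x).lmul (y ⊗ₜ a) = (mulRight k a).lTensor X (G.galoisW (x ⊗ₜ y)) := by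
  have := Q.nondeg; have := G.nondeg
  rw [← incl_inj (k := k), incl_lmul, incl_lTensor_mulRight, galoisW_spec, incl_tmul, mul_assoc]

/-- The elements (y⊗1)α(x) span X⊗A, because V is onto. -/
theorem α_mul_left_cancel {m n : Mult k (X ⊗[k] A)} (h : ∀ x, G.α x * m = G.α x * n) : m = n := by
  have := Q.nondeg; have := G.nondeg
  apply Mult.ext_of_rmul Nondeg.right
  intro t
  obtain ⟨t, rfl⟩ := G.V.surjective t
  induction t with
  | zero => simp
  | add s t hs ht => simp only [map_add, hs, ht]
  | tmul y x =>
    rw [← incl_inj (k := k), incl_rmul, incl_rmul, V_spec, mul_assoc, mul_assoc, h]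

/-- A one-sided identity suffices: from α(x)n = α(xm) one gets α(w)nα(x) = α(wm)α(x) = α(w)α(mx),
and α(w) cancels. -/
theorem isExtensionAt_of_V {m : Mult k X} {n : Mult k (X ⊗[k] A)}
    (h : ∀ y x, G.V (y ⊗ₜ m.rmul x) = n.rmul (G.V (y ⊗ₜ x))) : IsExtensionAt G.α m n := by
  have := Q.nondeg; have := G.nondeg
  have h2 : ∀ x, G.α x * n = G.α (m.rmul x) := by
    intro x
    apply Mult.ext_of_rmul Nondeg.right
    intro t
    induction t with
    | zero => simp
    | add s t hs ht => simp only [map_add, hs, ht]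
    | tmul y a =>
      rw [rmul_mul, α_rmul_V, α_rmul_V, h]
      exact rmul_lmul_comm (X := X ⊗[k] A) n (tmul 1 (incl a)) _
  refine fun x => ⟨G.α_mul_left_cancel fun w => ?_, h2 x⟩
  rw [← mul_assoc, h2, ← map_mul, ← map_mul, central]

theorem extendsTo_of_V {m : Mult k X} {n : Mult k (X ⊗[k] A)}
    (h : ∀ y x, G.V (y ⊗ₜ m.rmul x) = n.rmul (G.V (y ⊗ₜ x))) : ExtendsTo G.α m n :=
  ⟨G.isExtensionAt_of_V h, fun _ h' => G.α_mul_left_cancel fun x => by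
    rw [(h' x).2, (G.isExtensionAt_of_V h x).2]⟩

end

/-! ### The functional `φ_X` -/

theorem sliceR_φ_V_central (y x z : X) :
    sliceR Q.φ (G.V (y ⊗ₜ x)) * z = y * sliceR Q.φ (G.galoisW (x ⊗ₜ z)) := by
  have h := congrArg (sliceR Q.φ) (G.V_galoisW y x z)
  rwa [sliceR_rTensor, sliceR_rTensor] at h

/-- The pentagon with φ on the last leg, where left invariance absorbs `T1Δ`. It says that the
multiplier (ι⊗φ)α(x) is coinvariant, hence a scalar. -/
theorem V_sliceR_φ_V (y z x : X) : G.V (y ⊗ₜ sliceR Q.φ (G.V (z ⊗ₜ x))) =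
    (sliceR Q.φ ∘ₗ appR G.V.toLinearMap x).rTensor A (G.V (y ⊗ₜ z)) := by
  have h := G.V_pentagon_lTensor (sliceR Q.φ) y z x
    ((sliceR Q.φ ∘ₗ appR G.V.toLinearMap x).rTensor A) (by
      intro p b
      have e : sliceR Q.φ ∘ₗ appL Q.T1Δ.toLinearMap b = Q.φ.smulRight b := by
        ext a
        exact Q.sliceR_φ_T1Δ b a
      rw [e, lTensor_smulRight, LinearMap.rTensor_tmul]
      rfl)
  rw [← sliceR_assoc_symm, LinearEquiv.symm_apply_apply, sliceR_rTensor] at h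
  exact h

theorem exists_sliceR_φ_V_eq (x : X) : ∃ c : k, ∀ y, sliceR Q.φ (G.V (y ⊗ₜ x)) = c • y := by
  obtain ⟨c, hc⟩ := G.coinvariants (Mult.mk (sliceR Q.φ ∘ₗ appL G.galoisW.toLinearMap x)
    (sliceR Q.φ ∘ₗ appR G.V.toLinearMap x) (fun y z => (G.sliceR_φ_V_central y x z).symm))
    (G.isExtensionAt_of_V fun y z => G.V_sliceR_φ_V y z x)
  refine ⟨c, fun y => ?_⟩
  have h := congrArg (fun m => m.rmul y) hc
  rw [Mult.rmul_algebraMap] at h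
  exact h

variable [Nontrivial X]

theorem exists_φX : ∃ f : X →ₗ[k] k, ∀ y x, sliceR Q.φ (G.V (y ⊗ₜ x)) = f x • y := by
  obtain ⟨e, he⟩ := exists_ne (0 : X)
  obtain ⟨f, hf⟩ := exists_dual_eq_one (k := k) he
  refine ⟨f ∘ₗ sliceR Q.φ ∘ₗ appL G.V.toLinearMap e, fun y x => ?_⟩
  obtain ⟨c, hc⟩ := G.exists_sliceR_φ_V_eq x
  have : f (sliceR Q.φ (G.V (e ⊗ₜ x))) = c := by rw [hc, map_smul, hf, smul_eq_mul, mul_one]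
  rw [hc, ← this]
  rfl

/-- The functional `φ_X` with `(ι ⊗ φ)α(x) = φ_X(x) 1`. -/
def φX : X →ₗ[k] k := Classical.choose G.exists_φX

theorem sliceR_φ_V (y x : X) : sliceR Q.φ (G.V (y ⊗ₜ x)) = G.φX x • y :=
  Classical.choose_spec G.exists_φX y x

theorem sliceR_φ_galoisW (x y : X) : sliceR Q.φ (G.galoisW (x ⊗ₜ y)) = G.φX x • y := by
  apply mul_left_cancel_of_nondeg G.nondeg_right
  intro z
  rw [← sliceR_φ_V_central, sliceR_φ_V, smul_mul_assoc, mul_smul_comm]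

/-- Since (ι⊗φ)(V(z⊗x)α(y)) = φ_X(xy)z = 0 and V is onto, (ι⊗φ)((e⊗a)α(y)) = 0 for all a.
Faithfulness of φ then gives V(e⊗y) = 0. -/
theorem φX_faithful_right (y : X) (h : ∀ x, G.φX (x * y) = 0) : y = 0 := by
  obtain ⟨e, he⟩ := exists_ne (0 : X)
  refine tmul_left_cancel (k := k) he (G.V.injective ?_)
  rw [TensorProduct.tmul_zero, map_zero]
  refine sliceR_eq_zero (fun a => Q.φ ∘ₗ mulLeft k a) (fun b hb => Q.φ_faithful_right b hb) _
    fun a => ?_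
  rw [← sliceR_lTensor, ← α_rmul_V]
  obtain ⟨t, ht⟩ := G.V.surjective (e ⊗ₜ a)
  rw [← ht]
  clear ht
  induction t with
  | zero => simp
  | add s t hs ht => simp only [map_add, hs, ht, add_zero]
  | tmul z x => rw [← V_mul_right, sliceR_φ_V, h, zero_smul]

theorem φX_faithful_left (y : X) (h : ∀ x, G.φX (y * x) = 0) : y = 0 := by
  obtain ⟨e, he⟩ := exists_ne (0 : X)
  refine tmul_right_cancel (k := k) he (G.galoisW.injective ?_)
  rw [TensorProduct.zero_tmul, map_zero]
  refine sliceR_eq_zero (fun a => Q.φ ∘ₗ mulRight k a) (fun b hb => Q.φ_faithful_left b hb) _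
    fun a => ?_
  rw [← sliceR_lTensor, ← α_lmul_galoisW]
  obtain ⟨t, ht⟩ := G.galoisW.surjective (e ⊗ₜ a)
  rw [← ht]
  clear ht
  induction t with
  | zero => simp
  | add s t hs ht => simp only [map_add, hs, ht, add_zero]
  | tmul z x => rw [← galoisW_mul_left, sliceR_φ_galoisW, h, zero_smul]

theorem φX_ne_zero : G.φX ≠ 0 := by
  intro h
  obtain ⟨e, he⟩ := exists_ne (0 : X)
  exact he (G.φX_faithful_right e fun x => by simp [h])

/-- Coassociativity with φ on the middle leg: (ι⊗φ)α is φ_X, while (φ⊗ι)Δ is φ( · )δ. -/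
theorem sliceL_φX_T₁ (x : X) (b : A) :
    sliceL G.φX (G.T₁ (x ⊗ₜ b)) = G.φX x • (Q.δu : Mult k A).lmul b := by
  obtain ⟨y, hy⟩ := exists_ne (0 : X)
  apply tmul_left_cancel (k := k) hy
  have h := congrArg ((sliceR Q.φ).rTensor A) (G.legs y x b)
  rw [sliceR_rTensor_assoc_symm, ← LinearMap.lTensor_comp_apply,
    ← LinearMap.rTensor_comp_apply] at h
  have e1 : sliceR Q.φ ∘ₗ appL G.V.toLinearMap y = G.φX.smulRight y := by
    ext z
    exact G.sliceR_φ_V y z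
  have e2 : sliceL Q.φ ∘ₗ appR Q.TΔ2.toLinearMap b =
      Q.φ.smulRight ((Q.δu : Mult k A).lmul b) := by
    ext a
    exact Q.sliceL_φ_TΔ2 a b
  rw [e1, e2, lTensor_smulRight, rTensor_smulRight, LinearEquiv.coe_coe, sliceR_φ_V] at h
  rw [h, TensorProduct.smul_tmul]

theorem sliceL_φX_T₁' (t : X ⊗[k] A) :
    sliceL G.φX (G.T₁ t) = (Q.δu : Mult k A).lmul (sliceL G.φX t) := by
  induction t with
  | zero => simp
  | add s t hs ht => simp only [map_add, hs, ht]
  | tmul x b => rw [sliceL_φX_T₁, sliceL_tmul, map_smul]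

/-- `(φ_X ⊗ ι)(α(x)(y ⊗ 1)) = δ S((φ_X ⊗ ι)((x ⊗ 1)α(y)))`. -/
theorem sliceL_φX_galoisW (t : X ⊗[k] X) : sliceL G.φX (G.galoisW t) =
    (Q.δu : Mult k A).lmul (Q.antipode (sliceL G.φX (G.V t))) := by
  rw [galoisW_eq, sliceL_φX_T₁', sliceL_lTensor, LinearEquiv.coe_coe]

/-! ### Invariant functionals -/

/-- By coassociativity each functional x ↦ φ_X((ι⊗ψ)((y⊗1)α(x))) inherits invariance from ψ. They do
not all vanish, since V is onto and φ_X⊗ψ is non-zero. -/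
theorem exists_isInvariant : ∃ ψX : X →ₗ[k] k, G.IsInvariant ψX ∧ ψX ≠ 0 := by
  have hψ : ∀ y, G.IsInvariant (G.φX ∘ₗ sliceR Q.ψ ∘ₗ appL G.V.toLinearMap y) := by
    intro y x b
    have key : ∀ t : (X ⊗[k] A) ⊗[k] A, sliceL (G.φX ∘ₗ sliceR Q.ψ) t =
        sliceL G.φX ((sliceR Q.ψ).rTensor A t) := fun t => (sliceL_rTensor _ _ t).symm
    constructor
    · have e : sliceL Q.ψ ∘ₗ appR Q.TΔ2.toLinearMap b = Q.ψ.smulRight b := by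
        ext a
        exact Q.sliceL_ψ_TΔ2 a b
      rw [← LinearMap.comp_assoc, ← sliceL_rTensor, G.legs, key, sliceR_rTensor_assoc_symm,
        ← LinearMap.lTensor_comp_apply, e, lTensor_smulRight, sliceL_tmul]
      rfl
    · have e : sliceL Q.ψ ∘ₗ appL Q.T2Δ.toLinearMap b = Q.ψ.smulRight b := by
        ext a
        exact Q.sliceL_ψ_T2Δ b a
      rw [← LinearMap.comp_assoc, ← sliceL_rTensor, V_rTensor_T₂, key, sliceR_rTensor_assoc_symm,
        ← LinearMap.lTensor_comp_apply, e, lTensor_smulRight, sliceL_tmul]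
      rfl
  by_contra! H
  obtain ⟨x, hx⟩ := exists_eq_one_of_ne_zero G.φX_ne_zero
  obtain ⟨a, ha⟩ := exists_eq_one_of_ne_zero Q.ψ_ne_zero
  obtain ⟨t, ht⟩ := G.V.surjective (x ⊗ₜ a)
  have h0 : ∀ t, G.φX (sliceR Q.ψ (G.V t)) = 0 := by
    intro t
    induction t with
    | zero => simp
    | add s t hs ht => simp only [map_add, hs, ht, add_zero]
    | tmul z x => exact LinearMap.congr_fun (H _ (hψ z)) x
  have := h0 t
  rw [ht, sliceR_tmul, ha, one_smul, hx] at this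
  exact one_ne_zero this

end GaloisObject

/-! ### The multipliers (ι⊗f)α(x) and the modular element of X. -/

namespace GaloisObject

variable {k A X : Type*} [Field k]
  [NonUnitalRing A] [Module k A] [IsScalarTower k A A] [SMulCommClass k A A]
  [NonUnitalRing X] [Module k X] [IsScalarTower k X X] [SMulCommClass k X X]
  {Q : AlgebraicQuantumGroup k A} (G : GaloisObject Q X)

open AlgebraicQuantumGroup

/-- The multiplier `(ι ⊗ f)α(x)` of `X`. -/
def sliceMult (f : A →ₗ[k] k) (x : X) : Mult k X :=
  Mult.mk (sliceR f ∘ₗ appL G.galoisW.toLinearMap x) (sliceR f ∘ₗ appR G.V.toLinearMap x)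
    (fun y z => by
      have h := congrArg (sliceR f) (G.V_galoisW y x z)
      rw [sliceR_rTensor, sliceR_rTensor] at h
      exact h.symm)

theorem sliceMult_lmul (f : A →ₗ[k] k) (x y : X) :
    (G.sliceMult f x).lmul y = sliceR f (G.galoisW (x ⊗ₜ y)) := rfl

theorem sliceMult_rmul (f : A →ₗ[k] k) (x y : X) :
    (G.sliceMult f x).rmul y = sliceR f (G.V (y ⊗ₜ x)) := rfl

/-- Strong invariance for an invariant functional: unlike in `sliceL_φX_galoisW`, the map T₁ is
absorbed without a factor δ. This discrepancy is the source of α(δ_X) = δ_X⊗δ. -/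
theorem IsInvariant.sliceL_galoisW {G : GaloisObject Q X}
    {ψX : X →ₗ[k] k} (h : G.IsInvariant ψX) (t : X ⊗[k] X) :
    sliceL ψX (G.galoisW t) = Q.antipode (sliceL ψX (G.V t)) := by
  have h1 : ∀ t, sliceL ψX (G.T₁ t) = sliceL ψX t := by
    intro t
    induction t with
    | zero => simp
    | add s t hs ht => simp only [map_add, hs, ht]
    | tmul x b => rw [(h x b).1, sliceL_tmul]
  rw [galoisW_eq, h1, sliceL_lTensor, LinearEquiv.coe_coe]

theorem V_lTensor_mulRight (z : X) (t : X ⊗[k] X) :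
    G.V ((mulRight k z).lTensor X t) = (G.α z).rmul (G.V t) := by
  induction t with
  | zero => simp
  | add s t hs ht => simp only [map_add, hs, ht]
  | tmul x y => rw [LinearMap.lTensor_tmul, LinearMap.mulRight_apply, V_mul_right]

theorem galoisW_rTensor_mulLeft (z : X) (t : X ⊗[k] X) :
    G.galoisW ((mulLeft k z).rTensor X t) = (G.α z).lmul (G.galoisW t) := by
  induction t with
  | zero => simp
  | add s t hs ht => simp only [map_add, hs, ht]
  | tmul x y => rw [LinearMap.rTensor_tmul, LinearMap.mulLeft_apply, galoisW_mul_left]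

variable [Nontrivial X] {ψX : X →ₗ[k] k}

theorem ψX_sliceMult_rmul (h : G.IsInvariant ψX) (x y : X) :
    ψX ((G.sliceMult Q.ψ y).rmul x) = G.φX x * ψX y := by
  rw [sliceMult_rmul, slice_slice, ψ_apply, ← h.sliceL_galoisW, ← slice_slice, sliceR_φ_galoisW,
    map_smul, smul_eq_mul]

/-- Strong invariance supplies one S and ψ = φ∘S another; φ∘S² = τφ then produces the factor τ,
which is absent from `ψX_sliceMult_rmul`. -/
theorem ψX_sliceMult_lmul (h : G.IsInvariant ψX) (x y : X) :
    ψX ((G.sliceMult Q.ψ x).lmul y) = Q.scaling * G.φX y * ψX x := by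
  rw [sliceMult_lmul, slice_slice, h.sliceL_galoisW, ψ_apply, φ_antipode_antipode, ← slice_slice,
    sliceR_φ_V, map_smul, smul_eq_mul, mul_assoc]

theorem φX_sliceMult (x y : X) : G.φX ((G.sliceMult Q.ψ x).lmul y) =
    G.φX ((G.sliceMult (Q.ψ ∘ₗ (Q.δu : Mult k A).lmul ∘ₗ Q.antipode.toLinearMap) y).rmul x) := by
  rw [sliceMult_lmul, sliceMult_rmul, slice_slice, slice_slice, sliceL_φX_galoisW]
  rfl

theorem ψX_faithful_right (h : G.IsInvariant ψX) (h0 : ψX ≠ 0) (z : X)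
    (hz : ∀ x, ψX (x * z) = 0) : z = 0 := by
  have := G.nondeg
  obtain ⟨e, he⟩ := exists_eq_one_of_ne_zero h0
  apply G.φX_faithful_right
  intro y
  have h1 := G.ψX_sliceMult_lmul h e (y * z)
  rw [Mult.lmul_mul', hz, he, mul_one, eq_comm, mul_eq_zero] at h1
  exact h1.resolve_left Q.scaling_ne_zero

/-- There is an invertible multiplier `δ_X` with `φ_X(x δ_X) = ψ_X(x)`, and moreover
`ψ_X(δ_X⁻¹ x) = τ φ_X(x)`. -/
theorem exists_δX (h : G.IsInvariant ψX) (h0 : ψX ≠ 0) : ∃ d : (Mult k X)ˣ,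
    (∀ x, G.φX ((d : Mult k X).rmul x) = ψX x) ∧
    ∀ x, ψX (((d⁻¹ : (Mult k X)ˣ) : Mult k X).lmul x) = Q.scaling * G.φX x := by
  have := G.nondeg
  obtain ⟨w, hw⟩ := exists_eq_one_of_ne_zero h0
  -- This is the future δ_X⁻¹; the normalisation ψ_X(w) = 1 makes ψ_X(xn) = φ_X(x).
  let n : Mult k X := G.sliceMult Q.ψ w
  have hn1 : ∀ x, ψX (n.rmul x) = G.φX x := fun x => by
    rw [G.ψX_sliceMult_rmul h, hw, mul_one]
  have hn2 : ∀ x, ψX (n.lmul x) = Q.scaling * G.φX x := fun x => by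
    rw [G.ψX_sliceMult_lmul h, hw, mul_one]
  obtain ⟨y, hy⟩ : ∃ y, G.φX (n.rmul y) = 1 := by
    apply exists_eq_one_of_ne_zero (ω := G.φX ∘ₗ n.rmul)
    intro hc
    apply G.φX_ne_zero
    ext x
    rw [← hn1, G.φX_faithful_right (n.rmul x) fun y => by
      rw [← Mult.rmul_mul']; exact LinearMap.congr_fun hc (y * x)]
    simp
  -- With m = (ι⊗ψ)α(x), this choice makes φ_X(xd) = τ⁻¹φ_X(my) = τ⁻¹ψ_X(myn) = φ_X(yn)ψ_X(x) =
  -- ψ_X(x), by the normalisation φ_X(yn) = 1.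
  let d : Mult k X := Q.scaling⁻¹ •
    G.sliceMult (Q.ψ ∘ₗ (Q.δu : Mult k A).lmul ∘ₗ Q.antipode.toLinearMap) y
  have hd : ∀ x, G.φX (d.rmul x) = ψX x := by
    intro x
    rw [Mult.rmul_smul, map_smul, ← φX_sliceMult, ← hn1, Mult.rmul_lmul_comm,
      G.ψX_sliceMult_lmul h, hy, mul_one, smul_eq_mul, inv_mul_cancel_left₀ Q.scaling_ne_zero]
  refine ⟨⟨d, n, ?_, ?_⟩, hd, hn2⟩
  · apply Mult.ext_of_rmul G.nondeg_right
    intro y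
    apply faithful_right_ext (G.ψX_faithful_right h h0)
    intro x
    rw [← Mult.rmul_mul', Mult.rmul_mul, hn1, hd, Mult.rmul_one]
  · apply Mult.ext_of_rmul G.nondeg_right
    intro y
    apply faithful_right_ext G.φX_faithful_right
    intro x
    rw [← Mult.rmul_mul', Mult.rmul_mul, hd, hn1, Mult.rmul_one]

/-! ### The modular automorphism of `φ_X` -/

theorem sliceR_φX (t : X ⊗[k] X) : sliceR G.φX t = sliceR Q.φ (G.V t) := by
  induction t with
  | zero => simp
  | add s t hs ht => simp only [map_add, hs, ht]
  | tmul x y => rw [sliceR_tmul, sliceR_φ_V]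

theorem sliceL_φX (t : X ⊗[k] X) : sliceL G.φX t = sliceR Q.φ (G.galoisW t) := by
  induction t with
  | zero => simp
  | add s t hs ht => simp only [map_add, hs, ht]
  | tmul x y => rw [sliceL_tmul, sliceR_φ_galoisW]

/-- With `V⁻¹(p ⊗ b) = ∑ y ⊗ z` and `W⁻¹(w ⊗ σ(b)) = ∑ u ⊗ v`, this says that
`∑ φ_X(z x) y w = ∑ φ_X(x u) p v`. -/
theorem sliceR_φX_V_symm (p w x : X) (b : A) :
    sliceR (G.φX ∘ₗ mulRight k x) (G.V.symm (p ⊗ₜ b)) * w =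
      p * sliceL (G.φX ∘ₗ mulLeft k x) (G.galoisW.symm (w ⊗ₜ Q.σ b)) := by
  have e : Q.φ ∘ₗ mulRight k (Q.σ b) = Q.φ ∘ₗ mulLeft k b := by
    ext x; simp [Q.φ_mul b x]
  rw [← sliceR_lTensor, sliceR_φX, V_lTensor_mulRight, LinearEquiv.apply_symm_apply, α_rmul_V,
    ← sliceL_rTensor, sliceL_φX, galoisW_rTensor_mulLeft, LinearEquiv.apply_symm_apply,
    α_lmul_galoisW, sliceR_lTensor, sliceR_lTensor, e]
  have h := congrArg (sliceR (Q.φ ∘ₗ mulLeft k b)) (G.V_galoisW p x w)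
  rw [sliceR_rTensor, sliceR_rTensor] at h
  exact h

theorem φX_mul_slice (f : X →ₗ[k] k) (p w x : X) (b : A) :
    G.φX (sliceL (f ∘ₗ mulRight k w) (G.V.symm (p ⊗ₜ b)) * x) =
      G.φX (x * sliceR (f ∘ₗ mulLeft k p) (G.galoisW.symm (w ⊗ₜ Q.σ b))) := by
  have h := congrArg f (G.sliceR_φX_V_symm p w x b)
  exact (slice_slice (f ∘ₗ mulRight k w) (G.φX ∘ₗ mulRight k x) _).symm.trans
    (h.trans (slice_slice (G.φX ∘ₗ mulLeft k x) (f ∘ₗ mulLeft k p) _).symm)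

theorem exists_dual_mul_eq_one (G : GaloisObject Q X) : ∃ (f : X →ₗ[k] k) (y w : X), f (y * w) = 1 := by
  obtain ⟨y, hy⟩ := exists_ne (0 : X)
  obtain ⟨w, hw⟩ : ∃ w, y * w ≠ 0 := by
    by_contra! H
    exact hy (G.nondeg_left y H)
  obtain ⟨f, hf⟩ := exists_dual_eq_one (k := k) hw
  exact ⟨f, y, w, hf⟩

/-- Every a is a sum of slices of elements V⁻¹(p⊗b), because V⁻¹V(y⊗a) = y⊗a, and likewise with W.
On such slices `φX_mul_slice` exchanges φ_X(a ·) with a functional φ_X(· c), in both directions. -/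
theorem exists_σX : ∃ σ : AlgAut k X, ∀ a b, G.φX (a * b) = G.φX (b * σ a) := by
  obtain ⟨f, y, w, hf⟩ := G.exists_dual_mul_eq_one
  apply exists_modular _ G.φX_faithful_left G.φX_faithful_right
  · intro a
    have ha : a = sliceL (f ∘ₗ mulRight k w) (G.V.symm (G.V (y ⊗ₜ a))) := by simp [hf]
    rw [ha]
    generalize G.V (y ⊗ₜ a) = t
    induction t with
    | zero => exact ⟨0, fun x => by simp⟩
    | add s t hs ht =>
      obtain ⟨b, hb⟩ := hs
      obtain ⟨c, hc⟩ := ht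
      exact ⟨b + c, fun x => by simp only [map_add, add_mul, mul_add, hb, hc]⟩
    | tmul p b => exact ⟨_, fun x => G.φX_mul_slice f p w x b⟩
  · intro a
    have ha : a = sliceR (f ∘ₗ mulLeft k y) (G.galoisW.symm (G.galoisW (a ⊗ₜ w))) := by simp [hf]
    rw [ha]
    generalize G.galoisW (a ⊗ₜ w) = t
    induction t with
    | zero => exact ⟨0, fun x => by simp⟩
    | add s t hs ht =>
      obtain ⟨b, hb⟩ := hs
      obtain ⟨c, hc⟩ := ht
      exact ⟨b + c, fun x => by simp only [map_add, add_mul, mul_add, hb, hc]⟩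
    | tmul p b =>
      obtain ⟨b, rfl⟩ := Q.σ.toLinearEquiv.surjective b
      exact ⟨_, fun x => G.φX_mul_slice f y p x b⟩

/-- The modular automorphism of `φ_X`. -/
def σX : AlgAut k X := Classical.choose G.exists_σX

theorem φX_mul (x y : X) : G.φX (x * y) = G.φX (y * G.σX x) :=
  Classical.choose_spec G.exists_σX x y

theorem σX_lTensor_V_symm (p w : X) (b : A) :
    G.σX.toLinearEquiv.toLinearMap.lTensor X ((mulRight k w).rTensor X (G.V.symm (p ⊗ₜ b))) =
      TensorProduct.comm k X X ((mulLeft k p).lTensor X (G.galoisW.symm (w ⊗ₜ Q.σ b))) := by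
  rw [← sub_eq_zero]
  refine sliceR_eq_zero (fun x => G.φX ∘ₗ mulLeft k x) (fun b hb => G.φX_faithful_right b hb) _
    fun x => ?_
  have e : (G.φX ∘ₗ mulLeft k x) ∘ₗ G.σX.toLinearEquiv.toLinearMap = G.φX ∘ₗ mulRight k x := by
    ext y; simp [G.φX_mul y x]
  rw [map_sub, sub_eq_zero, sliceR_lTensor, sliceR_rTensor, sliceR_comm, sliceL_lTensor, e]
  exact G.sliceR_φX_V_symm p w x b

/-- The hypotheses give φ_X(dz) = τ⁻¹φ_X(zd), just as for δ on A. -/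
theorem σX_rmul {d : (Mult k X)ˣ} (h1 : ∀ x, G.φX ((d : Mult k X).rmul x) = ψX x)
    (h2 : ∀ x, ψX (((d⁻¹ : (Mult k X)ˣ) : Mult k X).lmul x) = Q.scaling * G.φX x) (x : X) :
    G.σX ((d : Mult k X).rmul x) = Q.scaling⁻¹ • (d : Mult k X).rmul (G.σX x) := by
  have := G.nondeg
  apply faithful_right_ext G.φX_faithful_right
  intro y
  have h := h2 ((d : Mult k X).lmul (y * G.σX x))
  rw [Mult.inv_lmul_lmul, ← h1, Mult.rmul_mul'] at h
  rw [← φX_mul, ← Mult.central, φX_mul, ← Mult.lmul_mul', mul_smul_comm, map_smul, h, smul_eq_mul,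
    inv_mul_cancel_left₀ Q.scaling_ne_zero]

/-! ### The coaction on the modular data -/

/-- Let u be the slice of V(zy⊗x) by ψ_X and v that of V(zy⊗xd) by φ_X. The slice of W(zy⊗xd) by φ_X
equals S(u) by strong invariance of ψ_X and δS(v) by that of φ_X. As δ⁻¹S(u) = S(uδ), this gives v =
uδ. -/
theorem V_rmul (h : G.IsInvariant ψX) {d : (Mult k X)ˣ}
    (h1 : ∀ x, G.φX ((d : Mult k X).rmul x) = ψX x) (y x : X) :
    G.V (y ⊗ₜ (d : Mult k X).rmul x) =
      (Mult.tmul (d : Mult k X) (Q.δu : Mult k A)).rmul (G.V (y ⊗ₜ x)) := by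
  have := G.nondeg
  change _ = TensorProduct.map _ _ _
  rw [← sub_eq_zero]
  refine sliceL_eq_zero (fun z => G.φX ∘ₗ mulLeft k z) (fun b hb => G.φX_faithful_right b hb) _
    fun z => ?_
  have e : (G.φX ∘ₗ mulLeft k z) ∘ₗ (d : Mult k X).rmul = ψX ∘ₗ mulLeft k z := by
    ext u; simp [← Mult.rmul_mul', h1]
  have hW : G.galoisW ((z * y) ⊗ₜ (d : Mult k X).rmul x) =
      (d : Mult k X).rmul.rTensor A (G.galoisW ((z * y) ⊗ₜ x)) := G.galoisW_rmul _ _ _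
  have h3 := G.sliceL_φX_galoisW ((z * y) ⊗ₜ (d : Mult k X).rmul x)
  have e2 : G.φX ∘ₗ (d : Mult k X).rmul = ψX := LinearMap.ext h1
  rw [hW, sliceL_rTensor, e2, h.sliceL_galoisW, V_mul_left, V_mul_left, sliceL_rTensor,
    sliceL_rTensor] at h3
  rw [map_sub, sub_eq_zero, map_eq_lTensor_rTensor, sliceL_lTensor, sliceL_rTensor, e]
  have h4 := congrArg (fun u => Q.antipode.symm (((Q.δu⁻¹ : (Mult k A)ˣ) : Mult k A).lmul u)) h3
  simp only [Mult.inv_lmul_lmul, LinearEquiv.symm_apply_apply] at h4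
  rw [← h4, δu_inv_lmul_antipode, LinearEquiv.symm_apply_apply]

end GaloisObject

/-! ### Equivariance of σ_X and θ_X. -/

namespace GaloisObject

variable {k A X : Type*} [Field k]
  [NonUnitalRing A] [Module k A] [IsScalarTower k A A] [SMulCommClass k A A]
  [NonUnitalRing X] [Module k X] [IsScalarTower k X X] [SMulCommClass k X X]
  {Q : AlgebraicQuantumGroup k A} (G : GaloisObject Q X)

open AlgebraicQuantumGroup

theorem α_eq_onMult {s u : AlgAut k X} {t : AlgAut k A}
    (h : ∀ y x, G.V (s y ⊗ₜ u x) = TensorProduct.map s.toLinearEquiv.toLinearMap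
      t.toLinearEquiv.toLinearMap (G.V (y ⊗ₜ x))) (x : X) :
    G.α (u x) = (s.tensor t).onMult (G.α x) := by
  have := Q.nondeg; have := G.nondeg
  apply Mult.ext_of_rmul Nondeg.right
  intro w
  obtain ⟨w, rfl⟩ := (s.tensor t).toLinearEquiv.surjective w
  change _ = (s.tensor t).toLinearEquiv ((G.α x).rmul ((s.tensor t).toLinearEquiv.symm _))
  rw [LinearEquiv.symm_apply_apply]
  induction w with
  | zero => simp
  | add v w hv hw => simp only [map_add, hv, hw]
  | tmul y b =>
    change (G.α (u x)).rmul (s y ⊗ₜ t b) = TensorProduct.map s.toLinearEquiv.toLinearMap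
      t.toLinearEquiv.toLinearMap _
    rw [α_rmul_V, α_rmul_V, h]
    generalize G.V (y ⊗ₜ x) = v
    induction v with
    | zero => simp
    | add v w hv hw => simp only [map_add, hv, hw]
    | tmul p a => simp [AlgAut.map_mul]

theorem charAct_rTensor_V (y x : X) :
    G.charAct.toLinearEquiv.toLinearMap.rTensor A (G.V (y ⊗ₜ x)) =
      Q.charLeft.toLinearEquiv.toLinearMap.lTensor X (G.V (G.charAct y ⊗ₜ x)) := by
  apply lTensor_mulRight_cancel Q.nondeg_left
  intro b
  obtain ⟨b, rfl⟩ := Q.charLeft.toLinearEquiv.surjective b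
  have e1 : mulRight k (Q.charLeft b) ∘ₗ Q.charLeft.toLinearEquiv.toLinearMap =
      Q.charLeft.toLinearEquiv.toLinearMap ∘ₗ mulRight k b := by
    ext a; simp [AlgAut.map_mul]
  have e2 : mulLeft k (G.charAct y) ∘ₗ G.charAct.toLinearEquiv.toLinearMap =
      G.charAct.toLinearEquiv.toLinearMap ∘ₗ mulLeft k y := by
    ext a; simp [AlgAut.map_mul]
  rw [← LinearMap.lTensor_comp_apply, e1, LinearMap.lTensor_comp_apply, V_T₁, lTensor_rTensor,
    V_T₁, lTensor_rTensor, ← charAct_rTensor_T₁, ← LinearMap.rTensor_comp_apply,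
    ← LinearMap.rTensor_comp_apply, e2]

variable [Nontrivial X] {ψX : X →ₗ[k] k}

theorem sliceL_φX_galoisW_σX (y x : X) :
    sliceL G.φX (G.galoisW (y ⊗ₜ G.σX x)) = sliceL G.φX (G.V (x ⊗ₜ y)) := by
  apply mul_right_cancel_of_nondeg Q.nondeg_left
  intro a
  have e : G.φX ∘ₗ mulRight k (G.σX x) = G.φX ∘ₗ mulLeft k x := by
    ext z; simp [G.φX_mul x z]
  have h1 := congrArg (sliceL G.φX) (G.α_lmul_galoisW y (G.σX x) a)
  have h2 := congrArg (sliceL G.φX) (G.V_T₁ x y a)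
  rw [α_lmul_T₁, sliceL_rTensor, sliceL_lTensor, e] at h1
  rw [sliceL_rTensor, sliceL_lTensor] at h2
  exact h1.symm.trans h2.symm

/-- With a the slice on the right and v the one on the left, strong invariance used twice gives a =
δS(δS(v)), hence aδ = δS²(v). But δS²(σν(a)) = aδ as well, so v = σν(a). -/
theorem sliceL_φX_V_σX (y x : X) : sliceL G.φX (G.V (y ⊗ₜ G.σX x)) =
    Q.σ (Q.charLeft (sliceL G.φX (G.galoisW (x ⊗ₜ y)))) := by
  have := Q.nondeg
  have h := Q.δu_lmul_antipodeSq_σ_charLeft (sliceL G.φX (G.galoisW (x ⊗ₜ y)))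
  rw [G.sliceL_φX_galoisW (x ⊗ₜ y), ← sliceL_φX_galoisW_σX, sliceL_φX_galoisW,
    Mult.rmul_lmul_comm, δu_rmul_antipode_δu_lmul] at h
  have h' := congrArg ((Q.δu⁻¹ : (Mult k A)ˣ) : Mult k A).lmul h
  rw [Mult.inv_lmul_lmul, Mult.inv_lmul_lmul, ← antipodeSq_apply] at h'
  rw [G.sliceL_φX_galoisW (x ⊗ₜ y), ← G.sliceL_φX_galoisW_σX y x, sliceL_φX_galoisW]
  exact (Q.antipodeSq.toLinearEquiv.injective h').symm

/-- Pair the first leg with φ_X(z ·): the modular property moves each factor σ_X to the other side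
of the functional, which leaves `sliceL_φX_V_σX`. -/
theorem V_σX (y x : X) : G.V (G.σX y ⊗ₜ G.σX x) = TensorProduct.map
    G.σX.toLinearEquiv.toLinearMap (Q.charLeft.trans Q.σ).toLinearEquiv.toLinearMap
      (G.V (y ⊗ₜ x)) := by
  rw [← sub_eq_zero]
  refine sliceL_eq_zero (fun z => G.φX ∘ₗ mulLeft k z) (fun b hb => G.φX_faithful_right b hb) _
    fun z => ?_
  have e : (G.φX ∘ₗ mulLeft k z) ∘ₗ G.σX.toLinearEquiv.toLinearMap = G.φX ∘ₗ mulRight k z := by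
    ext u; simp [G.φX_mul u z]
  have e' : G.φX ∘ₗ mulRight k (G.σX y) = G.φX ∘ₗ mulLeft k y := by
    ext u; simp [G.φX_mul y u]
  rw [map_sub, sub_eq_zero, map_eq_lTensor_rTensor, sliceL_lTensor, sliceL_rTensor, e,
    ← sliceL_rTensor, ← V_mul_left, sliceL_φX_V_σX, galoisW_mul_right, sliceL_rTensor, e',
    ← sliceL_rTensor, ← V_galoisW, sliceL_rTensor]
  rfl

/-- The automorphism `θ_X = σ_X(δ̂ · –)`. -/
def θX : AlgAut k X := G.charAct.trans G.σX

theorem V_θX_σX (y x : X) : G.V (G.θX y ⊗ₜ G.σX x) = TensorProduct.map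
    G.θX.toLinearEquiv.toLinearMap Q.σ.toLinearEquiv.toLinearMap (G.V (y ⊗ₜ x)) := by
  have h := G.charAct_rTensor_V y x
  change G.V (G.σX (G.charAct y) ⊗ₜ G.σX x) = TensorProduct.map
    (G.σX.toLinearEquiv.toLinearMap ∘ₗ G.charAct.toLinearEquiv.toLinearMap) _ _
  rw [V_σX, map_eq_lTensor_rTensor, map_eq_lTensor_rTensor, LinearMap.rTensor_comp_apply, h,
    lTensor_rTensor, lTensor_rTensor, ← LinearMap.lTensor_comp_apply]
  rfl

theorem V_σX_θX (y x : X) : G.V (G.σX y ⊗ₜ G.θX x) = TensorProduct.map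
    G.σX.toLinearEquiv.toLinearMap Q.σ'.symm.toLinearEquiv.toLinearMap (G.V (y ⊗ₜ x)) := by
  have e : (Q.charLeft.trans Q.σ).toLinearEquiv.toLinearMap ∘ₗ
      Q.charRight.toLinearEquiv.toLinearMap = Q.σ'.symm.toLinearEquiv.toLinearMap := by
    ext a
    simpa using (Q.σ_charLeft_charRight a).trans (Q.antipodeSq_charLeft a)
  change G.V (G.σX y ⊗ₜ G.σX (G.charAct x)) = _
  rw [V_σX, V_charAct, map_eq_lTensor_rTensor, map_eq_lTensor_rTensor, ← lTensor_rTensor,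
    ← LinearMap.lTensor_comp_apply, e]

theorem V_θX_θX (y x : X) : G.V (G.θX y ⊗ₜ G.θX x) = TensorProduct.map
    G.θX.toLinearEquiv.toLinearMap Q.antipodeSq.toLinearEquiv.toLinearMap (G.V (y ⊗ₜ x)) := by
  have h := G.charAct_rTensor_V y x
  have e : Q.σ'.symm.toLinearEquiv.toLinearMap =
      Q.antipodeSq.toLinearEquiv.toLinearMap ∘ₗ Q.charLeft.toLinearEquiv.toLinearMap := by
    ext a
    exact (Q.antipodeSq_charLeft a).symm
  change G.V (G.σX (G.charAct y) ⊗ₜ G.θX x) = TensorProduct.map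
    (G.σX.toLinearEquiv.toLinearMap ∘ₗ G.charAct.toLinearEquiv.toLinearMap) _ _
  rw [V_σX_θX, map_eq_lTensor_rTensor, map_eq_lTensor_rTensor, LinearMap.rTensor_comp_apply, h,
    lTensor_rTensor, lTensor_rTensor, e, LinearMap.lTensor_comp_apply]

theorem φX_θX (x : X) : G.φX (G.θX x) = Q.scaling * G.φX x := by
  obtain ⟨y, hy⟩ := exists_ne (0 : X)
  have h := congrArg (sliceR Q.φ) (G.V_θX_θX y x)
  have e : Q.φ ∘ₗ Q.antipodeSq.toLinearEquiv.toLinearMap = Q.scaling • Q.φ :=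
    LinearMap.ext Q.φ_antipodeSq
  rw [map_eq_lTensor_rTensor, sliceR_lTensor, sliceR_rTensor, e, sliceR_smul, sliceR_φ_V,
    sliceR_φ_V, map_smul, map_smul, LinearEquiv.coe_coe, smul_smul] at h
  exact smul_left_injective k ((LinearEquiv.map_ne_zero_iff _).2 hy) h

theorem σX_θX (x : X) : G.σX (G.θX x) = G.θX (G.σX x) := by
  apply faithful_right_ext G.φX_faithful_right
  intro y
  obtain ⟨y, rfl⟩ := G.θX.toLinearEquiv.surjective y
  rw [← φX_mul, ← AlgAut.map_mul, ← AlgAut.map_mul, φX_θX, φX_θX, φX_mul]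

theorem θX_rmul (h : G.IsInvariant ψX) {d : (Mult k X)ˣ}
    (h1 : ∀ x, G.φX ((d : Mult k X).rmul x) = ψX x)
    (h2 : ∀ x, ψX (((d⁻¹ : (Mult k X)ˣ) : Mult k X).lmul x) = Q.scaling * G.φX x) (x : X) :
    G.θX ((d : Mult k X).rmul x) = (d : Mult k X).rmul (G.θX x) := by
  have := G.nondeg
  -- Since α(δ_X) = δ_X⊗δ and χ(δ) = τ, this is γ(δ_X) = τδ_X; the factor cancels the τ⁻¹ coming
  -- from σ_X.
  have h3 : G.charAct ((d : Mult k X).rmul x) = Q.scaling • (d : Mult k X).rmul (G.charAct x) := by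
    apply mul_left_cancel_of_nondeg G.nondeg_right
    intro y
    have e : Q.χ ∘ₗ (Q.δu : Mult k A).rmul = Q.scaling • Q.χ := LinearMap.ext Q.χ_δu_rmul
    rw [mul_charAct, G.V_rmul h h1]
    change sliceR Q.χ (TensorProduct.map _ _ _) = _
    rw [map_eq_lTensor_rTensor, sliceR_lTensor, sliceR_rTensor, e, sliceR_smul, map_smul,
      ← mul_charAct, Mult.rmul_mul', mul_smul_comm]
  change G.σX (G.charAct _) = (d : Mult k X).rmul (G.σX (G.charAct x))
  rw [h3, map_smul, G.σX_rmul h1 h2, smul_smul, mul_inv_cancel₀ Q.scaling_ne_zero, one_smul]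

end GaloisObject

/-! ### Uniqueness of the structure maps of `A` -/

theorem AlgAut.ext' {k A : Type*} [Field k] [NonUnitalNonAssocRing A] [Module k A]
    {s t : AlgAut k A} (h : ∀ a, s a = t a) : s = t := by
  cases s
  cases t
  congr 1
  exact LinearEquiv.ext h

namespace AlgebraicQuantumGroup

namespace StructureMaps

variable {k A : Type*} [Field k] [NonUnitalRing A] [Module k A]
  [IsScalarTower k A A] [SMulCommClass k A A] {Q : AlgebraicQuantumGroup k A}
  (D : Q.StructureMaps)

theorem ε_eq : D.ε = Q.counit := by
  ext a
  obtain ⟨b, hb⟩ := Q.exists_ne_zero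
  have h : ∀ t, sliceL D.ε (Q.TΔ2 t) = sliceL Q.counit (Q.TΔ2 t) := by
    intro t
    induction t with
    | zero => simp
    | add s t hs ht => simp only [map_add, hs, ht]
    | tmul p q => rw [D.counit_left, sliceL_counit_TΔ2]
  have h' := h (Q.TΔ2.symm (a ⊗ₜ b))
  rw [LinearEquiv.apply_symm_apply, sliceL_tmul, sliceL_tmul] at h'
  exact smul_left_injective k hb h'

theorem S_eq : D.S = Q.antipode := by
  ext a
  apply mul_right_cancel_of_nondeg Q.nondeg_left
  intro b
  have h : ∀ t, LinearMap.mul' k A (TensorProduct.map D.S.toLinearMap LinearMap.id (Q.TΔ2 t)) =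
      LinearMap.mul' k A (Q.antipode.toLinearMap.rTensor A (Q.TΔ2 t)) := by
    intro t
    induction t with
    | zero => simp
    | add s t hs ht => simp only [map_add, hs, ht]
    | tmul p q => rw [D.antipode_left, mul'_antipode_TΔ2, ε_eq]
  simpa using h (Q.TΔ2.symm (a ⊗ₜ b))

theorem σ_eq : D.σ = Q.σ := by
  refine AlgAut.ext' fun a => faithful_right_ext Q.φ_faithful_right fun x => ?_
  rw [← D.φ_mul, ← Q.φ_mul]

theorem σ'_eq : D.σ' = Q.σ' := by
  refine AlgAut.ext' fun a => faithful_right_ext Q.ψ_faithful_right fun x => ?_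
  have h := D.ψ_mul a x
  rw [S_eq] at h
  rw [← Q.ψ_mul]
  exact h.symm

theorem S2_eq : D.S2 = Q.antipodeSq := by
  refine AlgAut.ext' fun a => ?_
  change D.S (D.S a) = Q.antipode (Q.antipode a)
  rw [S_eq]

theorem δ_eq : D.δ = (Q.δu : Mult k A) := by
  obtain ⟨e, he⟩ := exists_eq_one_of_ne_zero Q.φ_ne_zero
  apply Mult.ext_of_lmul Q.nondeg_left
  intro b
  have h := D.δ_left e b
  rw [sliceL_φ_TΔ2, he, one_smul, one_smul] at h
  exact h.symm

theorem τ_eq : D.τ = Q.scaling := by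
  obtain ⟨e, he⟩ := exists_eq_one_of_ne_zero Q.φ_ne_zero
  have h := D.φ_S_S e
  rw [S_eq, φ_antipode_antipode, he, mul_one, mul_one] at h
  exact h.symm

theorem φhat_eq : D.φhat = Q.dualφ := by
  ext ω
  obtain ⟨b, rfl⟩ := Q.hat_surjective ω
  -- The functionals ψ(a ·) = φ(· σ'(a)δ) exhaust the dual, so the values prescribed on them
  -- determine the invariant functional.
  obtain ⟨a, rfl⟩ : ∃ a, (Q.δu : Mult k A).rmul (Q.σ' a) = b := by
    obtain ⟨a, ha⟩ := Q.σ'.toLinearEquiv.surjective (((Q.δu⁻¹ : (Mult k A)ˣ) : Mult k A).rmul b)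
    exact ⟨a, by rw [ha, Mult.rmul_inv_rmul]⟩
  obtain ⟨ω, h1, h2⟩ := D.φhat_spec a
  have h : ω = Q.hat ((Q.δu : Mult k A).rmul (Q.σ' a)) := by
    apply Dual.ext
    intro x
    rw [h1, ev_hat, φ_mul_δu_rmul, ← Q.ψ_mul, S_eq]
    rfl
  rw [← h, h2, ε_eq, h, dualφ_hat, χ_δu_rmul, inv_mul_cancel_left₀ Q.scaling_ne_zero, χ_σ']

theorem pair_ev_separating {t t' : Q.Dual ⊗[k] Q.Dual}
    (h : ∀ x y, pair (Q.ev x) (Q.ev y) t = pair (Q.ev x) (Q.ev y) t') : t = t' := by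
  rw [← sub_eq_zero]
  have sep : ∀ ω : Q.Dual, (∀ x, Q.ev x ω = 0) → ω = 0 := fun ω hω => Dual.ext Q fun x => by
    rw [hω, map_zero]
  refine sliceR_eq_zero (fun y => Q.ev y) sep _ fun y => sep _ fun x => ?_
  rw [← pair_eq_sliceR, map_sub, h, sub_self]

theorem δhat_lmul (b : A) :
    D.δhat.lmul (Q.hat b) = Q.hat (Q.charLeft.toLinearEquiv.symm b) := by
  -- For this c the invariant functional of the dual takes the value τ⁻¹ ≠ 0 at φ(· c), which can be
  -- divided out.
  obtain ⟨c, hc⟩ := Q.exists_χ_eq_one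
  obtain ⟨t, ht, ht'⟩ := D.δhat_left (Q.hat c) b
  obtain ⟨s, hs, hs'⟩ := Q.dualModular_left (Q.hat c) b
  rw [φhat_eq, pair_ev_separating fun x y => (ht x y).trans (hs x y).symm, hs', dualφ_hat, hc,
    mul_one] at ht'
  rw [← dualModular_lmul]
  exact (smul_right_injective _ (inv_ne_zero Q.scaling_ne_zero) ht').symm

end StructureMaps

end AlgebraicQuantumGroup

namespace GaloisObject

variable {k A X : Type*} [Field k]
  [NonUnitalRing A] [Module k A] [IsScalarTower k A A] [SMulCommClass k A A]
  [NonUnitalRing X] [Module k X] [IsScalarTower k X X] [SMulCommClass k X X]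
  {Q : AlgebraicQuantumGroup k A} (G : GaloisObject Q X)

open AlgebraicQuantumGroup

/-! ### The map `β` -/

theorem galoisW_symm_antipode (y : X) (a : A) :
    G.galoisW.symm (y ⊗ₜ Q.antipode a) = G.V.symm (G.T₂ (y ⊗ₜ a)) := by
  rw [LinearEquiv.symm_apply_eq, galoisW_eq, LinearEquiv.apply_symm_apply, T₁_antipode_T₂]

theorem V_rTensor_mulLeft (x : X) (t : X ⊗[k] X) :
    G.V ((mulLeft k x).rTensor X t) = (mulLeft k x).rTensor A (G.V t) := by
  induction t with
  | zero => simp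
  | add s t hs ht => simp only [map_add, hs, ht]
  | tmul p q => rw [LinearMap.rTensor_tmul, LinearMap.mulLeft_apply, V_mul_left]

/-- Compatibility of the two formulas that define β(a): both sides are to be (x⊗1)β(a)(1⊗y). -/
theorem rTensor_mulLeft_galoisW_symm (x y : X) (a : A) :
    (mulLeft k x).rTensor X (G.galoisW.symm (y ⊗ₜ Q.antipode a)) =
      (mulRight k y).lTensor X (G.V.symm (x ⊗ₜ a)) := by
  apply G.V.injective
  rw [galoisW_symm_antipode, V_rTensor_mulLeft, LinearEquiv.apply_symm_apply, V_lTensor_mulRight,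
    LinearEquiv.apply_symm_apply, α_rmul_T₂]

theorem V_symm_mul_left (x y : X) (a : A) :
    G.V.symm ((x * y) ⊗ₜ a) = (mulLeft k x).rTensor X (G.V.symm (y ⊗ₜ a)) := by
  rw [LinearEquiv.symm_apply_eq, V_rTensor_mulLeft, LinearEquiv.apply_symm_apply,
    LinearMap.rTensor_tmul, LinearMap.mulLeft_apply]

/-- `x ⊗ y ↦ β(a)(x ⊗ y)`. -/
def βl (a : A) : X ⊗[k] X →ₗ[k] X ⊗[k] X :=
  TensorProduct.lift (LinearMap.mk₂ k
    (fun x y => (mulRight k x).rTensor X (G.galoisW.symm (y ⊗ₜ Q.antipode a)))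
    (fun x x' y => by
      rw [show mulRight k (x + x') = mulRight k x + mulRight k x' by ext; simp [mul_add],
        LinearMap.rTensor_add, LinearMap.add_apply])
    (fun c x y => by
      rw [show mulRight k (c • x) = c • mulRight k x by ext; simp [mul_smul_comm],
        LinearMap.rTensor_smul, LinearMap.smul_apply])
    (fun x y y' => by rw [TensorProduct.add_tmul, map_add, map_add])
    (fun c x y => by rw [← TensorProduct.smul_tmul', map_smul, map_smul]))

/-- `x ⊗ y ↦ (x ⊗ y)β(a)`. -/
def βr (a : A) : X ⊗[k] X →ₗ[k] X ⊗[k] X :=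
  TensorProduct.lift (LinearMap.mk₂ k
    (fun x y => (mulLeft k y).lTensor X (G.V.symm (x ⊗ₜ a)))
    (fun x x' y => by rw [TensorProduct.add_tmul, map_add, map_add])
    (fun c x y => by rw [← TensorProduct.smul_tmul', map_smul, map_smul])
    (fun x y y' => by
      rw [show mulLeft k (y + y') = mulLeft k y + mulLeft k y' by ext; simp [add_mul],
        LinearMap.lTensor_add, LinearMap.add_apply])
    (fun c x y => by
      rw [show mulLeft k (c • y) = c • mulLeft k y by ext; simp [smul_mul_assoc],
        LinearMap.lTensor_smul, LinearMap.smul_apply]))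

theorem βl_tmul (a : A) (x y : X) : G.βl a (x ⊗ₜ y) =
    (mulRight k x).rTensor X (G.galoisW.symm (y ⊗ₜ Q.antipode a)) := rfl

theorem βr_tmul (a : A) (x y : X) :
    G.βr a (x ⊗ₜ y) = (mulLeft k y).lTensor X (G.V.symm (x ⊗ₜ a)) := rfl

theorem βl_βr (a : A) (s t : X ⊗[k] X) : s * G.βl a t = G.βr a s * t := by
  induction s with
  | zero => simp
  | add s s' hs hs' => simp only [map_add, add_mul, hs, hs']
  | tmul x y =>
    induction t with
    | zero => simp
    | add t t' ht ht' => simp only [map_add, mul_add, ht, ht']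
    | tmul p q =>
      have h := G.rTensor_mulLeft_galoisW_symm x q a
      have key := congrArg (fun u => (mulLeft k y).lTensor X ((mulRight k p).rTensor X u)) h
      have e1 : ∀ u : X ⊗[k] X, (x ⊗ₜ y) * (mulRight k p).rTensor X u =
          (mulLeft k y).lTensor X ((mulRight k p).rTensor X ((mulLeft k x).rTensor X u)) := by
        intro u
        induction u with
        | zero => simp
        | add s s' hs hs' => simp only [map_add, mul_add, hs, hs']
        | tmul u v => simp [mul_assoc]
      have e2 : ∀ u : X ⊗[k] X, (mulLeft k y).lTensor X u * (p ⊗ₜ q) =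
          (mulLeft k y).lTensor X ((mulRight k p).rTensor X ((mulRight k q).lTensor X u)) := by
        intro u
        induction u with
        | zero => simp
        | add s s' hs hs' => simp only [map_add, add_mul, hs, hs']
        | tmul u v => simp [mul_assoc]
      rw [βl_tmul, βr_tmul, e1, e2]
      exact key

/-- The map `β : A → M(X ⊗ X)`. -/
def β : A →ₗ[k] Mult k (X ⊗[k] X) where
  toFun a := Mult.mk (G.βl a) (G.βr a) (G.βl_βr a)
  map_add' a b := by
    have := G.nondeg
    apply Mult.ext_of_rmul Nondeg.right
    intro t
    change G.βr (a + b) t = G.βr a t + G.βr b t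
    induction t with
    | zero => simp
    | add s t hs ht => simp only [map_add, hs, ht]; abel
    | tmul x y => simp only [βr_tmul, TensorProduct.tmul_add, map_add]
  map_smul' c a := by
    have := G.nondeg
    apply Mult.ext_of_rmul Nondeg.right
    intro t
    change G.βr (c • a) t = c • G.βr a t
    induction t with
    | zero => simp
    | add s t hs ht => simp only [map_add, smul_add, hs, ht]
    | tmul x y => simp only [βr_tmul, TensorProduct.tmul_smul, map_smul]

open Mult in
theorem incl_mul_β (x : X) (a : A) : tmul (incl x) 1 * G.β a = incl (G.V.symm (x ⊗ₜ a)) := by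
  have := G.nondeg
  apply Mult.ext_of_rmul Nondeg.right
  intro t
  change G.βr a ((mulRight k x).rTensor X t) = t * _
  induction t with
  | zero => simp
  | add s t hs ht => simp only [map_add, add_mul, hs, ht]
  | tmul p q =>
    rw [LinearMap.rTensor_tmul, LinearMap.mulRight_apply, βr_tmul, V_symm_mul_left]
    generalize G.V.symm (x ⊗ₜ a) = u
    induction u with
    | zero => simp
    | add s t hs ht => simp only [map_add, mul_add, hs, ht]
    | tmul u v => simp

open Mult in
theorem β_mul_incl (y : X) (a : A) :
    G.β a * tmul 1 (incl y) = incl (G.galoisW.symm (y ⊗ₜ Q.antipode a)) := by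
  have := G.nondeg; have := Q.nondeg
  have h : ∀ x, tmul (incl x) 1 * (G.β a * tmul 1 (incl y)) =
      tmul (incl x) 1 * incl (G.galoisW.symm (y ⊗ₜ Q.antipode a)) := by
    intro x
    rw [← mul_assoc, incl_mul_β, ← incl_lTensor_mulRight, ← incl_rTensor_mulLeft,
      rTensor_mulLeft_galoisW_symm]
  apply Mult.ext_of_lmul Nondeg.left
  intro t
  apply rTensor_mulLeft_cancel G.nondeg_right
  intro x
  exact congrArg (fun m => m.lmul t) (h x)

/-- `x ⊗ y ↦ (x ⊗ 1)β(a)(1 ⊗ y)`. -/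
def βtl (a : A) : X ⊗[k] X →ₗ[k] X ⊗[k] X :=
  G.V.symm.toLinearMap ∘ₗ (mulLeft k a).lTensor X ∘ₗ G.V.toLinearMap

/-- Conjugation by V turns x⊗y ↦ (x⊗1)β(a)(1⊗y) into left multiplication by a on the second leg;
this is why β̃ is multiplicative. -/
theorem βtl_tmul (a : A) (x y : X) :
    G.βtl a (x ⊗ₜ y) = (mulRight k y).lTensor X (G.V.symm (x ⊗ₜ a)) := by
  apply G.V.injective
  rw [V_lTensor_mulRight, LinearEquiv.apply_symm_apply, α_rmul_V]
  simp [βtl]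

variable [Nontrivial X]

/-- The element `(1 ⊗ p)β(a)` of `X ⊗ X`. -/
def inclβ (a : A) : X →ₗ[k] X ⊗[k] X :=
  (TensorProduct.comm k X X).toLinearMap ∘ₗ G.σX.toLinearEquiv.toLinearMap.lTensor X ∘ₗ
    appR G.V.symm.toLinearMap (Q.σ.toLinearEquiv.symm (Q.antipode a))

-- Membership of (1⊗p)β(a) in X⊗X is not formal; it uses the modular automorphisms. By
-- `σX_lTensor_V_symm` with b = σ⁻¹(S(a)), (1⊗p)W⁻¹(w⊗S(a)) is the flip of (ι⊗σ_X)V⁻¹(p⊗b),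
-- multiplied on the right by 1⊗w. Right multiplication by β̃(a) depends on this.
open Mult in
theorem tmul_one_incl_mul_β (p : X) (a : A) :
    tmul 1 (incl p) * G.β a = incl (G.inclβ a p) := by
  have := G.nondeg; have := Q.nondeg
  have h : ∀ w, tmul 1 (incl p) * G.β a * tmul 1 (incl w) =
      incl (G.inclβ a p) * tmul 1 (incl w) := by
    intro w
    rw [mul_assoc, β_mul_incl, ← incl_lTensor_mulRight, ← incl_lTensor_mulLeft, incl_inj]
    have h := congrArg (TensorProduct.comm k X X)
      (G.σX_lTensor_V_symm p w (Q.σ.toLinearEquiv.symm (Q.antipode a)))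
    have hc : ∀ u : X ⊗[k] X, TensorProduct.comm k X X (TensorProduct.comm k X X u) = u :=
      (TensorProduct.comm k X X).symm_apply_apply
    rw [LinearEquiv.apply_symm_apply, hc, lTensor_rTensor, comm_rTensor] at h
    exact h.symm
  apply Mult.ext_of_rmul Nondeg.right
  intro t
  apply lTensor_mulRight_cancel G.nondeg_left
  intro w
  exact congrArg (fun m => m.rmul t) (h w)

theorem lTensor_mulLeft_V_symm (x y : X) (a : A) :
    (mulLeft k y).lTensor X (G.V.symm (x ⊗ₜ a)) = (mulLeft k x).rTensor X (G.inclβ a y) := by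
  have := G.nondeg
  rw [← Mult.incl_inj (k := k), Mult.incl_lTensor_mulLeft, Mult.incl_rTensor_mulLeft, ← incl_mul_β,
    ← tmul_one_incl_mul_β, Mult.tmul_incl_comm_assoc]

/-- `x ⊗ y ↦ (1 ⊗ y)β(a)(x ⊗ 1)`. -/
def βtr (a : A) : X ⊗[k] X →ₗ[k] X ⊗[k] X :=
  TensorProduct.lift (LinearMap.mk₂ k
    (fun x y => (mulRight k x).rTensor X (G.inclβ a y))
    (fun x x' y => by
      rw [show mulRight k (x + x') = mulRight k x + mulRight k x' by ext; simp [mul_add],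
        LinearMap.rTensor_add, LinearMap.add_apply])
    (fun c x y => by
      rw [show mulRight k (c • x) = c • mulRight k x by ext; simp [mul_smul_comm],
        LinearMap.rTensor_smul, LinearMap.smul_apply])
    (fun x y y' => by rw [map_add, map_add])
    (fun c x y => by rw [map_smul, map_smul]))

theorem βtr_tmul (a : A) (x y : X) :
    G.βtr a (x ⊗ₜ y) = (mulRight k x).rTensor X (G.inclβ a y) := rfl

theorem βtl_βtr (a : A) (s t : X ⊗[k] X) :
    (opId s : Xᵐᵒᵖ ⊗[k] X) * opId (G.βtl a t) = opId (G.βtr a s) * opId t := by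
  induction s with
  | zero => simp
  | add s s' hs hs' => simp only [map_add, add_mul, hs, hs']
  | tmul x y =>
    induction t with
    | zero => simp
    | add t t' ht ht' => simp only [map_add, mul_add, ht, ht']
    | tmul p q =>
      have e1 : ∀ u : X ⊗[k] X, (opId (x ⊗ₜ y) : Xᵐᵒᵖ ⊗[k] X) * opId ((mulRight k q).lTensor X u) =
          opId ((mulRight k x).rTensor X ((mulRight k q).lTensor X
            ((mulLeft k y).lTensor X u))) := by
        intro u
        induction u with
        | zero => simp
        | add s s' hs hs' => simp only [map_add, mul_add, hs, hs']
        | tmul u v => simp [opId, mul_assoc]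
      have e2 : ∀ u : X ⊗[k] X, (opId ((mulRight k x).rTensor X u) : Xᵐᵒᵖ ⊗[k] X) *
          opId (p ⊗ₜ q) = opId ((mulRight k x).rTensor X ((mulRight k q).lTensor X
            ((mulLeft k p).rTensor X u))) := by
        intro u
        induction u with
        | zero => simp
        | add s s' hs hs' => simp only [map_add, add_mul, hs, hs']
        | tmul u v => simp [opId, ← MulOpposite.op_mul, mul_assoc]
      rw [βtl_tmul, βtr_tmul, e1, e2, lTensor_mulLeft_V_symm]

/-- The value of `β̃` at `a`. -/
def βtildeMult (a : A) : Mult k (Xᵐᵒᵖ ⊗[k] X) :=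
  Mult.mk ((opId (k := k) (X := X)).toLinearMap ∘ₗ G.βtl a ∘ₗ opId.symm.toLinearMap)
    ((opId (k := k) (X := X)).toLinearMap ∘ₗ G.βtr a ∘ₗ opId.symm.toLinearMap) (by
      intro s t
      obtain ⟨s, rfl⟩ := (opId (k := k) (X := X)).surjective s
      obtain ⟨t, rfl⟩ := (opId (k := k) (X := X)).surjective t
      simpa using G.βtl_βtr a s t)

theorem βtildeMult_lmul (a : A) (t : X ⊗[k] X) :
    (G.βtildeMult a).lmul (opId t) = opId (G.βtl a t) := by
  simp [βtildeMult]

theorem βtildeMult_rmul (a : A) (t : X ⊗[k] X) :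
    (G.βtildeMult a).rmul (opId t) = opId (G.βtr a t) := by
  simp [βtildeMult]

/-- The homomorphism `β̃ : A → M(Xᵒᵖ ⊗ X)`. -/
def βtilde : A →ₙₐ[k] Mult k (Xᵐᵒᵖ ⊗[k] X) :=
  have := G.nondeg
  have key : ∀ {m n : Mult k (Xᵐᵒᵖ ⊗[k] X)}, (∀ t, m.lmul (opId t) = n.lmul (opId t)) → m = n := by
    intro m n h
    apply Mult.ext_of_lmul Nondeg.left
    intro t
    obtain ⟨t, rfl⟩ := (opId (k := k) (X := X)).surjective t
    exact h t
  { toFun := G.βtildeMult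
    map_smul' := fun c a => key fun t => by
      change _ = c • (G.βtildeMult a).lmul (opId t)
      rw [βtildeMult_lmul, βtildeMult_lmul, ← map_smul]
      congr 1
      simp only [βtl, LinearMap.comp_apply]
      rw [show mulLeft k (c • a) = c • mulLeft k a by ext; simp [smul_mul_assoc],
        LinearMap.lTensor_smul, LinearMap.smul_apply, map_smul]
    map_zero' := key fun t => by
      change _ = 0
      rw [βtildeMult_lmul]
      simp only [βtl, LinearMap.comp_apply]
      rw [show mulLeft k (0 : A) = 0 by ext; simp, LinearMap.lTensor_zero, LinearMap.zero_apply,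
        map_zero, map_zero]
    map_add' := fun a b => key fun t => by
      change _ = (G.βtildeMult a).lmul (opId t) + (G.βtildeMult b).lmul (opId t)
      rw [βtildeMult_lmul, βtildeMult_lmul, βtildeMult_lmul, ← map_add]
      congr 1
      simp only [βtl, LinearMap.comp_apply]
      rw [show mulLeft k (a + b) = mulLeft k a + mulLeft k b by ext; simp [add_mul],
        LinearMap.lTensor_add, LinearMap.add_apply, map_add]
    map_mul' := fun a b => key fun t => by
      rw [Mult.lmul_mul, βtildeMult_lmul, βtildeMult_lmul, βtildeMult_lmul]
      congr 1
      simp only [βtl, LinearMap.comp_apply, LinearEquiv.coe_coe, LinearEquiv.apply_symm_apply]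
      rw [LinearMap.mulLeft_mul, LinearMap.lTensor_comp_apply] }

theorem opId_tmul {k X : Type*} [Field k] [NonUnitalRing X] [Module k X] (x y : X) :
    opId (x ⊗ₜ[k] y) = MulOpposite.op x ⊗ₜ y := rfl

open Mult in
theorem incl_βtilde_lmul (a : A) (x y : X) :
    incl (opId.symm ((G.βtilde a).lmul (MulOpposite.op x ⊗ₜ y))) =
      tmul (incl x) 1 * G.β a * tmul 1 (incl y) := by
  have := G.nondeg
  rw [incl_mul_β, ← opId_tmul]
  change incl (opId.symm ((G.βtildeMult a).lmul _)) = _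
  rw [βtildeMult_lmul, LinearEquiv.symm_apply_apply, βtl_tmul, incl_lTensor_mulRight]

open Mult in
theorem incl_βtilde_rmul (a : A) (x y : X) :
    incl (opId.symm ((G.βtilde a).rmul (MulOpposite.op x ⊗ₜ y))) =
      tmul 1 (incl y) * G.β a * tmul (incl x) 1 := by
  have := G.nondeg
  rw [tmul_one_incl_mul_β, ← opId_tmul]
  change incl (opId.symm ((G.βtildeMult a).rmul _)) = _
  rw [βtildeMult_rmul, LinearEquiv.symm_apply_apply, βtr_tmul, incl_rTensor_mulRight]

end GaloisObject

namespace GaloisObject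

variable {k A X : Type*} [Field k]
  [NonUnitalRing A] [Module k A] [IsScalarTower k A A] [SMulCommClass k A A]
  [NonUnitalRing X] [Module k X] [IsScalarTower k X X] [SMulCommClass k X X]
  {Q : AlgebraicQuantumGroup k A} (G : GaloisObject Q X)

open AlgebraicQuantumGroup

/-! ### The homomorphism `β̃` at the modular element -/

/-- The elements V⁻¹(x⊗a)(1⊗y) span X⊗X, since V is onto and products span X. Only the formula for
left multiplication is assumed, so that any choice of β̃ is covered. -/
theorem βtilde_mul_right_cancel {B : A → Mult k (Xᵐᵒᵖ ⊗[k] X)}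
    (hB : ∀ a x y, (B a).lmul (MulOpposite.op x ⊗ₜ y) =
      opId ((mulRight k y).lTensor X (G.V.symm (x ⊗ₜ a)))) {m n : Mult k (Xᵐᵒᵖ ⊗[k] X)}
    (h : ∀ a, m * B a = n * B a) : m = n := by
  have := G.nondeg
  apply Mult.ext_of_lmul Nondeg.left
  intro t
  obtain ⟨t, rfl⟩ := (opId (k := k) (X := X)).surjective t
  induction t with
  | zero => simp
  | add s t hs ht => simp only [map_add, hs, ht]
  | tmul p q =>
    obtain ⟨w, rfl⟩ := G.mul'_surjective q
    induction w with
    | zero => simp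
    | add s t hs ht => simp only [map_add, TensorProduct.tmul_add, hs, ht]
    | tmul q y =>
      have e : p ⊗ₜ[k] (LinearMap.mul' k X) (q ⊗ₜ y) =
          (mulRight k y).lTensor X (G.V.symm (G.V (p ⊗ₜ q))) := by simp
      rw [e]
      generalize G.V (p ⊗ₜ q) = u
      induction u with
      | zero => simp
      | add s t hs ht => simp only [map_add, hs, ht]
      | tmul x a =>
        rw [← hB, ← Mult.lmul_mul, ← Mult.lmul_mul, h]

theorem StructureMaps.βtilde_lmul {G : GaloisObject Q X} {ψX : X →ₗ[k] k} {D : Q.StructureMaps}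
    (E : G.StructureMaps D ψX) (a : A) (x y : X) :
    (E.βtilde a).lmul (MulOpposite.op x ⊗ₜ y) =
      opId ((mulRight k y).lTensor X (G.V.symm (x ⊗ₜ a))) := by
  have := G.nondeg
  have h := E.βtilde_left a x y
  rw [E.β_left, ← Mult.incl_lTensor_mulRight, Mult.incl_inj, LinearEquiv.symm_apply_eq] at h
  exact h

theorem charAct_act (b : A) (x : X) : G.charAct (G.act (Q.charLeft b) x) = G.act b x := by
  have h := congrArg (sliceR Q.φ) (G.charAct_rTensor_T₁ x b)
  have e : Q.φ ∘ₗ Q.charLeft.toLinearEquiv.toLinearMap = Q.φ := LinearMap.ext Q.φ_charLeft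
  rw [sliceR_rTensor, sliceR_lTensor, e] at h
  exact h

/-- The elements ω·x span X, because T₁ is bijective and φ ≠ 0; so the specification leaves no
freedom. -/
theorem StructureMaps.δhatAct_eq {G : GaloisObject Q X} {ψX : X →ₗ[k] k} {D : Q.StructureMaps}
    (E : G.StructureMaps D ψX) (x : X) : E.δhatAct x = G.charAct x := by
  obtain ⟨t, rfl⟩ := sliceR_surjective (M := X) Q.φ_ne_zero x
  obtain ⟨t, rfl⟩ := G.T₁equiv.surjective t
  induction t with
  | zero => simp
  | add s t hs ht => simp only [map_add, hs, ht]
  | tmul x a =>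
    obtain ⟨b, rfl⟩ := Q.charLeft.toLinearEquiv.surjective a
    refine (E.δhatAct_spec _ b x ?_).trans (G.charAct_act b x).symm
    rw [D.δhat_lmul, LinearEquiv.symm_apply_apply]

variable [Nontrivial X] {ψX : X →ₗ[k] k}

theorem extendsTo_α (h : G.IsInvariant ψX) {d : (Mult k X)ˣ}
    (h1 : ∀ x, G.φX ((d : Mult k X).rmul x) = ψX x) :
    Mult.ExtendsTo G.α (d : Mult k X) (Mult.tmul (d : Mult k X) (Q.δu : Mult k A)) :=
  G.extendsTo_of_V (G.V_rmul h h1)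

-- With d in the role of δ_X: (yδ_X⁻¹⊗1)α(δ_Xz) = (yδ_X⁻¹⊗1)(δ_X⊗δ)α(z) = (1⊗δ)(y⊗1)α(z).
open Mult in
theorem V_map_rmul_lmul (h : G.IsInvariant ψX) {d : (Mult k X)ˣ}
    (h1 : ∀ x, G.φX ((d : Mult k X).rmul x) = ψX x) (t : X ⊗[k] X) :
    G.V (TensorProduct.map ((d⁻¹ : (Mult k X)ˣ) : Mult k X).rmul (d : Mult k X).lmul t) =
      (Q.δu : Mult k A).lmul.lTensor X (G.V t) := by
  have := G.nondeg; have := Q.nondeg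
  induction t with
  | zero => simp
  | add s t hs ht => simp only [map_add, hs, ht]
  | tmul y z =>
    rw [TensorProduct.map_tmul, ← incl_inj (k := k), ← lmul_one_tmul, incl_lmul, V_spec, V_spec,
      ← ((G.extendsTo_α h h1).1 z).1, incl_rmul, ← mul_assoc, ← mul_assoc, tmul_mul_tmul,
      tmul_mul_tmul, mul_assoc, Units.inv_mul, mul_one, one_mul, one_mul, mul_one]

theorem V_symm_δu_lmul (h : G.IsInvariant ψX) {d : (Mult k X)ˣ}
    (h1 : ∀ x, G.φX ((d : Mult k X).rmul x) = ψX x) (x : X) (a : A) :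
    G.V.symm (x ⊗ₜ (Q.δu : Mult k A).lmul a) =
      TensorProduct.map ((d⁻¹ : (Mult k X)ˣ) : Mult k X).rmul (d : Mult k X).lmul
        (G.V.symm (x ⊗ₜ a)) := by
  rw [LinearEquiv.symm_apply_eq, G.V_map_rmul_lmul h h1, LinearEquiv.apply_symm_apply,
    LinearMap.lTensor_tmul]

/-- The left identity is `V_symm_δu_lmul` read in Xᵒᵖ⊗X. The right one follows by cancelling B(b) in
B(a)nB(b) = B(a(δb)) = B((aδ)b), where n is the proposed value. -/
theorem extendsTo_βtilde (h : G.IsInvariant ψX) {d : (Mult k X)ˣ}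
    (h1 : ∀ x, G.φX ((d : Mult k X).rmul x) = ψX x) {B : A →ₙₐ[k] Mult k (Xᵐᵒᵖ ⊗[k] X)}
    (hB : ∀ a x y, (B a).lmul (MulOpposite.op x ⊗ₜ y) =
      opId ((mulRight k y).lTensor X (G.V.symm (x ⊗ₜ a)))) :
    Mult.ExtendsTo B (Q.δu : Mult k A)
      (Mult.tmul (Mult.op ((d⁻¹ : (Mult k X)ˣ) : Mult k X)) (d : Mult k X)) := by
  have := G.nondeg
  have hl : ∀ a, Mult.tmul (Mult.op ((d⁻¹ : (Mult k X)ˣ) : Mult k X)) (d : Mult k X) * B a =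
      B ((Q.δu : Mult k A).lmul a) := by
    intro a
    apply Mult.ext_of_lmul Nondeg.left
    intro t
    induction t with
    | zero => simp
    | add s t hs ht => simp only [map_add, hs, ht]
    | tmul x y =>
      obtain ⟨x, rfl⟩ := MulOpposite.op_surjective x
      rw [Mult.lmul_mul, hB, hB, G.V_symm_δu_lmul h h1]
      generalize G.V.symm (x ⊗ₜ a) = u
      induction u with
      | zero => simp
      | add s t hs ht => simp only [map_add, hs, ht]
      | tmul p q =>
        simp only [LinearMap.lTensor_tmul, TensorProduct.map_tmul, LinearMap.mulRight_apply,
          opId_tmul, Mult.lmul_tmul, Mult.lmul_mul']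
        rfl
  refine ⟨fun a => ⟨hl a, G.βtilde_mul_right_cancel hB fun b => ?_⟩,
    fun n hn => G.βtilde_mul_right_cancel hB fun a => by rw [hl, (hn a).1]⟩
  rw [mul_assoc, hl, ← map_mul, ← map_mul, Mult.central]

/-! ### Existence and uniqueness of the structure maps of `X` -/

theorem nonempty_structureMaps (D : Q.StructureMaps) (h : G.IsInvariant ψX) (h0 : ψX ≠ 0) :
    Nonempty (G.StructureMaps D ψX) := by
  obtain ⟨d, h1, -⟩ := G.exists_δX h h0
  exact ⟨{
    W := G.galoisW
    W_spec := G.galoisW_spec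
    β := G.β
    β_left := G.incl_mul_β
    β_right := fun y a => by rw [D.S_eq, β_mul_incl]
    βtilde := G.βtilde
    βtilde_left := G.incl_βtilde_lmul
    βtilde_right := G.incl_βtilde_rmul
    φX := G.φX
    φX_left := G.sliceR_φ_galoisW
    φX_right := fun x y => G.sliceR_φ_V y x
    δX := d
    φX_δX := h1
    σX := G.σX
    φX_mul := fun x y => (G.φX_mul x y).symm
    δhatAct := G.charAct.toLinearEquiv.toLinearMap
    δhatAct_spec := fun a b x hab => by
      rw [D.δhat_lmul] at hab
      rw [← Q.hat_injective hab, LinearEquiv.coe_coe]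
      conv_lhs => rw [← LinearEquiv.apply_symm_apply Q.charLeft.toLinearEquiv a]
      exact G.charAct_act _ x
    θX := G.θX
    θX_eq := fun _ => rfl }⟩

namespace StructureMaps

variable {G} {D : Q.StructureMaps} (E : G.StructureMaps D ψX)

theorem φX_eq : E.φX = G.φX := by
  ext x
  obtain ⟨y, hy⟩ := exists_ne (0 : X)
  have h := E.φX_right x y
  rw [sliceR_φ_V] at h
  exact (smul_left_injective k hy h).symm

theorem σX_eq : E.σX = G.σX := by
  refine AlgAut.ext' fun a => faithful_right_ext G.φX_faithful_right fun x => ?_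
  rw [← G.φX_mul, ← E.φX_eq]
  exact E.φX_mul a x

theorem θX_eq_θX : E.θX = G.θX := by
  refine AlgAut.ext' fun a => ?_
  rw [E.θX_eq, σX_eq, δhatAct_eq]
  rfl

theorem φX_rmul_δX (x : X) : G.φX ((E.δX : Mult k X).rmul x) = ψX x := by
  rw [← E.φX_eq]
  exact E.φX_δX x

theorem ψX_lmul_δX_inv (h : G.IsInvariant ψX) (h0 : ψX ≠ 0) (x : X) :
    ψX (((E.δX⁻¹ : (Mult k X)ˣ) : Mult k X).lmul x) = Q.scaling * G.φX x := by
  have := G.nondeg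
  obtain ⟨d, h1, h2⟩ := G.exists_δX h h0
  have hd : E.δX = d := by
    apply Units.ext
    apply Mult.ext_of_rmul G.nondeg_right
    intro y
    apply faithful_right_ext G.φX_faithful_right
    intro x
    rw [← Mult.rmul_mul', ← Mult.rmul_mul', h1, E.φX_rmul_δX]
  rw [hd, h2]

end StructureMaps

end GaloisObject

end GaloisObj

end

/-! ### The theorem for arbitrary structure maps. -/

open GaloisObj in
theorem mainTheorem6 {k A X : Type*} [Field k]
    [NonUnitalRing A] [Module k A] [IsScalarTower k A A] [SMulCommClass k A A]
    [NonUnitalRing X] [Module k X] [IsScalarTower k X X] [SMulCommClass k X X] [Nontrivial X]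
    (Q : AlgebraicQuantumGroup k A) (G : GaloisObject Q X) :
    -- all the objects in the formulas exist
    Nonempty Q.StructureMaps ∧
    (∃ ψX : X →ₗ[k] k, G.IsInvariant ψX ∧ ψX ≠ 0) ∧
    ∀ (D : Q.StructureMaps) (ψX : X →ₗ[k] k), G.IsInvariant ψX → ψX ≠ 0 →
      Nonempty (G.StructureMaps D ψX) ∧
      ∀ E : G.StructureMaps D ψX,
        -- `α(δ_X) = δ_X ⊗ δ`
        Mult.ExtendsTo G.α (E.δX : Mult k X) (Mult.tmul (E.δX : Mult k X) D.δ) ∧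
        -- `β̃(δ) = δ_X⁻¹ ⊗ δ_X`
        Mult.ExtendsTo E.βtilde D.δ
          (Mult.tmul (Mult.op ((E.δX⁻¹ : (Mult k X)ˣ) : Mult k X)) (E.δX : Mult k X)) ∧
        -- `σ_X(δ_X) = τ⁻¹ δ_X`
        E.σX.onMult (E.δX : Mult k X) = D.τ⁻¹ • (E.δX : Mult k X) ∧
        -- `α ∘ σ_X = (θ_X ⊗ σ) ∘ α`
        (∀ x : X, G.α (E.σX x) = (E.θX.tensor D.σ).onMult (G.α x)) ∧
        -- `α ∘ θ_X = (θ_X ⊗ S²) ∘ α`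
        (∀ x : X, G.α (E.θX x) = (E.θX.tensor D.S2).onMult (G.α x)) ∧
        -- `α ∘ θ_X = (σ_X ⊗ σ'⁻¹) ∘ α`
        (∀ x : X, G.α (E.θX x) = (E.σX.tensor D.σ'.symm).onMult (G.α x)) ∧
        -- `σ_X ∘ θ_X = θ_X ∘ σ_X`
        (∀ x : X, E.σX (E.θX x) = E.θX (E.σX x)) ∧
        -- `θ_X(δ_X) = δ_X`
        E.θX.onMult (E.δX : Mult k X) = (E.δX : Mult k X) ∧
        -- `φ_X ∘ θ_X = φ_X(δ_X⁻¹ · δ_X) = τ φ_X`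
        (∀ x : X, E.φX (E.θX x) =
          E.φX (((E.δX⁻¹ : (Mult k X)ˣ) : Mult k X).lmul ((E.δX : Mult k X).rmul x))) ∧
        (∀ x : X, E.φX (E.θX x) = D.τ * E.φX x) ∧
        -- the scaling constant of `X` is `τ`
        (∀ c : k, (∀ x : X, E.φX (E.θX x) = c * E.φX x) ↔ c = D.τ) := by
  refine ⟨⟨Q.structureMaps⟩, G.exists_isInvariant, fun D ψX h h0 =>
    ⟨G.nonempty_structureMaps D h h0, fun E => ?_⟩⟩
  have := G.nondeg
  have h1 := E.φX_rmul_δX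
  have h2 := E.ψX_lmul_δX_inv h h0
  have hθ : ∀ x, G.φX (G.θX x) = D.τ * G.φX x := fun x => by rw [D.τ_eq, G.φX_θX]
  refine ⟨?_, ?_, ?_, ?_, ?_, ?_, ?_, ?_, ?_, ?_, ?_⟩
  · rw [D.δ_eq]
    exact G.extendsTo_α h h1
  · rw [D.δ_eq]
    exact G.extendsTo_βtilde h h1 E.βtilde_lmul
  · apply Mult.ext_of_rmul G.nondeg_right
    intro x
    rw [E.σX_eq, D.τ_eq]
    change G.σX ((E.δX : Mult k X).rmul (G.σX.toLinearEquiv.symm x)) = _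
    rw [G.σX_rmul h1 h2, LinearEquiv.apply_symm_apply, Mult.rmul_smul]
  · rw [E.σX_eq, E.θX_eq_θX, D.σ_eq]
    exact G.α_eq_onMult G.V_θX_σX
  · rw [E.θX_eq_θX, D.S2_eq]
    exact G.α_eq_onMult G.V_θX_θX
  · rw [E.σX_eq, E.θX_eq_θX, D.σ'_eq]
    exact G.α_eq_onMult G.V_σX_θX
  · rw [E.σX_eq, E.θX_eq_θX]
    exact G.σX_θX
  · apply Mult.ext_of_rmul G.nondeg_right
    intro x
    rw [E.θX_eq_θX]
    change G.θX ((E.δX : Mult k X).rmul (G.θX.toLinearEquiv.symm x)) = _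
    rw [G.θX_rmul h h1 h2, LinearEquiv.apply_symm_apply]
  · intro x
    -- Here φ_X(δ_X⁻¹xδ_X) = ψ_X(δ_X⁻¹x) = τφ_X(x).
    rw [E.φX_eq, E.θX_eq_θX, G.φX_θX, ← Mult.rmul_lmul_comm, h1, h2]
  · rw [E.φX_eq, E.θX_eq_θX]
    exact hθ
  · intro c
    rw [E.φX_eq, E.θX_eq_θX]
    refine ⟨fun hc => ?_, fun hc => hc ▸ hθ⟩
    obtain ⟨e, he⟩ := exists_eq_one_of_ne_zero G.φX_ne_zero
    have := (hc e).symm.trans (hθ e)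
    rwa [he, mul_one, mul_one] at this
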